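/- Let $V$ be a real polynomial of even degree $2l\ge 2$ with positive leading coefficient, let $a>0$, let $n\ge 1$ and let $A_n=\mathrm{diag}(a,0,\dots,0)$ ($n\times n$). For $\beta=1,2,4$ the $n$-dimensional rank 1 $\beta$-external source model is the probability measure with density proportional to - $e^{-n\,\mathrm{Tr}(\frac12V(M)-\frac12A_nM)}$ on the real symmetric $n\times n$ matrices ($\beta=1$), - $e^{-n\,\mathrm{Tr}(V(M)-A_nM)}$ on the complex Hermitian $n\times n$ matrices ($\beta=2$), - $e^{-n\,\mathrm{Tr}(V(M)-\hat A_nM)}$, with $\hat A_n=\mathrm{diag}(a,a,0,0,\dots,0,0)$, on the self-dual Hermitian $2n\times 2n$ matrices ($\beta=4$), with respect to Lebesgue measure on the space of matrices. Let $\xi_{\max}$ be the largest eigenvalue of the random matrix. For $m\ge 0$ let $\mu_{m,\beta}$ be the probability measure on $\mathbb R^m$ with density proportional to $\prod_{i<j}|x_i-x_j|^{\beta}\prod_{j=1}^m e^{-\frac{\beta}{2}mV(x_j)}$, and for $u\in\mathbb R$, $w\in\mathbb C\setminus(-\infty,u]$ let $$Z_{m,\beta}(u,w)=\int_{(-\infty,u)^m}\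 \prod_{j=1}^m \frac{e^{-\frac{\beta}{2}V(x_j)}(u-x_j)^{\beta}}{(w-x_j)^{\beta/2}}\,d\mu_{m,\beta}(x_1,\dots,x_m),$$ where powers with exponent $\beta/2$ are principal branches. For $x\in\mathbb R$ and $s>0$ let $\Pi^x_s$ be the contour that comes from $-\infty-is$ along the horizontal line to $x-is$, goes vertically to $x+is$ and then horizontally to $-\infty+is$. For $s_1>0$ and $s_2>s_1/\sqrt2$ let $\Sigma^x_{s_1,s_2}$ be the contour, symmetric about the real axis, whose upper half goes from $x$ along a segment to $x+e^{3\pi i/4}s_1$, then vertically to $x-s_1/\sqrt2+is_2$, then horizontally to $-\infty+is_2$; it is traversed from $-\infty-is_2$ to $-\infty+is_2$. Let $\beta\in\{2,4\}$, or let $\beta=1$ and $n$ be even. Then there is a constant $\hat C_{n,\beta}\in\mathbb R$ (which may depend on $n,\beta,V,a$) such that $\xi_{\max}$ has a probability density function $f_{\xi_{\max}}$ on $\mathbb R$ which satisfies, for all real $u$, $$f_{\xi_{\max}}(u)=\frac{\hat C_{n,\beta}}{2\pi i}\,e^{-\frac{\beta}{2}nV(u)}\int_{\mathcal C} Z_{n-1,\beta}(u,w)\,\frac{e^{\frac{\beta}{2}anw}}{(w-u)^{\beta/2}}\,dw,$$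 where $\mathcal C$ is any of the contours $\Sigma^x_{s_1,s_2}$ or $\Pi^x_s$ with $x>u$, and all the integrals converge absolutely. -/

import Mathlib

noncomputable section

namespace ExternalSource

open MeasureTheory Matrix

/-! ### Matrix spaces and their Lebesgue measures -/

/-- The Borel (product) `σ`-algebra on a matrix space. -/
instance instMeasurableSpaceMatrix {m n R : Type} [MeasurableSpace R] :
    MeasurableSpace (Matrix m n R) :=
  inferInstanceAs (MeasurableSpace (m → n → R))

/-- Index set of the entries strictly above the diagonal of an `n × n` matrix. -/
abbrev OffDiag (n : ℕ) : Type := {p : Fin n × Fin n // p.1 < p.2}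

/-- The Hermitian matrix (over `R`, with conjugation `star`) with real diagonal entries `d i`
and with entries `z (i, j)` above the diagonal. -/
def hermitianOf {R : Type} [Semiring R] [Algebra ℝ R] [Star R] {n : ℕ}
    (d : Fin n → ℝ) (z : OffDiag n → R) : Matrix (Fin n) (Fin n) R :=
  Matrix.of fun i j =>
    if h : i < j then z ⟨(i, j), h⟩
    else if h' : j < i then star (z ⟨(j, i), h'⟩)
    else algebraMap ℝ R (d i)

/-- The `2 × 2` complex block representing the quaternion `q 0 + q 1 i + q 2 j + q 3 k`.
Quaternionic conjugation is the conjugate transpose of the block. -/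
def quaternionBlock (q : Fin 4 → ℝ) : Matrix (Fin 2) (Fin 2) ℂ :=
  !![(q 0 : ℂ) + q 1 * Complex.I, (q 2 : ℂ) + q 3 * Complex.I;
     -(q 2 : ℂ) + q 3 * Complex.I, (q 0 : ℂ) - q 1 * Complex.I]

/-- Lebesgue measure `∏_{i ≤ j} dM_{ij}` on the real symmetric `n × n` matrices. -/
def lebesgueSymmetric (n : ℕ) : Measure (Matrix (Fin n) (Fin n) ℝ) :=
  Measure.map (fun c : (Fin n → ℝ) × (OffDiag n → ℝ) => hermitianOf c.1 c.2) volume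

/-- Lebesgue measure `∏_i dM_{ii} ∏_{i < j} d(Re M_{ij}) d(Im M_{ij})` on the complex Hermitian
`n × n` matrices. -/
def lebesgueHermitian (n : ℕ) : Measure (Matrix (Fin n) (Fin n) ℂ) :=
  Measure.map (fun c : (Fin n → ℝ) × (OffDiag n → ℂ) => hermitianOf c.1 c.2) volume

/-- Lebesgue measure on the self-dual Hermitian `2n × 2n` matrices: these consist of `2 × 2` blocks
which are the entries of a quaternionic Hermitian `n × n` matrix, and the coordinates are the
`n` real diagonal entries and the four real components of each entry above the diagonal. -/
def lebesgueSelfDual (n : ℕ) : Measure (Matrix (Fin n × Fin 2) (Fin n × Fin 2) ℂ) :=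
  Measure.map (fun c : (Fin n → ℝ) × (OffDiag n → Fin 4 → ℝ) =>
    Matrix.comp (Fin n) (Fin n) (Fin 2) (Fin 2) ℂ
      (hermitianOf c.1 fun p => quaternionBlock (c.2 p))) volume

/-! ### The matrix models with external source -/

section Model

variable {m 𝕜 : Type} [Fintype m] [DecidableEq m] [RCLike 𝕜] [MeasurableSpace 𝕜]

/-- The unnormalized density `exp (-n Tr (W(M) - A M))`. -/
def weight (n : ℕ) (W : Polynomial ℝ) (A M : Matrix m m 𝕜) : ℝ :=
  Real.exp (-(n : ℝ) * RCLike.re (Matrix.trace (Polynomial.aeval M W - A * M)))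

/-- The probability measure `C⁻¹ exp (-n Tr (W(M) - A M)) dM`, where `C` is the normalization
constant. -/
def model (dM : Measure (Matrix m m 𝕜)) (n : ℕ) (W : Polynomial ℝ) (A : Matrix m m 𝕜) :
    Measure (Matrix m m 𝕜) :=
  (∫⁻ M, ENNReal.ofReal (weight n W A M) ∂dM)⁻¹ •
    dM.withDensity fun M => ENNReal.ofReal (weight n W A M)

/-- The largest real eigenvalue (used for Hermitian matrices of positive size). -/
def largestEigenvalue (M : Matrix m m 𝕜) : ℝ := sSup (spectrum ℝ M)

/-- `f` is a probability density function of the largest eigenvalue of a random matrix of law `P`. -/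
def IsLargestEigenvaluePDF (P : Measure (Matrix m m 𝕜)) (f : ℝ → ℝ) : Prop :=
  IsProbabilityMeasure P ∧
  HasPDF largestEigenvalue P volume ∧
  (∀ u, 0 ≤ f u) ∧
  pdf largestEigenvalue P volume =ᵐ[volume] fun u => ENNReal.ofReal (f u)

end Model

/-- The rank one diagonal source `A_n = diag (a, 0, …, 0)`. -/
def source (𝕜 : Type) [RCLike 𝕜] (n : ℕ) (a : ℝ) : Matrix (Fin n) (Fin n) 𝕜 :=
  Matrix.diagonal fun i => if (i : ℕ) = 0 then (a : 𝕜) else 0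

/-- The doubled source `diag (a, a, 0, 0, …, 0, 0)`. -/
def sourceDoubled (n : ℕ) (a : ℝ) : Matrix (Fin n × Fin 2) (Fin n × Fin 2) ℂ :=
  Matrix.diagonal fun p => if (p.1 : ℕ) = 0 then (a : ℂ) else 0

/-- Real symmetric model (`β = 1`), with potential `V / 2` and source `A_n / 2`. -/
def model₁ (n : ℕ) (V : Polynomial ℝ) (a : ℝ) : Measure (Matrix (Fin n) (Fin n) ℝ) :=
  model (lebesgueSymmetric n) n (Polynomial.C (1 / 2 : ℝ) * V) ((1 / 2 : ℝ) • source ℝ n a)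

/-- Hermitian model (`β = 2`), with potential `V` and source `A_n`. -/
def model₂ (n : ℕ) (V : Polynomial ℝ) (a : ℝ) : Measure (Matrix (Fin n) (Fin n) ℂ) :=
  model (lebesgueHermitian n) n V (source ℂ n a)

/-- Self-dual Hermitian model (`β = 4`), with potential `V` and the doubled source. -/
def model₄ (n : ℕ) (V : Polynomial ℝ) (a : ℝ) :
    Measure (Matrix (Fin n × Fin 2) (Fin n × Fin 2) ℂ) :=
  model (lebesgueSelfDual n) n V (sourceDoubled n a)

/-! ### The function `Z_{m,β}(u,w)` -/

/-- `|Δ(x)|^β ∏_j exp (-(β/2) m V(x_j))`. -/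
def betaWeight (β m : ℕ) (V : Polynomial ℝ) (x : Fin m → ℝ) : ℝ :=
  |∏ i, ∏ j ∈ Finset.Ioi i, (x j - x i)| ^ β *
    ∏ j, Real.exp (-((β : ℝ) / 2) * m * V.eval (x j))

/-- The probability measure `μ_{m,β}` on `ℝ^m`. -/
def betaEnsemble (β m : ℕ) (V : Polynomial ℝ) : Measure (Fin m → ℝ) :=
  (∫⁻ x, ENNReal.ofReal (betaWeight β m V x))⁻¹ •
    volume.withDensity fun x => ENNReal.ofReal (betaWeight β m V x)

/-- `P_{m,β}(x; u, w) ∏_j χ_{(-∞,u)}(x_j)`, where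
`P_{m,β} = ∏_j exp (-(β/2) V(x_j)) (u - x_j)^β / (w - x_j)^{β/2}` with the principal branch. -/
def restrictedP (β m : ℕ) (V : Polynomial ℝ) (u : ℝ) (w : ℂ) (x : Fin m → ℝ) : ℂ :=
  (∏ j, (Real.exp (-((β : ℝ) / 2) * V.eval (x j)) : ℂ) * ((u - x j : ℝ) : ℂ) ^ β /
      (w - x j) ^ ((β : ℂ) / 2)) *
    ∏ j, (Set.Iio u).indicator (fun _ => (1 : ℂ)) (x j)

/-- `Z_{m,β}(u,w)`. -/
def Z (β m : ℕ) (V : Polynomial ℝ) (u : ℝ) (w : ℂ) : ℂ :=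
  ∫ x, restrictedP β m V u w x ∂(betaEnsemble β m V)

/-! ### Contours -/

/-- The part `t ≥ 0` of the parametrized contour `Σ^x_{s₁,s₂}`. -/
def sigmaUpper (x s₁ s₂ t : ℝ) : ℂ :=
  if t ≤ s₁ then x + Complex.exp (3 * Real.pi * Complex.I / 4) * t
  else if t ≤ s₂ + (1 - 1 / √2) * s₁ then
    x + Complex.exp (3 * Real.pi * Complex.I / 4) * s₁ + Complex.I * (t - s₁ : ℝ)
  else x - ((√2 - 1) * s₁ : ℝ) + (1 + Complex.I) * s₂ - t

/-- The contour `Σ^x_{s₁,s₂}`, symmetric about the real axis. -/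
def sigmaContour (x s₁ s₂ t : ℝ) : ℂ :=
  if 0 ≤ t then sigmaUpper x s₁ s₂ t else starRingEnd ℂ (sigmaUpper x s₁ s₂ (-t))

/-- The part `t ≥ 0` of the parametrized contour `Π^x_s`. -/
def piUpper (x s t : ℝ) : ℂ :=
  if t ≤ s then x + Complex.I * t else x + (1 + Complex.I) * s - t

/-- The contour `Π^x_s`, symmetric about the real axis. -/
def piContour (x s t : ℝ) : ℂ :=
  if 0 ≤ t then piUpper x s t else starRingEnd ℂ (piUpper x s (-t))

/-- `Z_{n-1,β}(u,w) exp ((β/2) a n w) / (w - u)^{β/2}`, with the principal branch. -/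
def integrand (β n : ℕ) (V : Polynomial ℝ) (a u : ℝ) (w : ℂ) : ℂ :=
  Z β (n - 1) V u w * Complex.exp ((β : ℂ) / 2 * a * n * w) / (w - u) ^ ((β : ℂ) / 2)

/-- For the contour `γ` (infinite in both directions), all integrals in the formula converge
absolutely and
`f(u) = Ĉ / (2πi) exp (-(β/2) n V(u)) ∫_γ Z_{n-1,β}(u,w) exp ((β/2) a n w) / (w - u)^{β/2} dw`. -/
def FormulaAlong (β n : ℕ) (V : Polynomial ℝ) (a : ℝ) (f : ℝ → ℝ) (C u : ℝ) (γ : ℝ → ℂ) : Prop :=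
  (∀ t, Integrable (restrictedP β (n - 1) V u (γ t)) (betaEnsemble β (n - 1) V)) ∧
  Integrable (fun t => integrand β n V a u (γ t) * deriv γ t) ∧
  (f u : ℂ) = (C : ℂ) / (2 * Real.pi * Complex.I) *
    (Real.exp (-((β : ℝ) / 2) * n * V.eval u) : ℂ) *
    ∫ t, integrand β n V a u (γ t) * deriv γ t

/-- The contour formula for `f`, with one constant for all `u` and for all the contours
`Σ^x_{s₁,s₂}` and `Π^x_s` with `x > u`. -/
def HasContourFormula (β n : ℕ) (V : Polynomial ℝ) (a : ℝ) (f : ℝ → ℝ) : Prop :=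
  IsProbabilityMeasure (betaEnsemble β (n - 1) V) ∧
  ∃ C : ℝ, ∀ u x : ℝ, u < x →
    (∀ s₁ s₂ : ℝ, 0 < s₁ → 0 < s₂ → s₁ / √2 < s₂ →
      FormulaAlong β n V a f C u (sigmaContour x s₁ s₂)) ∧
    (∀ s : ℝ, 0 < s → FormulaAlong β n V a f C u (piContour x s))

end ExternalSource

end

namespace ExternalSource

open MeasureTheory Filter Topology Complex

/-! ### Hankel-type contours around a half-line -/

/-! The weight of a matrix `M` in the model depends only on its eigenvalues `x_j` and on one matrix
entry: it is `exp (-(β/2) n ∑ V(x_j))` times `exp (c M₁₁)` with `c = (β/2) a n`. The measure `dM` is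
invariant under conjugation by unitary elements over the reals, complexes or quaternions, so at
fixed eigenvalues `M₁₁` may be replaced by the Rayleigh quotient `ρ(y)` of a Gaussian vector `y`
with `nβ` real coordinates (`HurwitzFrame.lintegral_eig_mul_diag`). Together with Weyl's integration
formula (`HurwitzFrame.exists_lintegral_eig`), this gives the joint eigenvalue density `|Δ(x)|^β ∏
exp (-(β/2) n V(x_j))` times the average of `exp (c ρ(y))`.

That average is a single contour integral. Radial integration shows that `∏ (w - x_j)^{-β/2}` is, up
to a constant, the Gaussian average of `(w - ρ(y))^{-nβ/2}` for real `w` above all `x_j`, and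
analytic continuation extends this to the slit plane (`prod_cpow_eq_integral_gauss`). If `nβ/2 = N +
1` is an integer, Hankel's formula `∫ e^{cw} (w - q)^{-N-1} dw = 2πi c^N/N! e^{cq}` turns the
contour integral of `e^{cw} ∏ (w - x_j)^{-β/2}` into the average of `e^{cρ}`
(`HankelContour.integral_exp_mul_prod_cpow`). This is where `n` even enters for `β = 1`.

The largest eigenvalue is then split off as `u`. The Vandermonde product yields `∏ |u - x_j|^β`, one
factor `exp (-(β/2) V(x_j))` is left over when `nV` is compared with `(n-1)V`, and the factor of the
product belonging to `u` is `(w - u)^{-β/2}`. Interchanging the contour integral with the integral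
over the other eigenvalues gives the formula (`formulaAlong_maxDensity`). All contours of the
statement share the features collected in `HankelContour`, so one argument covers them.

Weyl's formula is proved without a Jacobian. For the Gaussian weight, integration by parts of the
vector field `M ^ k ∏ tr M ^ l` on matrices, and of `x_i ^ k ∏ p_l` on eigenvalues weighted by
`|Δ|^β`, gives the same recursion for mixed moments of power sums (`LoopEquations`). The recursion
fixes the moments up to one factor, exponential moments make the symmetric moment problem
determinate, and the Gaussian factor, a function of the eigenvalues, is finally divided out. -/

/-- A unit speed contour around `(-∞, u]` which eventually runs along two conjugate horizontal
half-lines towards `-∞`. -/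
structure HankelContour (γ : ℝ → ℂ) (u : ℝ) : Prop where
  continuous : Continuous γ
  differentiable : ∃ S : Set ℝ, S.Countable ∧
    ∀ t ∉ S, DifferentiableAt ℝ γ t ∧ ‖deriv γ t‖ ≤ 1
  away : ∃ δ : ℝ, 0 < δ ∧ ∀ t, ∀ q : ℝ, q ≤ u → δ ≤ ‖γ t - q‖
  decay : ∃ A : ℝ, ∀ t, (γ t).re ≤ A - |t|
  tail : ∃ s : ℝ, 0 < s ∧ ∃ r T : ℝ, ∀ t ≥ T, γ t = (r - t : ℝ) + s * I ∧ γ (-t) = (r - t : ℝ) - s * I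

/-- Fundamental theorem of calculus on `[-T, T]` and `T → ∞`. The countable exceptional set absorbs
the corners of the contours. -/
theorem integral_eq_of_hasDerivAt_off_countable_of_tendsto {G g : ℝ → ℂ} {S : Set ℝ}
    (hS : S.Countable) (hG : Continuous G) (hd : ∀ t ∉ S, HasDerivAt G (g t) t)
    (hg : Integrable g) {L : ℂ} (hL : Tendsto (fun T : ℝ => G T - G (-T)) atTop (𝓝 L)) :
    ∫ t, g t = L := by
  have h1 := intervalIntegral_tendsto_integral hg tendsto_neg_atTop_atBot tendsto_id
  refine tendsto_nhds_unique h1 (hL.congr fun T => ?_)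
  exact (integral_eq_of_hasDerivAt_off_countable G g hS hG.continuousOn
    (fun x hx => hd x hx.2) hg.intervalIntegrable).symm

theorem integrable_exp_neg_mul_abs {c : ℝ} (hc : 0 < c) :
    Integrable fun t : ℝ => Real.exp (-c * |t|) := by
  have h1 : IntegrableOn (fun t : ℝ => Real.exp (-c * |t|)) (Set.Ioi 0) := by
    refine (integrableOn_exp_mul_Ioi (a := -c) (by linarith) 0).congr_fun (fun t ht => ?_)
      measurableSet_Ioi
    simp [abs_of_pos (Set.mem_Ioi.1 ht)]
  have h2 : IntegrableOn (fun t : ℝ => Real.exp (-c * |t|)) (Set.Iic 0) := by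
    refine (integrableOn_exp_mul_Iic (a := c) hc 0).congr_fun (fun t ht => ?_) measurableSet_Iic
    simp [abs_of_nonpos (Set.mem_Iic.1 ht)]
  rw [← integrableOn_univ, ← Set.Iic_union_Ioi (a := (0 : ℝ))]
  exact h2.union h1

namespace HankelContour

variable {γ : ℝ → ℂ} {u : ℝ}

theorem sub_ne_zero (h : HankelContour γ u) (t : ℝ) {q : ℝ} (hq : q ≤ u) : γ t - q ≠ 0 := by
  obtain ⟨δ, hδ, H⟩ := h.away
  exact norm_pos_iff.1 (hδ.trans_le (H t q hq))

/-- A point of the cut would make `γ t` a real number at most `u`, at distance zero from the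
half-line. Principal logarithms and powers of `γ - q` are therefore smooth wherever `γ` is. -/
theorem sub_mem_slitPlane (h : HankelContour γ u) (t : ℝ) {q : ℝ} (hq : q ≤ u) :
    γ t - q ∈ slitPlane := by
  rw [mem_slitPlane_iff]
  by_contra hcon
  push Not at hcon
  obtain ⟨h1, h2⟩ := hcon
  simp only [sub_re, ofReal_re, sub_im, ofReal_im, sub_zero] at h1 h2
  exact h.sub_ne_zero t (q := (γ t).re) (by linarith) (Complex.ext (by simp) (by simp [h2]))

theorem ae_norm_deriv_le (h : HankelContour γ u) : ∀ᵐ t : ℝ, ‖deriv γ t‖ ≤ 1 := by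
  obtain ⟨S, hS, H⟩ := h.differentiable
  filter_upwards [hS.ae_notMem volume] with t ht using (H t ht).2

theorem norm_exp_le (h : HankelContour γ u) {c : ℝ} (hc : 0 < c) :
    ∃ K > 0, ∀ t, ‖exp (c * γ t)‖ ≤ K * Real.exp (-c * |t|) := by
  obtain ⟨A, hA⟩ := h.decay
  refine ⟨Real.exp (c * A), Real.exp_pos _, fun t => ?_⟩
  rw [norm_exp, ← Real.exp_add, Real.exp_le_exp]
  simp only [mul_re, ofReal_re, ofReal_im, zero_mul, sub_zero]
  nlinarith [hA t]

/-- A measurable function dominated by `exp (c γ)` is integrable along the contour. -/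
theorem integrable_mul_deriv (h : HankelContour γ u) {c : ℝ} (hc : 0 < c) {G : ℝ → ℂ}
    (hG : AEStronglyMeasurable G) {B : ℝ} (hB : ∀ t, ‖G t‖ ≤ B * ‖exp (c * γ t)‖) :
    Integrable fun t => G t * deriv γ t := by
  obtain ⟨K, hK, H⟩ := h.norm_exp_le hc
  refine ((integrable_exp_neg_mul_abs hc).const_mul (|B| * K)).mono'
    (hG.mul (measurable_deriv γ).aestronglyMeasurable) ?_
  filter_upwards [h.ae_norm_deriv_le] with t ht
  calc ‖G t * deriv γ t‖ ≤ ‖G t‖ * 1 := by rw [norm_mul]; gcongr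
    _ ≤ |B| * ‖exp (c * γ t)‖ := by
      rw [mul_one]; exact (hB t).trans (by gcongr; exact le_abs_self B)
    _ ≤ |B| * K * Real.exp (-c * |t|) := by rw [mul_assoc]; gcongr; exact H t

theorem continuous_exp_div_pow (h : HankelContour γ u) (c : ℝ) {q : ℝ} (hq : q ≤ u) (k : ℕ) :
    Continuous fun t => exp (c * γ t) / (γ t - q) ^ k := by
  have := h.continuous
  exact Continuous.div (by fun_prop) (by fun_prop) fun t => pow_ne_zero _ (h.sub_ne_zero t hq)

theorem integrable_exp_div_pow (h : HankelContour γ u) {c : ℝ} (hc : 0 < c) {q : ℝ} (hq : q ≤ u)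
    (k : ℕ) : Integrable fun t => exp (c * γ t) / (γ t - q) ^ k * deriv γ t := by
  obtain ⟨δ, hδ, H⟩ := h.away
  refine h.integrable_mul_deriv hc (B := (δ ^ k)⁻¹)
    (h.continuous_exp_div_pow c hq k).aestronglyMeasurable fun t => ?_
  rw [norm_div, norm_pow, div_eq_inv_mul]
  gcongr
  exact H t q hq

theorem tendsto_exp_div_pow (h : HankelContour γ u) {c : ℝ} (hc : 0 < c) {q : ℝ} (hq : q ≤ u)
    (k : ℕ) : Tendsto (fun t => exp (c * γ t) / (γ t - q) ^ k) (cocompact ℝ) (𝓝 0) := by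
  obtain ⟨δ, hδ, H⟩ := h.away
  obtain ⟨K, hK, H'⟩ := h.norm_exp_le hc
  have h0 : Tendsto (fun t : ℝ => (δ ^ k)⁻¹ * (K * Real.exp (-c * |t|))) (cocompact ℝ) (𝓝 0) := by
    have h1 : Tendsto (fun t : ℝ => c * |t|) (cocompact ℝ) atTop :=
      (tendsto_norm_cocompact_atTop (E := ℝ)).const_mul_atTop hc
    have h2 := (Real.tendsto_exp_neg_atTop_nhds_zero.comp h1).const_mul ((δ ^ k)⁻¹ * K)
    simpa [mul_assoc, Function.comp_def] using h2
  refine squeeze_zero_norm (fun t => ?_) h0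
  rw [norm_div, norm_pow, div_eq_inv_mul]
  gcongr
  · exact H t q hq
  · exact H' t

/-- The two ends are conjugate, so the difference of logarithms is `2i arg (γ T - q)`. Divided by `T
> 0`, the point `γ T - q` tends to `-1` from the upper half-plane, hence its argument tends to `π`.
-/
theorem tendsto_log_sub (h : HankelContour γ u) {q : ℝ} (hq : q ≤ u) :
    Tendsto (fun T => log (γ T - q) - log (γ (-T) - q)) atTop (𝓝 (2 * Real.pi * I)) := by
  obtain ⟨s, hs, r, T₀, hT⟩ := h.tail
  have e : ∀ᶠ T : ℝ in atTop, (2 * (log (γ T - q)).im : ℝ) * I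
      = log (γ T - q) - log (γ (-T) - q) := by
    filter_upwards [eventually_ge_atTop T₀] with T h0
    have hc : γ (-T) - q = (starRingEnd ℂ) (γ T - q) := by
      rw [(hT T h0).1, (hT T h0).2]; apply Complex.ext <;> simp
    rw [hc, log_conj _ (mem_slitPlane_iff_arg.1 (h.sub_mem_slitPlane T hq)).1, sub_conj]
  refine Tendsto.congr' e ?_
  have hlim : Tendsto (fun T => (log (γ T - q)).im) atTop (𝓝 Real.pi) := by
    have hz : Tendsto (fun T : ℝ => ((r - q) / T - 1 : ℝ) + (s / T : ℝ) * I) atTop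
        (𝓝[{z | 0 ≤ z.im}] (-1)) := by
      refine tendsto_nhdsWithin_iff.2 ⟨?_, ?_⟩
      · have h1 : Tendsto (fun T : ℝ => (r - q) / T) atTop (𝓝 0) :=
          tendsto_const_nhds.div_atTop tendsto_id
        have h2 : Tendsto (fun T : ℝ => s / T) atTop (𝓝 0) :=
          tendsto_const_nhds.div_atTop tendsto_id
        have h3 := ((continuous_ofReal.tendsto _).comp (h1.sub_const 1)).add
          (((continuous_ofReal.tendsto _).comp h2).mul_const I)
        simpa [Function.comp_def] using h3
      · filter_upwards [eventually_gt_atTop 0] with T h0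
        simp only [add_im, ofReal_im, mul_im, ofReal_re, I_im, I_re]
        have : 0 < s / T := div_pos hs h0
        simp [this.le]
    have ha := (tendsto_arg_nhdsWithin_im_nonneg_of_re_neg_of_im_zero (z := -1)
      (by simp) (by simp)).comp hz
    refine ha.congr' ?_
    filter_upwards [eventually_ge_atTop T₀, eventually_gt_atTop 0] with T h0 h1
    rw [log_im, (hT T h0).1]
    have : (↑(r - T) + s * I - q : ℂ)
        = (T : ℝ) * (((r - q) / T - 1 : ℝ) + (s / T : ℝ) * I) := by
      have : (T : ℂ) ≠ 0 := by exact_mod_cast h1.ne'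
      push_cast; field_simp; ring
    rw [Function.comp_apply, this, arg_real_mul _ h1]
  have h2 := ((continuous_ofReal.tendsto _).comp (hlim.const_mul 2)).mul_const I
  simpa [Function.comp_def] using h2

/-- Hankel's formula for the simple pole. -/
theorem integral_exp_div (h : HankelContour γ u) {c : ℝ} (hc : 0 < c) {q : ℝ} (hq : q ≤ u) :
    ∫ t, exp (c * γ t) / (γ t - q) * deriv γ t = 2 * Real.pi * I * exp (c * q) := by
  -- `dslope exp 0` is the entire function `(e^z - 1)/z`; let `E` be a primitive. Since `e^{cw}/(w -
  -- q) = e^{cq} (c (e^z - 1)/z + 1/(w - q))` with `z = c(w - q)`, a primitive along `γ` is `e^{cq}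
  -- (E(c(γ - q)) + log (γ - q))`. Only the logarithm will have a nonzero increment.
  have hdiff : Differentiable ℂ (dslope exp 0) := by
    rw [← differentiableOn_univ, differentiableOn_dslope univ_mem]
    exact differentiable_exp.differentiableOn
  obtain ⟨E, hE⟩ := hdiff.isExactOn_univ
  replace hE : ∀ z, HasDerivAt E (dslope exp 0 z) z := fun z => hE z trivial
  obtain ⟨S, hS, hSd⟩ := h.differentiable
  have hcont := h.continuous
  have hEc : Continuous E := continuous_iff_continuousAt.2 fun z => (hE z).continuousAt
  have hi := h.integrable_exp_div_pow hc hq 1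
  simp only [pow_one] at hi
  refine integral_eq_of_hasDerivAt_off_countable_of_tendsto
    (G := fun t => exp (c * q) * (E (c * (γ t - q)) + log (γ t - q))) hS ?_ ?_ hi ?_
  · refine continuous_const.mul (Continuous.add (by fun_prop) ?_)
    exact Continuous.clog (by fun_prop) fun t => h.sub_mem_slitPlane t hq
  · intro t ht
    have h1 : HasDerivAt (fun t => γ t - q) (deriv γ t) t := (hSd t ht).1.hasDerivAt.sub_const _
    have h2 := (hE (c * (γ t - q))).comp t (h1.const_mul (c : ℂ))
    have h3 := h1.clog_real (h.sub_mem_slitPlane t hq)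
    have h4 := (h2.add h3).const_mul (exp (c * q))
    refine h4.congr_deriv ?_
    have hne := h.sub_ne_zero t hq
    have hcne : (c : ℂ) ≠ 0 := by exact_mod_cast hc.ne'
    rw [dslope_of_ne _ (mul_ne_zero hcne hne), slope_def_field, exp_zero]
    have : exp (c * γ t) = exp (c * q) * exp (c * (γ t - q)) := by
      rw [← exp_add]; ring_nf
    rw [this]
    field_simp
    ring
  · obtain ⟨s, hs, r, T₀, hT⟩ := h.tail
    -- The chord between the two ends has the fixed length `2cs` and lies in the half-plane `Re z ≤
    -- -c(T - r + q)`. There `|(e^z - 1)/z| ≤ 2/(c(T - r + q))`, so the increment of `E` tends to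
    -- zero.
    have hEl : Tendsto (fun T => E (c * (γ T - q)) - E (c * (γ (-T) - q))) atTop (𝓝 0) := by
      have hb : Tendsto (fun T : ℝ => 2 / (c * (T - r + q)) * (2 * c * s)) atTop (𝓝 0) := by
        have : Tendsto (fun T : ℝ => c * (T - r + q)) atTop atTop := by
          refine Tendsto.const_mul_atTop hc ?_
          exact tendsto_atTop_add_const_right _ _ (tendsto_atTop_add_const_right _ (-r) tendsto_id)
        simpa using (tendsto_const_nhds.div_atTop this).mul_const (2 * c * s)
      refine squeeze_zero_norm' ?_ hb
      filter_upwards [eventually_ge_atTop T₀, eventually_gt_atTop (r - q)] with T h0 h1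
      have hpos : 0 < c * (T - r + q) := mul_pos hc (by linarith)
      have hconv : Convex ℝ {z : ℂ | z.re ≤ -(c * (T - r + q))} := convex_halfSpace_re_le _
      have key := hconv.norm_image_sub_le_of_norm_hasDerivWithin_le (f := E)
        (f' := fun z => dslope exp 0 z) (C := 2 / (c * (T - r + q)))
        (fun z _ => (hE z).hasDerivWithinAt) (fun z hz => ?_)
        (x := c * (γ (-T) - q)) (y := c * (γ T - q)) ?_ ?_
      · refine key.trans (le_of_eq ?_)
        rw [(hT T h0).1, (hT T h0).2]
        have : (c * (↑(r - T) + s * I - q) - c * (↑(r - T) - s * I - q) : ℂ)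
            = ((2 * c * s : ℝ) : ℂ) * I := by push_cast; ring
        rw [this, norm_mul, norm_I, mul_one, norm_real, Real.norm_of_nonneg (by positivity)]
      · have hz' : z.re ≤ -(c * (T - r + q)) := hz
        have hz0 : z ≠ 0 := by rintro rfl; simp at hz'; linarith
        rw [dslope_of_ne _ hz0, slope_def_field, exp_zero, sub_zero, norm_div]
        have hn : c * (T - r + q) ≤ ‖z‖ := by
          have := abs_re_le_norm z
          rw [abs_of_nonpos (by linarith)] at this
          linarith
        gcongr
        calc ‖exp z - 1‖ ≤ ‖exp z‖ + ‖(1 : ℂ)‖ := norm_sub_le _ _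
          _ ≤ 1 + 1 := by
            gcongr
            · rw [norm_exp]; exact Real.exp_le_one_iff.2 (by linarith)
            · simp
          _ = 2 := by norm_num
      · simp [(hT T h0).2]; nlinarith
      · simp [(hT T h0).1]; nlinarith
    have := (hEl.add (h.tendsto_log_sub hq)).const_mul (exp (c * q))
    rw [zero_add, mul_comm (exp (c * q))] at this
    refine this.congr fun T => ?_
    ring

/-- Hankel's formula for a pole of arbitrary order. -/
theorem integral_exp_div_pow (h : HankelContour γ u) {c : ℝ} (hc : 0 < c) {q : ℝ} (hq : q ≤ u)
    (k : ℕ) : ∫ t, exp (c * γ t) / (γ t - q) ^ (k + 1) * deriv γ t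
      = 2 * Real.pi * I * (c ^ k / k.factorial) * exp (c * q) := by
  induction k with
  | zero => simpa using h.integral_exp_div hc hq
  | succ k ih =>
    obtain ⟨S, hS, hSd⟩ := h.differentiable
    have h1 := (h.integrable_exp_div_pow hc hq (k + 1)).const_mul (c : ℂ)
    have h2 := (h.integrable_exp_div_pow hc hq (k + 2)).const_mul ((k : ℂ) + 1)
    -- The total derivative of `e^{cγ} (γ - q)^{-(k+1)}` integrates to zero, because this function
    -- vanishes at both ends. That expresses the pole of order `k + 2` through the pole of order `k
    -- + 1`.
    have key := integral_eq_of_hasDerivAt_off_countable_of_tendsto (L := 0) hS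
      (h.continuous_exp_div_pow c hq (k + 1)) (fun t ht => ?_) (h1.sub h2) ?_
    · simp only [Pi.sub_apply] at key
      rw [integral_sub h1 h2, integral_const_mul, integral_const_mul, ih, sub_eq_zero] at key
      have hk : (k : ℂ) + 1 ≠ 0 := by exact_mod_cast k.succ_ne_zero
      have hf : (k.factorial : ℂ) ≠ 0 := by exact_mod_cast k.factorial_ne_zero
      refine mul_left_cancel₀ hk (key.symm.trans ?_)
      rw [Nat.factorial_succ]
      push_cast
      field_simp
      rw [pow_succ']
    · have hd : HasDerivAt γ (deriv γ t) t := (hSd t ht).1.hasDerivAt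
      have hne := h.sub_ne_zero t hq
      have h3 := ((hd.const_mul (c : ℂ)).cexp).div ((hd.sub_const (q : ℂ)).pow (k + 1))
        (pow_ne_zero _ hne)
      refine h3.congr_deriv ?_
      simp only [Pi.pow_apply, Pi.sub_apply, Nat.add_sub_cancel]
      push_cast
      generalize γ t - q = z at hne ⊢
      field_simp
      ring
    · have h3 := h.tendsto_exp_div_pow hc hq (k + 1)
      have h4 := (h3.mono_left (atTop_le_cocompact)).sub
        ((h3.mono_left (atBot_le_cocompact)).comp tendsto_neg_atTop_atBot)
      simpa [Function.comp_def] using h4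

end HankelContour

/-! ### The contours `Π` and `Σ` are Hankel contours. -/

section Contours

variable {g : ℝ → ℂ} {u x : ℝ}

/-- Conjugation preserves real parts and distances to real points, so it suffices to check the upper
half. The halves fit together because the starting point is real. -/
theorem hankelContour_of_upper (hg : Continuous g) (hg0 : g 0 = x) {S : Set ℝ} (hS : S.Countable)
    (hd : ∀ t ∉ S, ∃ d, HasDerivAt g d t ∧ ‖d‖ ≤ 1)
    (haway : ∃ δ : ℝ, 0 < δ ∧ ∀ t, 0 ≤ t → ∀ q : ℝ, q ≤ u → δ ≤ ‖g t - q‖)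
    {A : ℝ} (hA : ∀ t, 0 ≤ t → (g t).re ≤ A - t)
    {s r T : ℝ} (hs : 0 < s) (htail : ∀ t, T ≤ t → g t = (r - t : ℝ) + s * I) :
    HankelContour (fun t => if 0 ≤ t then g t else starRingEnd ℂ (g (-t))) u where
  continuous := by
    refine Continuous.if_le hg (continuous_conj.comp (hg.comp continuous_neg)) continuous_const
      continuous_id ?_
    rintro t rfl
    simp [hg0]
  differentiable := by
    refine ⟨insert 0 (S ∪ Neg.neg ⁻¹' S), ?_, fun t ht => ?_⟩
    · exact (hS.union (hS.preimage neg_injective)).insert 0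
    · simp only [Set.mem_insert_iff, Set.mem_union, Set.mem_preimage, not_or] at ht
      obtain ⟨h0, h1, h2⟩ := ht
      suffices H : ∃ d, HasDerivAt (fun t => if 0 ≤ t then g t else starRingEnd ℂ (g (-t))) d t ∧
          ‖d‖ ≤ 1 by
        obtain ⟨d, h3, h4⟩ := H
        exact ⟨h3.differentiableAt, by rwa [h3.deriv]⟩
      rcases lt_or_gt_of_ne h0 with h | h
      · obtain ⟨d, h3, h4⟩ := hd _ h2
        refine ⟨starRingEnd ℂ (-d), ?_, by simpa using h4⟩
        have h5 : HasDerivAt (fun t => g (-t)) (-d) t := by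
          simpa [Function.comp_def] using h3.scomp t (hasDerivAt_neg t)
        have h6 : HasDerivAt (fun t => starRingEnd ℂ (g (-t))) (starRingEnd ℂ (-d)) t := h5.star
        refine h6.congr_of_eventuallyEq ?_
        filter_upwards [gt_mem_nhds h] with y hy using if_neg (not_le.2 hy)
      · obtain ⟨d, h3, h4⟩ := hd _ h1
        refine ⟨d, h3.congr_of_eventuallyEq ?_, h4⟩
        filter_upwards [lt_mem_nhds h] with y hy using if_pos hy.le
  away := by
    obtain ⟨δ, hδ, H⟩ := haway
    refine ⟨δ, hδ, fun t q hq => ?_⟩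
    split_ifs with h
    · exact H t h q hq
    · have := H (-t) (by linarith) q hq
      rwa [← norm_conj, map_sub, conj_ofReal] at this
  decay := by
    refine ⟨A, fun t => ?_⟩
    split_ifs with h
    · rw [abs_of_nonneg h]; exact hA t h
    · rw [conj_re, abs_of_neg (not_le.1 h)]
      exact hA _ (by linarith)
  tail := by
    -- The lower bound `1` makes `-t` negative, which selects the reflected branch.
    refine ⟨s, hs, r, max T 1, fun t ht => ?_⟩
    have h1 : 1 ≤ t := (le_max_right _ _).trans ht
    have h2 := htail t ((le_max_left _ _).trans ht)
    refine ⟨by rw [if_pos (by linarith), h2], ?_⟩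
    rw [if_neg (by linarith), neg_neg, h2]
    simp [sub_eq_add_neg]

theorem exp_three_pi_div_four :
    exp (3 * Real.pi * I / 4) = ((-(1 / √2) : ℝ) : ℂ) + ((1 / √2 : ℝ) : ℂ) * I := by
  have h1 : (3 * Real.pi * I / 4 : ℂ) = ((Real.pi - Real.pi / 4 : ℝ) : ℂ) * I := by
    push_cast; ring
  have h2 : √2 / 2 = 1 / √2 := by
    rw [div_eq_div_iff (by norm_num) (by positivity)]; simp
  rw [h1, exp_mul_I, ← ofReal_cos, ← ofReal_sin, Real.cos_pi_sub, Real.sin_pi_sub,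
    Real.cos_pi_div_four, Real.sin_pi_div_four, h2]

theorem norm_sub_ofReal_ge_of_re (z : ℂ) {q : ℝ} {δ : ℝ} (h : q + δ ≤ z.re) : δ ≤ ‖z - q‖ := by
  refine le_trans ?_ (re_le_norm _)
  simp; linarith

theorem norm_sub_ofReal_ge_of_im (z : ℂ) (q : ℝ) {δ : ℝ} (h : δ ≤ z.im) : δ ≤ ‖z - q‖ := by
  refine le_trans ?_ (im_le_norm _)
  simpa using h

theorem hankelContour_piContour (hx : u < x) {s : ℝ} (hs : 0 < s) :
    HankelContour (piContour x s) u := by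
  refine hankelContour_of_upper (g := piUpper x s) (x := x) (S := {s}) (A := x + s) (s := s)
    (r := x + s) (T := s) ?_ ?_ (Set.countable_singleton s) ?_ ?_ ?_ hs ?_
  · unfold piUpper
    refine Continuous.if_le (by fun_prop) (by fun_prop) continuous_id continuous_const ?_
    rintro t rfl
    ring
  · simp [piUpper, hs.le]
  · intro t ht
    rcases lt_or_gt_of_ne ht with h | h
    · refine ⟨I, ?_, by simp⟩
      have h1 : HasDerivAt (fun t : ℝ => (x : ℂ) + I * t) I t := by
        simpa using ((hasDerivAt_id t).ofReal_comp.const_mul I).const_add (x : ℂ)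
      refine h1.congr_of_eventuallyEq ?_
      filter_upwards [gt_mem_nhds h] with y hy using if_pos hy.le
    · refine ⟨-1, ?_, by simp⟩
      have h1 : HasDerivAt (fun t : ℝ => (x : ℂ) + (1 + I) * s - t) (-1) t := by
        simpa using (hasDerivAt_id t).ofReal_comp.const_sub ((x : ℂ) + (1 + I) * s)
      refine h1.congr_of_eventuallyEq ?_
      filter_upwards [lt_mem_nhds h] with y hy using if_neg (not_le.2 hy)
  · refine ⟨min (x - u) s, by simp [hx, hs], fun t ht q hq => ?_⟩
    unfold piUpper
    split_ifs with h
    · refine (min_le_left _ _).trans (norm_sub_ofReal_ge_of_re _ ?_)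
      simp; linarith
    · refine (min_le_right _ _).trans (norm_sub_ofReal_ge_of_im _ _ ?_)
      simp
  · intro t ht
    unfold piUpper
    split_ifs with h <;> simp
    linarith
  · intro t ht
    rcases ht.eq_or_lt with rfl | h
    · simp [piUpper]; ring
    · rw [piUpper, if_neg (not_le.2 h)]; push_cast; ring

theorem hankelContour_sigmaContour (hx : u < x) {s₁ s₂ : ℝ} (hs₁ : 0 < s₁)
    (hs : s₁ / √2 < s₂) : HankelContour (sigmaContour x s₁ s₂) u := by
  have hs₂ : 0 < s₂ := lt_trans (by positivity) hs
  have h2 : 1 ≤ √2 := by rw [Real.one_le_sqrt]; norm_num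
  have h2i : 0 < 1 / √2 := by positivity
  have h2' : 1 / √2 ≤ 1 := by rw [div_le_one (by positivity)]; exact h2
  have h2m : 2 * (1 / √2) = √2 := by
    field_simp; simp
  have hs' : s₁ < s₂ + (1 - 1 / √2) * s₁ := by
    have : s₁ / √2 = 1 / √2 * s₁ := by ring
    nlinarith
  set m := s₂ + (1 - 1 / √2) * s₁ with hm
  have hup : sigmaUpper x s₁ s₂ = fun t => if t ≤ s₁ then
      (x : ℂ) + (((-(1 / √2) : ℝ) : ℂ) + ((1 / √2 : ℝ) : ℂ) * I) * t
      else if t ≤ m then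
      (x : ℂ) + (((-(1 / √2) : ℝ) : ℂ) + ((1 / √2 : ℝ) : ℂ) * I) * s₁ + I * (t - s₁ : ℝ)
      else x - ((√2 - 1) * s₁ : ℝ) + (1 + I) * s₂ - t := by
    funext t
    rw [sigmaUpper, exp_three_pi_div_four]
  change HankelContour (fun t => if 0 ≤ t then sigmaUpper x s₁ s₂ t else
    starRingEnd ℂ (sigmaUpper x s₁ s₂ (-t))) u
  rw [hup]
  generalize hj : 1 / √2 = j at *
  rw [← h2m]
  refine hankelContour_of_upper (x := x) (S := {s₁, m}) (A := x + m) (s := s₂)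
    (r := x - (2 * j - 1) * s₁ + s₂) (T := m + 1) ?_ ?_ ((Set.finite_singleton m).insert s₁).countable
    ?_ ?_ ?_ hs₂ ?_
  · refine Continuous.if_le (by fun_prop) (Continuous.if_le (by fun_prop) (by fun_prop)
      continuous_id continuous_const ?_) continuous_id continuous_const ?_
    · rintro t rfl
      rw [hm]; push_cast; ring
    · rintro t rfl
      rw [if_pos hs'.le]; push_cast; ring
  · simp [hs₁.le]
  · intro t ht
    simp only [Set.mem_insert_iff, Set.mem_singleton_iff, not_or] at ht
    rcases lt_or_gt_of_ne ht.1 with h | h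
    · refine ⟨((-j : ℝ) : ℂ) + (j : ℂ) * I, ?_, ?_⟩
      · have h1 : HasDerivAt (fun t : ℝ => (x : ℂ) + (((-j : ℝ) : ℂ) + (j : ℂ) * I) * t)
            (((-j : ℝ) : ℂ) + (j : ℂ) * I) t := by
          simpa using ((hasDerivAt_id t).ofReal_comp.const_mul
            (((-j : ℝ) : ℂ) + (j : ℂ) * I)).const_add (x : ℂ)
        refine h1.congr_of_eventuallyEq ?_
        filter_upwards [gt_mem_nhds h] with y hy using if_pos hy.le
      · rw [← hj, ← exp_three_pi_div_four]
        have : (3 * Real.pi * I / 4 : ℂ) = ((3 * Real.pi / 4 : ℝ) : ℂ) * I := by push_cast; ring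
        rw [this, norm_exp_ofReal_mul_I]
    rcases lt_or_gt_of_ne ht.2 with h' | h'
    · refine ⟨I, ?_, by simp⟩
      have h1 : HasDerivAt (fun t : ℝ => (x : ℂ) + (((-j : ℝ) : ℂ) + (j : ℂ) * I) * s₁
          + I * (t - s₁ : ℝ)) I t := by
        simpa using (((hasDerivAt_id t).sub_const s₁).ofReal_comp.const_mul I).const_add
          ((x : ℂ) + (((-j : ℝ) : ℂ) + (j : ℂ) * I) * s₁)
      refine h1.congr_of_eventuallyEq ?_
      filter_upwards [lt_mem_nhds h, gt_mem_nhds h'] with y hy hy'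
      rw [if_neg (not_le.2 hy), if_pos hy'.le]
    · refine ⟨-1, ?_, by simp⟩
      have h1 : HasDerivAt (fun t : ℝ => (x : ℂ) - ((2 * j - 1) * s₁ : ℝ) + (1 + I) * s₂ - t)
          (-1) t := by
        simpa using (hasDerivAt_id t).ofReal_comp.const_sub
          ((x : ℂ) - ((2 * j - 1) * s₁ : ℝ) + (1 + I) * s₂)
      refine h1.congr_of_eventuallyEq ?_
      filter_upwards [lt_mem_nhds h, lt_mem_nhds h'] with y hy hy'
      rw [if_neg (not_le.2 hy), if_neg (not_le.2 hy')]
  -- On the slanted segment the height is `j t` and the real part `x - j t`: either the height is at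
  -- least `(x - u)/2`, or the real part exceeds `u` by at least that much. On the vertical segment
  -- the height is at least `j s₁`, on the horizontal one it is `s₂`.
  · refine ⟨min ((x - u) / 2) (min (j * s₁) s₂), by simp; exact ⟨hx, by positivity, hs₂⟩,
      fun t ht q hq => ?_⟩
    split_ifs with h h'
    · refine (min_le_left _ _).trans ?_
      by_cases hc : (x - u) / 2 ≤ j * t
      · refine norm_sub_ofReal_ge_of_im _ _ ?_
        simpa using hc
      · refine norm_sub_ofReal_ge_of_re _ ?_
        simp; linarith
    · refine (min_le_right _ _).trans ((min_le_left _ _).trans (norm_sub_ofReal_ge_of_im _ _ ?_))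
      simp; linarith
    · refine (min_le_right _ _).trans ((min_le_right _ _).trans (norm_sub_ofReal_ge_of_im _ _ ?_))
      simp
  · intro t ht
    split_ifs with h h'
    · simp; nlinarith
    · simp; nlinarith
    · simp
      have : s₂ + s₁ - j * s₁ = m := by rw [hm]; ring
      nlinarith
  · intro t ht
    rw [if_neg (by linarith), if_neg (by linarith)]; push_cast; ring

end Contours

end ExternalSource

namespace ExternalSource

open MeasureTheory Filter Topology

/-! ### Gaussian averages of Rayleigh quotients -/

section Polar

variable {E : Type*} [NormedAddCommGroup E] [NormedSpace ℝ E] [FiniteDimensional ℝ E]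
  [MeasurableSpace E] [BorelSpace E] (μ : Measure E) [μ.IsAddHaarMeasure]

/-- Polar coordinates; the origin is a null set because `E` is nontrivial. -/
theorem lintegral_eq_lintegral_sphere [Nontrivial E] {f : E → ENNReal} (hf : Measurable f) :
    ∫⁻ y, f y ∂μ = ∫⁻ s : Metric.sphere (0 : E) 1, (∫⁻ r : ℝ in Set.Ioi (0 : ℝ),
      ENNReal.ofReal (r ^ (Module.finrank ℝ E - 1)) * f (r • (s : E))) ∂μ.toSphere := by
  have h0 : MeasurableSet ({0}ᶜ : Set E) := (measurableSet_singleton 0).compl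
  have hpos : Measurable fun r : Set.Ioi (0 : ℝ) =>
      ENNReal.ofReal ((r : ℝ) ^ (Module.finrank ℝ E - 1)) := by fun_prop
  have hmp := μ.measurePreserving_homeomorphUnitSphereProd
  have hfp : Measurable fun p : Metric.sphere (0 : E) 1 × Set.Ioi (0 : ℝ) =>
      f ((p.2 : ℝ) • (p.1 : E)) := by fun_prop
  calc ∫⁻ y, f y ∂μ = ∫⁻ y in {0}ᶜ, f y ∂μ := by rw [restrict_compl_singleton]
    _ = ∫⁻ y : ({0}ᶜ : Set E), f y ∂(μ.comap Subtype.val) := (lintegral_subtype_comap h0 f).symm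
    _ = ∫⁻ p, f ((p.2 : ℝ) • (p.1 : E))
          ∂(μ.toSphere.prod (.volumeIoiPow (Module.finrank ℝ E - 1))) := by
        rw [← hmp.lintegral_comp_emb (Homeomorph.measurableEmbedding _)]
        refine lintegral_congr fun y => ?_
        rw [← homeomorphUnitSphereProd_symm_apply_coe, Homeomorph.symm_apply_apply]
    _ = _ := by
        rw [lintegral_prod _ hfp.aemeasurable]
        refine lintegral_congr fun s => ?_
        have hfs : Measurable fun r : Set.Ioi (0 : ℝ) => f ((r : ℝ) • (s : E)) := by fun_prop
        rw [Measure.volumeIoiPow, lintegral_withDensity_eq_lintegral_mul _ hpos hfs]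
        exact lintegral_subtype_comap measurableSet_Ioi
          fun r => ENNReal.ofReal (r ^ (Module.finrank ℝ E - 1)) * f (r • (s : E))

theorem lintegral_pow_mul_exp_neg_mul_sq {k : ℝ} (hk : 0 < k) {N : ℕ} (hN : 0 < N) :
    ∫⁻ r in Set.Ioi (0 : ℝ), ENNReal.ofReal (r ^ (2 * N - 1)) * ENNReal.ofReal (Real.exp (-(r ^ 2 * k)))
      = ENNReal.ofReal ((k ^ N)⁻¹) * ENNReal.ofReal (1 / 2 * Real.Gamma N) := by
  have h1 : (-1 : ℝ) < 2 * N - 1 := by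
    have : (0 : ℝ) < N := by exact_mod_cast hN
    linarith
  have hc : ((2 * N - 1 : ℕ) : ℝ) = 2 * N - 1 := by
    rw [Nat.cast_sub (by omega)]; push_cast; ring
  have h2 := integral_rpow_mul_exp_neg_mul_rpow (p := 2) two_pos h1 hk
  have h3 := integrableOn_rpow_mul_exp_neg_mul_rpow (p := 2) h1 two_pos hk
  have e : -(2 * (N : ℝ) - 1 + 1) / 2 = -N := by ring
  have e' : (2 * (N : ℝ) - 1 + 1) / 2 = N := by ring
  rw [e, e', Real.rpow_neg hk.le, Real.rpow_natCast, mul_assoc] at h2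
  rw [← ENNReal.ofReal_mul (by positivity), ← h2, ofReal_integral_eq_lintegral_ofReal h3]
  · refine setLIntegral_congr_fun measurableSet_Ioi fun r hr => ?_
    have hr' : (0 : ℝ) < r := hr
    rw [← ENNReal.ofReal_mul (by positivity), ← hc, Real.rpow_natCast, Real.rpow_two]
    ring_nf
  · filter_upwards [ae_restrict_mem measurableSet_Ioi] with r hr
    have hr' : (0 : ℝ) < r := hr
    simp only [Pi.zero_apply]
    positivity

/-- Radial integration: `∫ exp (-|y|² κ(y)) = ∫ exp (-|y|²) κ(y)^{-N}` if `κ` is homogeneous of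
degree zero and `2 N` is the dimension. -/
theorem lintegral_exp_neg_homogeneous {N : ℕ} (hN : 0 < N) (hE : Module.finrank ℝ E = 2 * N)
    {κ : E → ℝ} (hκ : Measurable κ) (hh : ∀ r : ℝ, 0 < r → ∀ y, κ (r • y) = κ y)
    (hpos : ∀ y ≠ 0, 0 < κ y) :
    ∫⁻ y, ENNReal.ofReal (Real.exp (-(‖y‖ ^ 2 * κ y))) ∂μ
      = ∫⁻ y, ENNReal.ofReal (Real.exp (-‖y‖ ^ 2)) * ENNReal.ofReal ((κ y ^ N)⁻¹) ∂μ := by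
  have : Nontrivial E := Module.nontrivial_of_finrank_pos (R := ℝ) (by omega)
  rw [lintegral_eq_lintegral_sphere μ (by fun_prop), lintegral_eq_lintegral_sphere μ (by fun_prop)]
  refine lintegral_congr fun s => ?_
  have hs : (s : E) ≠ 0 := by
    intro h
    have := s.2
    simp [h] at this
  have hn : ‖(s : E)‖ = 1 := by simp
  -- On each ray `κ` is constant. Both radial integrals are Gamma integrals, and scaling `r` shows
  -- that they differ exactly by the factor `κ(s)^{-N}`.
  have e1 := lintegral_pow_mul_exp_neg_mul_sq (hpos s hs) hN
  have e2 := lintegral_pow_mul_exp_neg_mul_sq one_pos hN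
  simp only [one_pow, inv_one, ENNReal.ofReal_one, one_mul, mul_one] at e2
  rw [hE]
  calc _ = ∫⁻ r in Set.Ioi (0 : ℝ), ENNReal.ofReal (r ^ (2 * N - 1)) *
        ENNReal.ofReal (Real.exp (-(r ^ 2 * κ s))) := by
        refine setLIntegral_congr_fun measurableSet_Ioi fun r hr => ?_
        simp only [norm_smul, hn, hh r hr, mul_one, Real.norm_eq_abs, sq_abs]
    _ = ∫⁻ r in Set.Ioi (0 : ℝ), ENNReal.ofReal ((κ s ^ N)⁻¹) *
        (ENNReal.ofReal (r ^ (2 * N - 1)) * ENNReal.ofReal (Real.exp (-r ^ 2))) := by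
        rw [lintegral_const_mul _ (by fun_prop), e1, e2]
    _ = _ := by
        refine setLIntegral_congr_fun measurableSet_Ioi fun r hr => ?_
        simp only [norm_smul, hn, hh r hr, mul_one, Real.norm_eq_abs, sq_abs]
        ring

end Polar

section Rayleigh

variable {ι : Type} [Fintype ι]

/-- The Gaussian measure with density `exp (-|y|²)`. -/
noncomputable def gauss (ι : Type) [Fintype ι] : Measure (EuclideanSpace ℝ ι) :=
  volume.withDensity fun y => ENNReal.ofReal (Real.exp (-‖y‖ ^ 2))

/-- The Rayleigh quotient of the diagonal quadratic form with eigenvalues `X`. -/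
noncomputable def rayleigh (X : ι → ℝ) (y : EuclideanSpace ℝ ι) : ℝ := (∑ p, X p * y p ^ 2) / ‖y‖ ^ 2

theorem lintegral_gauss {f : EuclideanSpace ℝ ι → ENNReal} (hf : Measurable f) :
    ∫⁻ y, f y ∂gauss ι = ∫⁻ y, ENNReal.ofReal (Real.exp (-‖y‖ ^ 2)) * f y := by
  rw [gauss, lintegral_withDensity_eq_lintegral_mul _ (by fun_prop) hf]
  rfl

instance : IsFiniteMeasure (gauss ι) := by
  have h := GaussianFourier.integrable_cexp_neg_mul_sq_norm_add (V := EuclideanSpace ℝ ι) (b := 1)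
    (by simp) 0 0
  refine isFiniteMeasure_withDensity_ofReal ?_
  refine HasFiniteIntegral.mono h.2 (Eventually.of_forall fun y => ?_)
  simp [Complex.norm_exp, ← Complex.ofReal_pow]

theorem gauss_ae_of_volume_ae {P : EuclideanSpace ℝ ι → Prop} (h : ∀ᵐ y, P y) :
    ∀ᵐ y ∂gauss ι, P y :=
  (withDensity_absolutelyContinuous _ _).ae_le h

theorem volume_absolutelyContinuous_gauss : volume ≪ gauss ι :=
  withDensity_absolutelyContinuous' (by fun_prop)
    (Eventually.of_forall fun y => by simp [Real.exp_pos])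

theorem measurable_rayleigh (X : ι → ℝ) : Measurable (rayleigh X) := by
  unfold rayleigh
  fun_prop

theorem rayleigh_le [Nonempty ι] {X : ι → ℝ} {u : ℝ} (hX : ∀ p, X p ≤ u) {y : EuclideanSpace ℝ ι}
    (hy : y ≠ 0) : rayleigh X y ≤ u := by
  have h0 : 0 < ‖y‖ ^ 2 := by positivity
  rw [rayleigh, div_le_iff₀ h0, EuclideanSpace.real_norm_sq_eq, Finset.mul_sum]
  exact Finset.sum_le_sum fun p _ => mul_le_mul_of_nonneg_right (hX p) (sq_nonneg _)

theorem rayleigh_smul (X : ι → ℝ) {r : ℝ} (hr : 0 < r) (y : EuclideanSpace ℝ ι) :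
    rayleigh X (r • y) = rayleigh X y := by
  have : ∑ p, X p * (r • y) p ^ 2 = r ^ 2 * ∑ p, X p * y p ^ 2 := by
    rw [Finset.mul_sum]
    refine Finset.sum_congr rfl fun p _ => ?_
    simp; ring
  rw [rayleigh, this, norm_smul, mul_pow, Real.norm_eq_abs, sq_abs, rayleigh,
    mul_div_mul_left _ _ (by positivity)]

theorem ae_gauss_ne_zero [Nonempty ι] : ∀ᵐ y ∂gauss ι, y ≠ 0 :=
  gauss_ae_of_volume_ae (Measure.ae_ne _ _)

/-- Gaussian integration of `(w - ρ(y))^{-N}` for real `w`. -/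
theorem integral_gauss_inv_pow [Nonempty ι] {N : ℕ} (hι : Fintype.card ι = 2 * N) {X : ι → ℝ}
    {w : ℝ} (hw : ∀ p, X p < w) :
    ∫ y, ((w - rayleigh X y) ^ N)⁻¹ ∂gauss ι = ∏ p, √(Real.pi / (w - X p)) := by
  obtain ⟨p₀, hp₀⟩ := Finite.exists_max X
  have hlt : ∀ y ≠ 0, 0 < w - rayleigh X y := fun y hy => by
    linarith [rayleigh_le hp₀ hy, hw p₀]
  have hN : 0 < N := by
    have := Fintype.card_pos (α := ι)
    omega
  have hm := measurable_rayleigh X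
  have h1 := lintegral_exp_neg_homogeneous (volume : Measure (EuclideanSpace ℝ ι)) hN
    (by rw [finrank_euclideanSpace, hι]) (κ := fun y => w - rayleigh X y) (by fun_prop)
    (fun r hr y => by simp only [rayleigh_smul X hr]) hlt
  rw [← lintegral_gauss (by fun_prop)] at h1
  -- `|y|² (w - ρ(y)) = ∑ (w - X_p) y_p²` is a diagonal quadratic form, so the integral becomes a
  -- product of one-dimensional Gaussian integrals.
  have h2 : ∀ y : EuclideanSpace ℝ ι, Real.exp (-(‖y‖ ^ 2 * (w - rayleigh X y)))
      = ∏ p, Real.exp (-(w - X p) * y p ^ 2) := by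
    intro y
    rw [← Real.exp_sum]
    congr 1
    rcases eq_or_ne y 0 with rfl | hy
    · simp
    · have h0 : ‖y‖ ^ 2 ≠ 0 := by positivity
      rw [mul_sub, rayleigh, mul_div_cancel₀ _ h0, EuclideanSpace.real_norm_sq_eq,
        Finset.sum_mul, ← Finset.sum_sub_distrib, ← Finset.sum_neg_distrib]
      exact Finset.sum_congr rfl fun p _ => by ring
  rw [integral_eq_lintegral_of_nonneg_ae, ← h1]
  · simp only [h2]
    rw [← integral_eq_lintegral_of_nonneg_ae (Eventually.of_forall fun y => by positivity)
      (by fun_prop)]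
    have h3 := (PiLp.volume_preserving_ofLp ι).integral_comp
      (MeasurableEquiv.toLp 2 (ι → ℝ)).symm.measurableEmbedding
      (fun y : ι → ℝ => ∏ p, Real.exp (-(w - X p) * y p ^ 2))
    rw [h3, integral_fintype_prod_volume_eq_prod (fun p (t : ℝ) => Real.exp (-(w - X p) * t ^ 2))]
    exact Finset.prod_congr rfl fun p _ => integral_gaussian _
  · filter_upwards [ae_gauss_ne_zero] with y hy
    exact inv_nonneg.2 (pow_nonneg (hlt y hy).le _)
  · fun_prop

end Rayleigh

end ExternalSource

/-! ### Analytic continuation in `w` and the contour integral of the product of powers. -/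

namespace ExternalSource

open MeasureTheory Filter Topology

section Continuation

open Complex

theorem isPreconnected_slitPlane_shift (u : ℝ) :
    IsPreconnected {w : ℂ | w - u ∈ slitPlane} := by
  have h1 : IsPreconnected slitPlane :=
    (starConvex_one_slitPlane.isPathConnected (by simp)).isConnected.isPreconnected
  have h2 : {w : ℂ | w - u ∈ slitPlane} = (fun z : ℂ => z + u) '' slitPlane := by
    ext w
    exact ⟨fun h => ⟨w - u, h, by simp⟩, by rintro ⟨z, hz, rfl⟩; simpa using hz⟩
  rw [h2]
  exact h1.image _ (by fun_prop)

theorem isOpen_slitPlane_shift (u : ℝ) : IsOpen {w : ℂ | w - u ∈ slitPlane} :=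
  isOpen_slitPlane.preimage (by fun_prop)

theorem sub_ofReal_mem_slitPlane {u q : ℝ} {w : ℂ} (hw : w - u ∈ slitPlane) (hq : q ≤ u) :
    w - q ∈ slitPlane := by
  rw [mem_slitPlane_iff] at hw ⊢
  simp only [sub_re, ofReal_re, sub_im, ofReal_im] at hw ⊢
  exact hw.imp (fun h => by linarith) id

variable {ι : Type} [Fintype ι] [Nonempty ι]

theorem differentiableOn_integral_gauss_inv_pow {X : ι → ℝ} {u : ℝ} (hX : ∀ p, X p ≤ u) (N : ℕ) :
    DifferentiableOn ℂ (fun w : ℂ => ∫ y, ((w - rayleigh X y) ^ N)⁻¹ ∂gauss ι)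
      {w : ℂ | w - u ∈ slitPlane} := by
  intro w₀ hw₀
  obtain ⟨ε, hε, hball⟩ := Metric.isOpen_iff.1 (isOpen_slitPlane_shift u) w₀ hw₀
  have hm := measurable_rayleigh X
  -- The ball of radius `ε` avoids the cut, so the ball of half the radius keeps distance `ε / 2`
  -- from it. This gives a bound on the derivative uniform in `y`, because `ρ(y) ≤ u`.
  have hlow : ∀ w ∈ Metric.ball w₀ (ε / 2), ∀ q : ℝ, q ≤ u → ε / 2 ≤ ‖w - q‖ := by
    intro w hw q hq
    by_contra! h
    have h1 : (q : ℂ) ∈ Metric.ball w₀ ε := by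
      rw [Metric.mem_ball] at hw ⊢
      calc dist (q : ℂ) w₀ ≤ dist (q : ℂ) w + dist w w₀ := dist_triangle _ _ _
        _ < ε / 2 + ε / 2 := by
          gcongr
          rwa [dist_comm, Complex.dist_eq]
        _ = ε := by ring
    have h2 := sub_ofReal_mem_slitPlane (hball h1) hq
    simp at h2
  have hdiff := hasDerivAt_integral_of_dominated_loc_of_deriv_le (μ := gauss ι) (x₀ := w₀)
    (s := Metric.ball w₀ (ε / 2)) (F := fun (w : ℂ) y => ((w - rayleigh X y) ^ N)⁻¹)
    (F' := fun (w : ℂ) y => -(N * (w - rayleigh X y) ^ (N - 1)) / ((w - rayleigh X y) ^ N) ^ 2)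
    (bound := fun _ => N * (ε / 2)⁻¹ ^ (N + 1)) (Metric.ball_mem_nhds _ (by positivity))
    (Eventually.of_forall fun w => by fun_prop) ?_
    (Measurable.aestronglyMeasurable (by fun_prop)) ?_ (integrable_const _) ?_
  · exact hdiff.2.differentiableAt.differentiableWithinAt
  · refine Integrable.of_bound (C := (ε / 2)⁻¹ ^ N) (by fun_prop) ?_
    filter_upwards [ae_gauss_ne_zero] with y hy
    rw [norm_inv, norm_pow, ← inv_pow]
    gcongr
    exact hlow w₀ (Metric.mem_ball_self (by positivity)) _ (rayleigh_le hX hy)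
  · filter_upwards [ae_gauss_ne_zero] with y hy w hw
    have h1 := hlow w hw _ (rayleigh_le hX hy)
    have h0 : 0 < ‖w - rayleigh X y‖ := lt_of_lt_of_le (by positivity) h1
    rcases N.eq_zero_or_pos with rfl | hN
    · simp
    rw [norm_div, norm_neg, norm_mul, norm_natCast, norm_pow, norm_pow, norm_pow]
    have e : (N : ℝ) * ‖w - rayleigh X y‖ ^ (N - 1) / (‖w - rayleigh X y‖ ^ N) ^ 2
        = N * ‖w - rayleigh X y‖⁻¹ ^ (N + 1) := by
      obtain ⟨M, rfl⟩ : ∃ M, N = M + 1 := ⟨N - 1, by omega⟩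
      simp only [Nat.add_sub_cancel, inv_pow]
      field_simp
      ring
    rw [e]
    gcongr
  · filter_upwards [ae_gauss_ne_zero] with y hy w hw
    have h1 := hlow w hw _ (rayleigh_le hX hy)
    have h0 : w - rayleigh X y ≠ 0 := norm_pos_iff.1 (lt_of_lt_of_le (by positivity) h1)
    refine ((((hasDerivAt_id w).sub_const (rayleigh X y : ℂ)).pow N).inv
      (pow_ne_zero _ h0)).congr_deriv ?_
    simp

/-- `∏ (w - X_j)^{-β/2}` is a Gaussian average of powers of `(w - ρ(y))⁻¹`. -/
theorem prod_cpow_eq_integral_gauss {n β N : ℕ} [NeZero n] [NeZero β] (hN : n * β = 2 * N)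
    {X : Fin n → ℝ} {u : ℝ} (hX : ∀ j, X j ≤ u) {w : ℂ} (hw : w - u ∈ slitPlane) :
    (((Real.pi ^ ((β : ℝ) / 2)) ^ n : ℝ) : ℂ) * ∏ j, ((w - X j) ^ ((β : ℂ) / 2))⁻¹
      = ∫ y, ((w - rayleigh (fun p : Fin n × Fin β => X p.1) y) ^ N)⁻¹ ∂gauss (Fin n × Fin β) := by
  have hX' : ∀ p : Fin n × Fin β, (fun p : Fin n × Fin β => X p.1) p ≤ u := fun p => hX p.1
  have hopen := isOpen_slitPlane_shift u
  have h1 : DifferentiableOn ℂ (fun w : ℂ => (((Real.pi ^ ((β : ℝ) / 2)) ^ n : ℝ) : ℂ) *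
      ∏ j, ((w - X j) ^ ((β : ℂ) / 2))⁻¹) {w : ℂ | w - u ∈ slitPlane} := by
    refine DifferentiableOn.const_mul (DifferentiableOn.fun_finsetProd fun j _ => ?_) _
    intro w hw
    have hs := sub_ofReal_mem_slitPlane hw (hX j)
    refine DifferentiableAt.differentiableWithinAt ?_
    refine DifferentiableAt.inv ?_ ?_
    · exact ((differentiableAt_id.sub_const _).cpow (differentiableAt_const _) hs)
    · rw [Ne, cpow_eq_zero_iff]
      exact fun h => slitPlane_ne_zero hs h.1
  have h2 := differentiableOn_integral_gauss_inv_pow hX' N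
  -- Identity theorem on the connected slit plane: both sides are analytic and agree at real points
  -- `x > u`, which accumulate at `u + 1`.
  refine (h1.analyticOnNhd hopen).eqOn_of_preconnected_of_frequently_eq (h2.analyticOnNhd hopen)
    (isPreconnected_slitPlane_shift u) (z₀ := ((u + 1 : ℝ) : ℂ)) (by simp) ?_ hw
  have hreal : ∀ x : ℝ, u < x → (((Real.pi ^ ((β : ℝ) / 2)) ^ n : ℝ) : ℂ) *
      ∏ j, (((x : ℂ) - X j) ^ ((β : ℂ) / 2))⁻¹
      = ∫ y, (((x : ℂ) - rayleigh (fun p : Fin n × Fin β => X p.1) y) ^ N)⁻¹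
        ∂gauss (Fin n × Fin β) := by
    intro x hx
    have h3 := integral_gauss_inv_pow (N := N) (by simp [hN]) (w := x)
      (X := fun p : Fin n × Fin β => X p.1) (fun p => (hX p.1).trans_lt hx)
    have h4 : ∀ y, (((x : ℂ) - rayleigh (fun p : Fin n × Fin β => X p.1) y) ^ N)⁻¹
        = (((((x - rayleigh (fun p : Fin n × Fin β => X p.1) y) ^ N)⁻¹ : ℝ)) : ℂ) := by
      intro y; push_cast; rfl
    simp only [h4]
    rw [integral_complex_ofReal, h3, Fintype.prod_prod_type]
    simp only [Finset.prod_const, Finset.card_univ, Fintype.card_fin]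
    -- Each `X_j` occurs for `β` of the Gaussian coordinates, which produces the exponent `β/2`.
    have h5 : ∀ j, √(Real.pi / (x - X j)) ^ β
        = Real.pi ^ ((β : ℝ) / 2) * ((x - X j) ^ ((β : ℝ) / 2))⁻¹ := by
      intro j
      have hj : 0 < x - X j := by linarith [hX j]
      rw [Real.sqrt_eq_rpow, ← Real.rpow_natCast, ← Real.rpow_mul (by positivity),
        Real.div_rpow Real.pi_pos.le hj.le, ← div_eq_mul_inv]
      ring_nf
    simp only [h5]
    rw [Finset.prod_mul_distrib, Finset.prod_const, Finset.card_univ, Fintype.card_fin]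
    push_cast
    congr 1
    refine Finset.prod_congr rfl fun j _ => ?_
    have hj : 0 < x - X j := by linarith [hX j]
    rw [ofReal_cpow hj.le]
    push_cast
    rfl
  have htend : Tendsto (fun k : ℕ => ((u + 1 + 1 / ((k : ℝ) + 1) : ℝ) : ℂ)) atTop
      (𝓝[≠] ((u + 1 : ℝ) : ℂ)) := by
    refine tendsto_nhdsWithin_iff.2 ⟨?_, Eventually.of_forall fun k => ?_⟩
    · have := (tendsto_one_div_add_atTop_nhds_zero_nat (𝕜 := ℝ)).const_add (u + 1)
      rw [add_zero] at this
      exact (continuous_ofReal.tendsto _).comp this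
    · have : (0 : ℝ) < 1 / ((k : ℝ) + 1) := by positivity
      rw [Set.mem_compl_singleton_iff, Ne, ofReal_inj]
      linarith
  refine htend.frequently (Frequently.of_forall fun k => hreal _ ?_)
  have : (0 : ℝ) < 1 / ((k : ℝ) + 1) := by positivity
  linarith

end Continuation

/-- The contour integral and the integral over a parameter may be interchanged. -/
theorem HankelContour.integral_integral {γ : ℝ → ℂ} {u : ℝ} (h : HankelContour γ u) {c : ℝ}
    (hc : 0 < c) {Y : Type*} [MeasurableSpace Y] {ν : Measure Y} [SFinite ν] {k : ℂ → Y → ℂ}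
    (hk : Measurable fun p : ℝ × Y => k (γ p.1) p.2) {b : Y → ℝ} (hb : Integrable b ν)
    (hkb : ∀ᵐ y ∂ν, ∀ t, ‖k (γ t) y‖ ≤ b y * ‖Complex.exp (c * γ t)‖) :
    Integrable (fun t => (∫ y, k (γ t) y ∂ν) * deriv γ t) ∧
    ∫ t, (∫ y, k (γ t) y ∂ν) * deriv γ t = ∫ y, (∫ t, k (γ t) y * deriv γ t) ∂ν := by
  obtain ⟨K, hK, H⟩ := h.norm_exp_le hc
  have hint : Integrable (fun p : ℝ × Y => k (γ p.1) p.2 * deriv γ p.1) (volume.prod ν) := by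
    refine ((integrable_exp_neg_mul_abs hc).mul_prod (hb.norm.const_mul K)).mono'
      (hk.mul ((measurable_deriv γ).comp measurable_fst)).aestronglyMeasurable ?_
    filter_upwards [Measure.quasiMeasurePreserving_snd.ae hkb,
      Measure.quasiMeasurePreserving_fst.ae h.ae_norm_deriv_le] with p hp hp'
    calc ‖k (γ p.1) p.2 * deriv γ p.1‖ ≤ ‖k (γ p.1) p.2‖ * 1 := by rw [norm_mul]; gcongr
      _ ≤ ‖b p.2‖ * ‖Complex.exp (c * γ p.1)‖ := by
        rw [mul_one]
        exact (hp p.1).trans (by gcongr; exact Real.le_norm_self _)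
      _ ≤ ‖b p.2‖ * (K * Real.exp (-c * |p.1|)) := by gcongr; exact H p.1
      _ = _ := by ring
  have h1 := hint.integral_prod_left
  have h2 := integral_integral_swap (f := fun t y => k (γ t) y * deriv γ t) hint
  simp only [integral_mul_const] at h1 h2
  exact ⟨h1, h2⟩

/-- The average `∫ exp (c ρ_X(y))` of the exponential of the Rayleigh quotient whose eigenvalues
are `X_1, …, X_n`, each with multiplicity `β`. -/
noncomputable def sphericalAverage (n β : ℕ) (c : ℝ) (X : Fin n → ℝ) : ℝ :=
  ∫ y, Real.exp (c * rayleigh (fun p : Fin n × Fin β => X p.1) y) ∂gauss (Fin n × Fin β)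

/-- The product is a Gaussian average of `(w - ρ(y))^{-(N+1)}`. After interchanging the integrals,
each `y` contributes a pole of order `N + 1` at the real point `ρ(y) ≤ u`, to which Hankel's formula
applies. -/
theorem HankelContour.integral_exp_mul_prod_cpow {γ : ℝ → ℂ} {u : ℝ} (h : HankelContour γ u)
    {c : ℝ} (hc : 0 < c) {n β N : ℕ} [NeZero n] [NeZero β] (hN : n * β = 2 * (N + 1))
    {X : Fin n → ℝ} (hX : ∀ j, X j ≤ u) :
    ∫ t, Complex.exp (c * γ t) * (∏ j, ((γ t - X j) ^ ((β : ℂ) / 2))⁻¹) * deriv γ t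
      = 2 * Real.pi * Complex.I *
        ((c ^ N / N.factorial / (Real.pi ^ ((β : ℝ) / 2)) ^ n * sphericalAverage n β c X : ℝ) : ℂ) := by
  set ρ := rayleigh (fun p : Fin n × Fin β => X p.1) with hρ
  have hρm : Measurable ρ := measurable_rayleigh _
  have hX' : ∀ p : Fin n × Fin β, (fun p : Fin n × Fin β => X p.1) p ≤ u := fun p => hX p.1
  obtain ⟨δ, hδ, H⟩ := h.away
  have hγ := h.continuous.measurable
  set A : ℂ := (((Real.pi ^ ((β : ℝ) / 2)) ^ n : ℝ) : ℂ) with hA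
  have hA0 : A ≠ 0 := by
    rw [hA, Complex.ofReal_ne_zero]; have := Real.pi_pos; positivity
  have key := h.integral_integral hc (ν := gauss (Fin n × Fin β))
    (k := fun w y => Complex.exp (c * w) / (w - ρ y) ^ (N + 1)) (b := fun _ => (δ ^ (N + 1))⁻¹)
    (by fun_prop) (integrable_const _) ?_
  · have e1 : ∀ t, A * (Complex.exp (c * γ t) * (∏ j, ((γ t - X j) ^ ((β : ℂ) / 2))⁻¹) * deriv γ t)
        = (∫ y, Complex.exp (c * γ t) / (γ t - ρ y) ^ (N + 1) ∂gauss (Fin n × Fin β))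
          * deriv γ t := by
      intro t
      simp only [div_eq_mul_inv (Complex.exp _)]
      rw [integral_const_mul, ← prod_cpow_eq_integral_gauss hN hX (h.sub_mem_slitPlane t le_rfl)]
      ring
    refine mul_left_cancel₀ hA0 ?_
    rw [← integral_const_mul]
    simp only [e1]
    rw [key.2]
    have e2 : ∀ᵐ y ∂gauss (Fin n × Fin β),
        ∫ t, Complex.exp (c * γ t) / (γ t - ρ y) ^ (N + 1) * deriv γ t
        = 2 * Real.pi * Complex.I * (c ^ N / N.factorial) * ((Real.exp (c * ρ y) : ℝ) : ℂ) := by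
      filter_upwards [ae_gauss_ne_zero] with y hy
      rw [h.integral_exp_div_pow hc (rayleigh_le hX' hy)]
      push_cast
      rfl
    rw [integral_congr_ae e2, integral_const_mul, integral_complex_ofReal]
    rw [sphericalAverage]
    push_cast
    rw [hA] at hA0 ⊢
    push_cast at hA0 ⊢
    rw [← hρ]
    field_simp
  · filter_upwards [ae_gauss_ne_zero] with y hy t
    rw [norm_div, norm_pow, div_eq_inv_mul]
    gcongr
    exact H t _ (rayleigh_le hX' hy)

end ExternalSource

namespace ExternalSource

open MeasureTheory Matrix Module

/-! ### Hermitian matrices over `ℝ`, `ℂ` and the quaternions -/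

/-- An orthonormal real basis `e_0, …, e_{β-1}` of a division algebra with involution, with the
identities shared by the real numbers, the complex numbers and the quaternions. -/
structure HurwitzFrame (F : Type) [DivisionRing F] [Algebra ℝ F] [StarRing F] (β : ℕ) where
  re : F →ₗ[ℝ] ℝ
  e : Fin β → F
  sum_re_smul : ∀ q, ∑ k, re (q * star (e k)) • e k = q
  re_mul_star : ∀ k l, re (e k * star (e l)) = if k = l then 1 else 0
  re_mul_comm : ∀ p q, re (p * q) = re (q * p)
  re_one : re 1 = 1
  algebraMap_re : ∀ q, star q = q → algebraMap ℝ F (re q) = q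
  sum_mul_mul : ∀ q, ∑ k, e k * q * e k = ((2 : ℝ) - β) • star q

namespace HurwitzFrame

variable {F : Type} [DivisionRing F] [Algebra ℝ F] [StarRing F] {β : ℕ}
  (H : HurwitzFrame F β)

theorem re_algebraMap (r : ℝ) : H.re (algebraMap ℝ F r) = r := by
  rw [Algebra.algebraMap_eq_smul_one, map_smul, H.re_one, smul_eq_mul, mul_one]

/-- The coordinates with respect to the frame. -/
def coord : F ≃ₗ[ℝ] (Fin β → ℝ) where
  toFun q k := H.re (q * star (H.e k))
  map_add' p q := by ext k; simp [add_mul]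
  map_smul' r q := by ext k; simp
  invFun c := ∑ k, c k • H.e k
  left_inv q := H.sum_re_smul q
  right_inv c := by
    ext l
    simp [Finset.sum_mul, H.re_mul_star]

theorem coord_apply (q : F) (k : Fin β) : H.coord q k = H.re (q * star (H.e k)) := rfl

theorem coord_symm_apply (c : Fin β → ℝ) : H.coord.symm c = ∑ k, c k • H.e k := rfl

theorem finrank_eq (H : HurwitzFrame F β) : finrank ℝ F = β := by
  rw [H.coord.finrank_eq]; simp

variable [StarModule ℝ F]

theorem re_mul_star_eq_sum (p q : F) : H.re (p * star q) = ∑ k, H.coord p k * H.coord q k := by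
  conv_lhs => rw [← H.sum_re_smul q]
  simp [Finset.mul_sum, coord_apply, mul_comm]

variable {n : ℕ}

/-- Real coordinates of row vectors. -/
def vec : EuclideanSpace ℝ (Fin n × Fin β) ≃ₗ[ℝ] (Fin n → F) where
  toFun y j := H.coord.symm fun k => y (j, k)
  map_add' y z := by
    ext j
    rw [Pi.add_apply, ← map_add]
    rfl
  map_smul' r y := by
    ext j
    rw [RingHom.id_apply, Pi.smul_apply, ← map_smul]
    rfl
  invFun v := WithLp.toLp 2 fun p => H.coord (v p.1) p.2
  left_inv y := by ext p; simp
  right_inv v := by ext j; simp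

theorem coord_vec (y : EuclideanSpace ℝ (Fin n × Fin β)) (j : Fin n) (k : Fin β) :
    H.coord (H.vec y j) k = y (j, k) := by
  simp [vec]

theorem inner_eq_re (y z : EuclideanSpace ℝ (Fin n × Fin β)) :
    inner ℝ y z = H.re (H.vec y ⬝ᵥ star (H.vec z)) := by
  simp only [dotProduct, map_sum, Pi.star_apply, re_mul_star_eq_sum, coord_vec]
  rw [← Fintype.sum_prod_type (fun p : Fin n × Fin β => y p * z p), PiLp.inner_apply]
  exact Finset.sum_congr rfl fun p _ => by simp [mul_comm]

/-- Right multiplication by a matrix, in real coordinates. -/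
def op (M : Matrix (Fin n) (Fin n) F) :
    EuclideanSpace ℝ (Fin n × Fin β) →ₗ[ℝ] EuclideanSpace ℝ (Fin n × Fin β) :=
  H.vec.symm.toLinearMap ∘ₗ
    { toFun := fun v => v ᵥ* M
      map_add' := fun v w => add_vecMul _ _ _
      map_smul' := fun r v => smul_vecMul _ _ _ } ∘ₗ H.vec.toLinearMap

theorem vec_op (M : Matrix (Fin n) (Fin n) F) (y : EuclideanSpace ℝ (Fin n × Fin β)) :
    H.vec (H.op M y) = H.vec y ᵥ* M := by
  simp [op]

theorem op_one : H.op (1 : Matrix (Fin n) (Fin n) F) = 1 := by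
  ext1 y
  apply H.vec.injective
  simp [vec_op]

theorem op_pow (M : Matrix (Fin n) (Fin n) F) (k : ℕ) : H.op M ^ k = H.op (M ^ k) := by
  induction k with
  | zero => simp [op_one]
  | succ k ih =>
    ext1 y
    apply H.vec.injective
    rw [pow_succ', ih, Module.End.mul_apply, vec_op, vec_op, vecMul_vecMul, vec_op, pow_succ]

theorem inner_op (M : Matrix (Fin n) (Fin n) F) (y z : EuclideanSpace ℝ (Fin n × Fin β)) :
    inner ℝ (H.op M y) z = H.re (H.vec y ⬝ᵥ M *ᵥ star (H.vec z)) := by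
  rw [H.inner_eq_re, vec_op, ← dotProduct_mulVec]

theorem isSymmetric_op {M : Matrix (Fin n) (Fin n) F} (hM : M.IsHermitian) :
    (H.op M).IsSymmetric := by
  intro y z
  rw [H.inner_op, H.inner_eq_re, H.vec_op, star_vecMul, hM.eq]

/-- A matrix acting on row vectors from the right commutes with left scalar multiplication. Its real
eigenspaces are therefore left vector spaces over `F`, and `F` has real dimension `β`. -/
theorem finrank_eigenspace_op (M : Matrix (Fin n) (Fin n) F) (μ : ℝ) :
    β ∣ finrank ℝ (End.eigenspace (H.op M) μ) := by
  let W : Submodule F (Fin n → F) :=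
    { carrier := {v | v ᵥ* M = μ • v}
      add_mem' := fun {v w} hv hw => by
        simp only [Set.mem_ofPred_eq] at hv hw ⊢
        rw [add_vecMul, hv, hw, smul_add]
      zero_mem' := by simp
      smul_mem' := fun a v hv => by
        simp only [Set.mem_ofPred_eq] at hv ⊢
        rw [smul_vecMul, hv, smul_comm] }
  have h1 : (End.eigenspace (H.op M) μ).map H.vec.toLinearMap = W.restrictScalars ℝ := by
    ext v
    simp only [Submodule.mem_map, End.mem_eigenspace_iff, Submodule.restrictScalars_mem]
    constructor
    · rintro ⟨y, hy, rfl⟩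
      change H.vec y ᵥ* M = μ • H.vec y
      rw [← vec_op, hy, map_smul]
    · intro hv
      refine ⟨H.vec.symm v, ?_, by simp⟩
      apply H.vec.injective
      rw [vec_op, map_smul, LinearEquiv.apply_symm_apply]
      exact hv
  have h2 : finrank ℝ (End.eigenspace (H.op M) μ) = finrank ℝ (W.restrictScalars ℝ) := by
    rw [← h1]
    exact (H.vec.submoduleMap _).finrank_eq
  have h3 : finrank ℝ F * finrank F W = finrank ℝ W := finrank_mul_finrank ℝ F W
  rw [h2]
  exact ⟨finrank F W, by rw [← H.finrank_eq]; exact h3.symm⟩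

end HurwitzFrame

/-- A decreasing sequence all of whose values have multiplicities divisible by `β` is constant on
blocks of length `β`. -/
theorem Antitone.eq_of_dvd_card {n β : ℕ} {f : Fin (n * β) → ℝ} (hf : Antitone f)
    (hd : ∀ a, β ∣ (Finset.univ.filter fun i => f i = a).card) (j : Fin n) (k l : Fin β) :
    f (finProdFinEquiv (j, k)) = f (finProdFinEquiv (j, l)) := by
  wlog hkl : k ≤ l generalizing k l
  · exact (this l k (le_of_not_ge hkl)).symm
  by_contra hne
  set a := f (finProdFinEquiv (j, l)) with ha
  have hlt : a < f (finProdFinEquiv (j, k)) :=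
    lt_of_le_of_ne (hf (by rw [Fin.le_def]; simpa using hkl)) (Ne.symm hne)
  -- The number of values above `a` is a sum of multiplicities, hence a multiple of `β`. If `f`
  -- dropped to `a` within block `j` between the places `k` and `l`, this number would lie between
  -- `βj + k + 1` and `βj + l`, where there is no multiple of `β`.
  have hdvd : β ∣ (Finset.univ.filter fun i => a < f i).card := by
    rw [Finset.card_eq_sum_card_image f]
    refine Finset.dvd_sum fun b hb => ?_
    rw [Finset.mem_image] at hb
    obtain ⟨i, hi, rfl⟩ := hb
    rw [Finset.mem_filter] at hi
    convert! hd (f i) using 2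
    ext i'
    simp only [Finset.mem_filter, Finset.mem_univ, true_and, and_iff_right_iff_imp]
    intro h
    rw [h]; exact hi.2
  have h1 : β * j + k + 1 ≤ (Finset.univ.filter fun i => a < f i).card := by
    have : (Finset.Iic (finProdFinEquiv (j, k))).card = β * j + k + 1 := by
      rw [Fin.card_Iic]; simp; ring
    rw [← this]
    refine Finset.card_le_card fun i hi => ?_
    rw [Finset.mem_Iic] at hi
    simpa using hlt.trans_le (hf hi)
  have h2 : (Finset.univ.filter fun i => a < f i).card ≤ β * j + l := by
    have : (Finset.Iio (finProdFinEquiv (j, l))).card = β * j + l := by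
      rw [Fin.card_Iio]; simp; ring
    rw [← this]
    refine Finset.card_le_card fun i hi => ?_
    simp only [Finset.mem_filter, Finset.mem_univ, true_and] at hi
    rw [Finset.mem_Iio]
    by_contra hc
    exact absurd (hf (not_lt.1 hc)) (not_le.2 hi)
  obtain ⟨d, hd'⟩ := hdvd
  rw [hd'] at h1 h2
  have h3 : (j : ℕ) < d := by
    by_contra hc
    have := Nat.mul_le_mul_left β (not_lt.1 hc)
    omega
  have h4 := Nat.mul_le_mul_left β (Nat.succ_le_of_lt h3)
  have h5 := l.2
  rw [Nat.mul_succ] at h4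
  omega

namespace HurwitzFrame

variable {F : Type} [DivisionRing F] [Algebra ℝ F] [StarRing F] [StarModule ℝ F] {β : ℕ}
  (H : HurwitzFrame F β) {n : ℕ}

/-- The spectral theorem. -/
theorem exists_orthonormalBasis [NeZero β] {M : Matrix (Fin n) (Fin n) F} (hM : M.IsHermitian) :
    ∃ x : Fin n → ℝ, Antitone x ∧
      ∃ b : OrthonormalBasis (Fin n × Fin β) ℝ (EuclideanSpace ℝ (Fin n × Fin β)),
        ∀ p, H.op M (b p) = x p.1 • b p := by
  have hs := H.isSymmetric_op hM
  have hn : finrank ℝ (EuclideanSpace ℝ (Fin n × Fin β)) = n * β := by simp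
  have hblock := Antitone.eq_of_dvd_card (hs.eigenvalues_antitone hn) fun a => by
    have := hs.card_filter_eigenvalues_eq hn a
    have h2 := H.finrank_eigenspace_op M a
    simp only [RCLike.ofReal_real_eq_id, id] at this
    rw [← this] at h2
    exact h2
  refine ⟨fun j => hs.eigenvalues hn (finProdFinEquiv (j, 0)), fun i j hij => ?_,
    (hs.eigenvectorBasis hn).reindex finProdFinEquiv.symm, fun p => ?_⟩
  · refine hs.eigenvalues_antitone hn ?_
    rw [Fin.le_def]
    simpa using Nat.mul_le_mul_left β hij
  · rw [OrthonormalBasis.reindex_apply, Equiv.symm_symm, hs.apply_eigenvectorBasis]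
    simp only [RCLike.ofReal_real_eq_id, id]
    rw [← hblock p.1 p.2 0]

/-- The normalized real trace. -/
def rtr (X : Matrix (Fin n) (Fin n) F) : ℝ := H.re X.trace

/-- Diagonal entries of a Hermitian matrix are real, so each of the `β` frame vectors in row
position `j` contributes the same number `re X_jj`. -/
theorem trace_op {X : Matrix (Fin n) (Fin n) F} (hX : X.IsHermitian) :
    LinearMap.trace ℝ _ (H.op X) = β * H.rtr X := by
  classical
  rw [LinearMap.trace_eq_sum_inner _ (EuclideanSpace.basisFun (Fin n × Fin β) ℝ),
    Fintype.sum_prod_type, rtr, trace, map_sum, Finset.mul_sum]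
  refine Finset.sum_congr rfl fun j _ => ?_
  have h1 : ∀ k, inner ℝ (EuclideanSpace.basisFun (Fin n × Fin β) ℝ (j, k))
      (H.op X (EuclideanSpace.basisFun (Fin n × Fin β) ℝ (j, k))) = H.re (X j j) := by
    intro k
    rw [← H.isSymmetric_op hX, inner_op]
    have h2 : H.vec (EuclideanSpace.basisFun (Fin n × Fin β) ℝ (j, k)) = Pi.single j (H.e k) := by
      apply H.vec.symm.injective
      rw [LinearEquiv.symm_apply_apply]
      ext ⟨i, l⟩
      by_cases hij : i = j
      · subst hij
        simp [vec, coord_apply, H.re_mul_star, Pi.single_apply, eq_comm]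
      · simp [vec, hij]
    have h3 : X j j = algebraMap ℝ F (H.re (X j j)) := (H.algebraMap_re _ (hX.apply j j)).symm
    have h4 : H.vec (EuclideanSpace.basisFun (Fin n × Fin β) ℝ (j, k)) ⬝ᵥ X *ᵥ
        star (H.vec (EuclideanSpace.basisFun (Fin n × Fin β) ℝ (j, k)))
        = H.e k * (X j j * star (H.e k)) := by
      rw [h2, ← Pi.single_star, mulVec_single, single_dotProduct]
      simp
    rw [h4, h3, ← mul_assoc, ← Algebra.commutes, mul_assoc, ← Algebra.smul_def, map_smul,
      H.re_mul_star, H.re_algebraMap]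
    simp
  rw [Finset.sum_congr rfl fun k _ => h1 k]
  simp

end HurwitzFrame

end ExternalSource

namespace ExternalSource

open MeasureTheory Matrix Module

/-! ### Power sums determine eigenvalues -/

section PowerSums

variable {ι κ : Type*} [Fintype ι] [Fintype κ]

theorem sum_eval_eq_of_psum {x : ι → ℝ} {y : κ → ℝ} {m : ℝ}
    (h : ∀ k : ℕ, ∑ i, x i ^ k = m * ∑ j, y j ^ k) (p : Polynomial ℝ) :
    ∑ i, p.eval (x i) = m * ∑ j, p.eval (y j) := by
  induction p using Polynomial.induction_on' with
  | add p q hp hq => simp only [Polynomial.eval_add, Finset.sum_add_distrib, mul_add, hp, hq]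
  | monomial k a =>
    simp only [Polynomial.eval_monomial]
    rw [← Finset.mul_sum, ← Finset.mul_sum, h]
    ring

/-- Test with the square of a polynomial vanishing at all `y_j`: the sum over the `x_i` is zero with
nonnegative terms, so every `x_i` is a root. The factor `m` may be anything, which allows for
eigenvalue multiplicities. -/
theorem range_subset_of_psum {x : ι → ℝ} {y : κ → ℝ} {m : ℝ}
    (h : ∀ k : ℕ, ∑ i, x i ^ k = m * ∑ j, y j ^ k) : Set.range x ⊆ Set.range y := by
  rintro _ ⟨i, rfl⟩
  set p : Polynomial ℝ := (∏ j, (Polynomial.X - Polynomial.C (y j))) ^ 2 with hp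
  have h1 := sum_eval_eq_of_psum h p
  have h2 : ∀ j, p.eval (y j) = 0 := fun j => by
    rw [hp, Polynomial.eval_pow, Polynomial.eval_prod,
      Finset.prod_eq_zero (Finset.mem_univ j) (by simp)]
    simp
  rw [Finset.sum_eq_zero fun j _ => h2 j, mul_zero,
    Finset.sum_eq_zero_iff_of_nonneg fun i _ => by rw [hp, Polynomial.eval_pow]; positivity] at h1
  have h3 := h1 i (Finset.mem_univ i)
  rw [hp, Polynomial.eval_pow, Polynomial.eval_prod, sq_eq_zero_iff, Finset.prod_eq_zero_iff] at h3
  obtain ⟨j, -, hj⟩ := h3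
  exact ⟨j, by simp [sub_eq_zero] at hj; exact hj.symm⟩

/-- Test with a polynomial that vanishes at all occurring values except `a`; both sums then count
occurrences of `a`. -/
theorem card_filter_eq_of_psum [DecidableEq ι] {x y : ι → ℝ}
    (h : ∀ k : ℕ, ∑ i, x i ^ k = ∑ i, y i ^ k) (a : ℝ) :
    (Finset.univ.filter fun i => x i = a).card = (Finset.univ.filter fun i => y i = a).card := by
  classical
  set S := (Finset.univ.image x ∪ Finset.univ.image y).erase a with hS
  set p : Polynomial ℝ := ∏ b ∈ S, (Polynomial.X - Polynomial.C b) with hp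
  have hpa : p.eval a ≠ 0 := by
    rw [hp, Polynomial.eval_prod, Finset.prod_ne_zero_iff]
    intro b hb
    simp only [Polynomial.eval_sub, Polynomial.eval_X, Polynomial.eval_C]
    exact sub_ne_zero.2 (Finset.ne_of_mem_erase hb).symm
  have hpb : ∀ b ∈ Finset.univ.image x ∪ Finset.univ.image y, b ≠ a → p.eval b = 0 := by
    intro b hb hba
    rw [hp, Polynomial.eval_prod]
    exact Finset.prod_eq_zero (Finset.mem_erase.2 ⟨hba, hb⟩) (by simp)
  have hsum : ∀ z : ι → ℝ, (∀ i, z i ∈ Finset.univ.image x ∪ Finset.univ.image y) →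
      ∑ i, p.eval (z i) = (Finset.univ.filter fun i => z i = a).card * p.eval a := by
    intro z hz
    rw [Finset.card_filter, Nat.cast_sum, Finset.sum_mul]
    refine Finset.sum_congr rfl fun i _ => ?_
    by_cases hi : z i = a
    · simp [hi]
    · simp [hi, hpb _ (hz i) hi]
  have h1 := sum_eval_eq_of_psum (m := 1) (by simpa using h) p
  rw [one_mul, hsum x (fun i => by simp), hsum y (fun i => by simp)] at h1
  exact_mod_cast mul_right_cancel₀ hpa h1

/-- The power sums determine the multiset of values, and a decreasing tuple is recovered from the
numbers of entries above each level. -/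
theorem Antitone.eq_of_psum {n : ℕ} {x y : Fin n → ℝ} (hx : Antitone x) (hy : Antitone y)
    (h : ∀ k : ℕ, ∑ i, x i ^ k = ∑ i, y i ^ k) : x = y := by
  have hm : (Finset.univ.val.map x) = (Finset.univ.val.map y) := by
    ext a
    rw [Multiset.count_map, Multiset.count_map]
    have := card_filter_eq_of_psum h a
    simp only [Finset.card_def, Finset.filter_val] at this
    simpa [eq_comm] using this
  have hc : ∀ a, (Finset.univ.filter fun i => a < x i).card
      = (Finset.univ.filter fun i => a < y i).card := by
    intro a
    have := congrArg (Multiset.countP (a < ·)) hm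
    rw [Multiset.countP_map, Multiset.countP_map] at this
    exact this
  refine funext fun j => eq_of_forall_lt_iff fun a => ?_
  rw [← Tuple.lt_card_gt_iff_apply_gt_of_antitone (j := j) hx, hc,
    Tuple.lt_card_gt_iff_apply_gt_of_antitone hy]

/-- The power sums form an injective measurable map on the closed set of decreasing tuples. By the
Lusin–Souslin theorem it is a measurable embedding, so measurability can be tested after applying
it. -/
theorem measurable_of_psum {Ω : Type*} [MeasurableSpace Ω] {n : ℕ} {f : Ω → Fin n → ℝ}
    (hf : ∀ ω, Antitone (f ω)) (h : ∀ k : ℕ, Measurable fun ω => ∑ i, f ω i ^ k) :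
    Measurable f := by
  have hcl : MeasurableSet {x : Fin n → ℝ | Antitone x} := isClosed_antitone.measurableSet
  have : StandardBorelSpace {x : Fin n → ℝ | Antitone x} := hcl.standardBorel
  have hemb : MeasurableEmbedding
      fun (x : {x : Fin n → ℝ | Antitone x}) (k : ℕ) => ∑ i, (x : Fin n → ℝ) i ^ k := by
    refine Measurable.measurableEmbedding (measurable_pi_iff.2 fun k => ?_) fun x y hxy => Subtype.ext ?_
    · refine Finset.measurable_sum _ fun i _ => Measurable.pow_const ?_ k
      exact (measurable_pi_apply i).comp measurable_subtype_coe
    · exact Antitone.eq_of_psum x.2 y.2 fun k => congrFun hxy k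
  have hm : Measurable fun ω => (⟨f ω, hf ω⟩ : {x : Fin n → ℝ | Antitone x}) :=
    hemb.measurable_comp_iff.1 (measurable_pi_iff.2 fun k => h k)
  exact measurable_subtype_coe.comp hm

end PowerSums

/-! ### Coordinates and ordered eigenvalues of Hermitian matrices. -/

/-- Real coordinates of Hermitian matrices over a division algebra of real dimension `β`. -/
abbrev HermCoord (n β : ℕ) : Type := (Fin n → ℝ) × (OffDiag n → Fin β → ℝ)

namespace HurwitzFrame

section Algebra

variable {F : Type} [DivisionRing F] [Algebra ℝ F] [StarRing F] [StarModule ℝ F] {β : ℕ}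
  (H : HurwitzFrame F β) {n : ℕ}

/-- The Hermitian matrix with given coordinates. -/
noncomputable def herm (c : HermCoord n β) : Matrix (Fin n) (Fin n) F :=
  hermitianOf c.1 fun p => H.coord.symm (c.2 p)

theorem herm_diag (c : HermCoord n β) (i : Fin n) : H.herm c i i = algebraMap ℝ F (c.1 i) := by
  simp [herm, hermitianOf]

theorem herm_lt (c : HermCoord n β) {i j : Fin n} (h : i < j) :
    H.herm c i j = H.coord.symm (c.2 ⟨(i, j), h⟩) := by
  simp [herm, hermitianOf, h]

theorem herm_gt (c : HermCoord n β) {i j : Fin n} (h : j < i) :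
    H.herm c i j = star (H.coord.symm (c.2 ⟨(j, i), h⟩)) := by
  simp [herm, hermitianOf, h, h.not_gt]

theorem isHermitian_herm (c : HermCoord n β) : (H.herm c).IsHermitian := by
  ext i j
  rw [conjTranspose_apply]
  rcases lt_trichotomy i j with h | rfl | h
  · rw [H.herm_lt c h, H.herm_gt c h, star_star]
  · rw [H.herm_diag, ← algebraMap_star_comm]; simp
  · rw [H.herm_gt c h, H.herm_lt c h]

theorem herm_add (c d : HermCoord n β) : H.herm (c + d) = H.herm c + H.herm d := by
  ext i j
  rw [Matrix.add_apply]
  rcases lt_trichotomy i j with h | rfl | h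
  · simp [H.herm_lt _ h]
  · simp [H.herm_diag]
  · simp [H.herm_gt _ h]

theorem herm_smul (r : ℝ) (c : HermCoord n β) : H.herm (r • c) = r • H.herm c := by
  ext i j
  rw [Matrix.smul_apply]
  rcases lt_trichotomy i j with h | rfl | h
  · simp [H.herm_lt _ h]
  · rw [H.herm_diag, H.herm_diag, Prod.smul_fst, Pi.smul_apply, smul_eq_mul, map_mul,
      ← Algebra.smul_def]
  · simp [H.herm_gt _ h]

/-- The coordinates of a Hermitian matrix. -/
noncomputable def coordOf (X : Matrix (Fin n) (Fin n) F) : HermCoord n β :=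
  (fun i => H.re (X i i), fun p => H.coord (X p.1.1 p.1.2))

theorem herm_coordOf {X : Matrix (Fin n) (Fin n) F} (hX : X.IsHermitian) :
    H.herm (H.coordOf X) = X := by
  ext i j
  rcases lt_trichotomy i j with h | rfl | h
  · simp [H.herm_lt _ h, coordOf]
  · rw [H.herm_diag]; exact H.algebraMap_re _ (hX.apply i i)
  · simp [H.herm_gt _ h, coordOf, hX.apply i j]

theorem coordOf_herm (c : HermCoord n β) : H.coordOf (H.herm c) = c := by
  refine Prod.ext (funext fun i => ?_) (funext fun p => ?_)
  · simp [coordOf, H.herm_diag, H.re_algebraMap]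
  · simp [coordOf, H.herm_lt c p.2]

variable [NeZero β]

/-- The eigenvalues in decreasing order. -/
noncomputable def eig (c : HermCoord n β) : Fin n → ℝ :=
  (H.exists_orthonormalBasis (H.isHermitian_herm c)).choose

theorem antitone_eig (c : HermCoord n β) : Antitone (H.eig c) :=
  (H.exists_orthonormalBasis (H.isHermitian_herm c)).choose_spec.1

/-- The trace of the `k`-th power of the real operator is `β` times either side: by `trace_op` for
the left, and by the orthonormal eigenbasis, where each eigenvalue appears `β` times, for the right.
-/
theorem rtr_herm_pow (c : HermCoord n β) (k : ℕ) :
    H.rtr (H.herm c ^ k) = ∑ j, H.eig c j ^ k := by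
  obtain ⟨-, b, hb⟩ := (H.exists_orthonormalBasis (H.isHermitian_herm c)).choose_spec
  change ∀ p, H.op (H.herm c) (b p) = H.eig c p.1 • b p at hb
  have h1 := H.trace_op ((H.isHermitian_herm c).pow k)
  rw [← H.op_pow, LinearMap.trace_eq_sum_inner _ b] at h1
  have h2 : ∀ p, (H.op (H.herm c) ^ k) (b p) = H.eig c p.1 ^ k • b p := by
    intro p
    induction k with
    | zero => simp
    | succ k ih =>
      -- The context contains `h1`, which mentions `k`, so the induction hypothesis asks for its
      -- version at the smaller exponent.
      have := ih (by rw [H.op_pow, ← LinearMap.trace_eq_sum_inner _ b,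
        H.trace_op ((H.isHermitian_herm c).pow k)])
      rw [pow_succ', Module.End.mul_apply, this, map_smul, hb, smul_smul, pow_succ]
  simp only [h2, inner_smul_right, real_inner_self_eq_norm_sq, b.norm_eq_one, one_pow, mul_one] at h1
  rw [Fintype.sum_prod_type] at h1
  simp only [Finset.sum_const, Finset.card_univ, Fintype.card_fin, nsmul_eq_mul,
    ← Finset.mul_sum] at h1
  exact (mul_left_cancel₀ (by exact_mod_cast NeZero.ne β) h1).symm

/-- The Gaussian average of a function of the Rayleigh quotient only depends on the eigenvalues. -/
theorem lintegral_gauss_op (c : HermCoord n β) {g : ℝ → ENNReal} (hg : Measurable g) :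
    ∫⁻ y, g (inner ℝ (H.op (H.herm c) y) y / ‖y‖ ^ 2) ∂gauss (Fin n × Fin β)
      = ∫⁻ y, g (rayleigh (fun p => H.eig c p.1) y) ∂gauss (Fin n × Fin β) := by
  obtain ⟨-, b, hb⟩ := (H.exists_orthonormalBasis (H.isHermitian_herm c)).choose_spec
  change ∀ p, H.op (H.herm c) (b p) = H.eig c p.1 • b p at hb
  have hr := measurable_rayleigh fun p : Fin n × Fin β => H.eig c p.1
  have hcont : Continuous (H.op (H.herm c)) := LinearMap.continuous_of_finiteDimensional _
  rw [lintegral_gauss (by fun_prop), lintegral_gauss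
    (f := fun y => g (rayleigh (fun p : Fin n × Fin β => H.eig c p.1) y)) (by fun_prop),
    ← b.repr.measurePreserving.lintegral_comp
      (f := fun y => ENNReal.ofReal (Real.exp (-‖y‖ ^ 2)) * g (rayleigh (fun p => H.eig c p.1) y))
      (by fun_prop)]
  refine lintegral_congr fun y => ?_
  rw [LinearIsometryEquiv.norm_map, rayleigh, LinearIsometryEquiv.norm_map]
  congr 3
  have hy : y = ∑ p, b.repr y p • b p := (b.sum_repr y).symm
  have h1 : H.op (H.herm c) y = ∑ p, (H.eig c p.1 * b.repr y p) • b p := by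
    conv_lhs => rw [hy]
    simp [map_sum, hb, smul_smul, mul_comm]
  rw [h1, sum_inner]
  refine Finset.sum_congr rfl fun p _ => ?_
  rw [inner_smul_left, b.repr_apply_apply]
  simp; ring

end Algebra

section Topology

variable {F : Type} [NormedDivisionRing F] [NormedAlgebra ℝ F] [StarRing F] [StarModule ℝ F]
  {β : ℕ} (H : HurwitzFrame F β) {n : ℕ}

theorem finiteDimensional (H : HurwitzFrame F β) : FiniteDimensional ℝ F :=
  LinearEquiv.finiteDimensional H.coord.symm

theorem continuous_re : Continuous H.re :=
  haveI := H.finiteDimensional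
  LinearMap.continuous_of_finiteDimensional _

theorem continuous_herm : Continuous (H.herm : HermCoord n β → Matrix (Fin n) (Fin n) F) := by
  have := H.finiteDimensional
  let L : HermCoord n β →ₗ[ℝ] (Fin n → Fin n → F) :=
    { toFun := H.herm, map_add' := H.herm_add, map_smul' := H.herm_smul }
  exact LinearMap.continuous_of_finiteDimensional L

theorem continuous_rtr : Continuous (H.rtr : Matrix (Fin n) (Fin n) F → ℝ) :=
  H.continuous_re.comp (Continuous.matrix_trace continuous_id)

/-- The eigenvalues come from a choice, but their power sums are traces of matrix powers and hence
continuous. -/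
theorem measurable_eig [NeZero β] : Measurable (H.eig : HermCoord n β → Fin n → ℝ) := by
  refine measurable_of_psum H.antitone_eig fun k => ?_
  simp only [← H.rtr_herm_pow]
  exact (H.continuous_rtr.comp (H.continuous_herm.pow k)).measurable

end Topology

end HurwitzFrame

end ExternalSource

namespace ExternalSource

open MeasureTheory Module

/-! ### Gaussian integration by parts for functions of polynomial growth -/

/-- Functions of polynomial growth. -/
def PolyGrowth {E G : Type*} [Norm E] [Norm G] (f : E → G) : Prop :=
  ∃ (C : ℝ) (K : ℕ), ∀ x, ‖f x‖ ≤ C * (1 + ‖x‖) ^ K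

namespace PolyGrowth

variable {E G : Type*} [NormedAddCommGroup E] [NormedAddCommGroup G]

theorem nonneg {f : E → G} {C : ℝ} {K : ℕ} (h : ∀ x, ‖f x‖ ≤ C * (1 + ‖x‖) ^ K) : 0 ≤ C := by
  have := (norm_nonneg _).trans (h 0)
  simpa using this

theorem const (a : G) : PolyGrowth fun _ : E => a := ⟨‖a‖, 0, fun x => by simp⟩

theorem mono {G' : Type*} [NormedAddCommGroup G'] {f : E → G} {g : E → G'} (hf : PolyGrowth f)
    (h : ∀ x, ‖g x‖ ≤ ‖f x‖) : PolyGrowth g := by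
  obtain ⟨C, K, hC⟩ := hf
  exact ⟨C, K, fun x => (h x).trans (hC x)⟩

theorem norm {f : E → G} (hf : PolyGrowth f) : PolyGrowth fun x => ‖f x‖ :=
  hf.mono fun x => by simp

theorem add {f g : E → G} (hf : PolyGrowth f) (hg : PolyGrowth g) :
    PolyGrowth fun x => f x + g x := by
  obtain ⟨C, K, hC⟩ := hf
  obtain ⟨D, L, hD⟩ := hg
  have hC0 := nonneg hC
  have hD0 := nonneg hD
  refine ⟨C + D, K + L, fun x => ?_⟩
  have h1 : 1 ≤ 1 + ‖x‖ := by linarith [norm_nonneg x]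
  calc ‖f x + g x‖ ≤ C * (1 + ‖x‖) ^ K + D * (1 + ‖x‖) ^ L :=
        (norm_add_le _ _).trans (add_le_add (hC x) (hD x))
    _ ≤ C * (1 + ‖x‖) ^ (K + L) + D * (1 + ‖x‖) ^ (K + L) := by
        gcongr <;> first | exact h1 | omega
    _ = _ := by ring

theorem sum {ι : Type*} (s : Finset ι) {f : ι → E → G} (hf : ∀ i ∈ s, PolyGrowth (f i)) :
    PolyGrowth fun x => ∑ i ∈ s, f i x := by
  classical
  induction s using Finset.induction_on with
  | empty => simpa using const (E := E) (0 : G)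
  | insert a s ha ih =>
    simp only [Finset.sum_insert ha]
    exact (hf a (by simp)).add (ih fun i hi => hf i (by simp [hi]))

theorem clm [NormedSpace ℝ E] [NormedSpace ℝ G] (L : E →L[ℝ] G) : PolyGrowth L := by
  refine ⟨‖L‖, 1, fun x => (L.le_opNorm x).trans ?_⟩
  rw [pow_one]
  gcongr
  linarith

theorem clm_comp [NormedSpace ℝ G] {G' : Type*} [NormedAddCommGroup G'] [NormedSpace ℝ G']
    (L : G →L[ℝ] G') {f : E → G} (hf : PolyGrowth f) : PolyGrowth fun x => L (f x) := by
  obtain ⟨C, K, hC⟩ := hf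
  refine ⟨‖L‖ * C, K, fun x => (L.le_opNorm _).trans ?_⟩
  rw [mul_assoc]
  gcongr
  exact hC x

section Ring

variable {A : Type*} [NormedRing A]

theorem mul {f g : E → A} (hf : PolyGrowth f) (hg : PolyGrowth g) :
    PolyGrowth fun x => f x * g x := by
  obtain ⟨C, K, hC⟩ := hf
  obtain ⟨D, L, hD⟩ := hg
  have hC0 := nonneg hC
  refine ⟨C * D, K + L, fun x => (norm_mul_le _ _).trans ?_⟩
  calc ‖f x‖ * ‖g x‖ ≤ (C * (1 + ‖x‖) ^ K) * (D * (1 + ‖x‖) ^ L) := by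
        gcongr
        · exact hC x
        · exact hD x
    _ = _ := by ring

theorem pow {f : E → A} (hf : PolyGrowth f) (k : ℕ) : PolyGrowth fun x => f x ^ k := by
  induction k with
  | zero => simpa using const (1 : A)
  | succ k ih => simpa only [pow_succ] using ih.mul hf

end Ring

theorem prod {A : Type*} [NormedCommRing A] {ι : Type*} (s : Finset ι) {f : ι → E → A}
    (hf : ∀ i ∈ s, PolyGrowth (f i)) : PolyGrowth fun x => ∏ i ∈ s, f i x := by
  classical
  induction s using Finset.induction_on with
  | empty => simpa using const (E := E) (1 : A)
  | insert a s ha ih =>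
    simp only [Finset.prod_insert ha]
    exact (hf a (by simp)).mul (ih fun i hi => hf i (by simp [hi]))

theorem multiset_prod {A : Type*} [NormedCommRing A] {ι : Type*} (s : Multiset ι) {f : ι → E → A}
    (hf : ∀ i, PolyGrowth (f i)) : PolyGrowth fun x => (s.map fun i => f i x).prod := by
  induction s using Multiset.induction_on with
  | empty => simpa using const (E := E) (1 : A)
  | cons a s ih =>
    simp only [Multiset.map_cons, Multiset.prod_cons]
    exact (hf a).mul ih

variable [NormedSpace ℝ E] [FiniteDimensional ℝ E] [MeasurableSpace E] [BorelSpace E]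
  {μ : Measure E} [μ.IsAddHaarMeasure]

/-- A function of polynomial growth is integrable against a Gaussian. -/
theorem integrable_mul_exp {f : E → ℝ} (hf : PolyGrowth f) (hm : AEStronglyMeasurable f μ)
    {Q : E → ℝ} (hQ : ∀ x, ‖x‖ ^ 2 ≤ Q x) (hQc : Continuous Q) {a : ℝ} (ha : 0 < a) :
    Integrable (fun x => f x * Real.exp (-a * Q x)) μ := by
  obtain ⟨C, K, hC⟩ := hf
  have hC0 := nonneg hC
  -- `(1 + |x|)^{-r}` is integrable. The remaining `(1 + |x|)^{K+r}` is at most `(K+r)! e^{1+|x|}`,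
  -- and the Gaussian absorbs the exponential since `|x| - a|x|² ≤ 1/(4a)`.
  set r := finrank ℝ E + 1 with hr
  have h1 : Integrable (fun x : E => (1 + ‖x‖) ^ (-(r : ℝ))) μ :=
    integrable_one_add_norm (by rw [hr]; push_cast; linarith)
  refine (h1.const_mul (C * ((K + r).factorial * Real.exp (1 + 1 / (4 * a))))).mono'
    (hm.mul (by fun_prop)) (Filter.Eventually.of_forall fun x => ?_)
  have hp : 0 < 1 + ‖x‖ := by positivity
  have h2 : (1 + ‖x‖) ^ (K + r) ≤ (K + r).factorial * Real.exp (1 + ‖x‖) := by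
    have := Real.pow_div_factorial_le_exp (1 + ‖x‖) hp.le (K + r)
    rwa [div_le_iff₀ (by positivity), mul_comm] at this
  have h3 : Real.exp (1 + ‖x‖) * Real.exp (-a * Q x) ≤ Real.exp (1 + 1 / (4 * a)) := by
    rw [← Real.exp_add, Real.exp_le_exp]
    have h5 : 0 ≤ (2 * a * ‖x‖ - 1) ^ 2 / (4 * a) := by positivity
    have h6 : (2 * a * ‖x‖ - 1) ^ 2 / (4 * a) = a * ‖x‖ ^ 2 - ‖x‖ + 1 / (4 * a) := by
      field_simp; ring
    nlinarith [hQ x]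
  rw [norm_mul, Real.norm_of_nonneg (Real.exp_pos _).le, Real.rpow_neg hp.le, Real.rpow_natCast]
  calc ‖f x‖ * Real.exp (-a * Q x) ≤ C * (1 + ‖x‖) ^ K * Real.exp (-a * Q x) := by
        gcongr; exact hC x
    _ = C * ((1 + ‖x‖) ^ (K + r) * Real.exp (-a * Q x)) * ((1 + ‖x‖) ^ r)⁻¹ := by
        rw [pow_add]; field_simp
    _ ≤ C * ((K + r).factorial * Real.exp (1 + 1 / (4 * a))) * ((1 + ‖x‖) ^ r)⁻¹ := by
        have h4 : (1 + ‖x‖) ^ (K + r) * Real.exp (-a * Q x)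
            ≤ (K + r).factorial * Real.exp (1 + 1 / (4 * a)) :=
          calc _ ≤ (K + r).factorial * Real.exp (1 + ‖x‖) * Real.exp (-a * Q x) := by gcongr
            _ = (K + r).factorial * (Real.exp (1 + ‖x‖) * Real.exp (-a * Q x)) := by ring
            _ ≤ _ := by gcongr
        gcongr

end PolyGrowth

section Stein

variable {E : Type*} [NormedAddCommGroup E] [NormedSpace ℝ E] [FiniteDimensional ℝ E]
  [MeasurableSpace E] [BorelSpace E] {μ : Measure E} [μ.IsAddHaarMeasure]

/-- Gaussian integration by parts. -/
theorem integral_lineDeriv_mul_gaussian {Q q : E → ℝ} (hQ : ∀ x, ‖x‖ ^ 2 ≤ Q x)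
    (hQc : Continuous Q) {v : E} (hQd : ∀ x, HasLineDerivAt ℝ Q (2 * q x) x v)
    (hq : PolyGrowth q) (hqc : Continuous q) {g g' : E → ℝ}
    (hgd : ∀ x, HasLineDerivAt ℝ g (g' x) x v) (hg : PolyGrowth g) (hg' : PolyGrowth g')
    (hgc : Continuous g) (hgc' : Continuous g') :
    ∫ x, g' x * Real.exp (-(1 / 2) * Q x) ∂μ
      = ∫ x, g x * q x * Real.exp (-(1 / 2) * Q x) ∂μ := by
  have hw : ∀ x, HasLineDerivAt ℝ (fun x => Real.exp (-(1 / 2) * Q x))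
      (-q x * Real.exp (-(1 / 2) * Q x)) x v := by
    intro x
    have h1 : HasDerivAt (fun t : ℝ => Q (x + t • v)) (2 * q x) 0 := hQd x
    have h2 := (h1.const_mul (-(1 / 2 : ℝ))).exp
    refine h2.congr_deriv ?_
    simp; ring
  have h := integral_bilinear_hasLineDerivAt_right_eq_neg_left_of_integrable (μ := μ)
    (f := fun x => Real.exp (-(1 / 2) * Q x)) (f' := fun x => -q x * Real.exp (-(1 / 2) * Q x))
    (g := g) (g' := g') (v := v) (B := ContinuousLinearMap.mul ℝ ℝ) ?_ ?_ ?_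
    (fun x _ => hw x) (fun x _ => hgd x)
  · simp only [ContinuousLinearMap.mul_apply'] at h
    calc _ = ∫ x, Real.exp (-(1 / 2) * Q x) * g' x ∂μ := by simp only [mul_comm]
      _ = _ := by
        rw [h, ← integral_neg]
        congr 1; ext x; ring
  · have := (hq.mul hg).integrable_mul_exp (μ := μ) (by fun_prop) hQ hQc (a := 1 / 2) (by norm_num)
    refine this.neg.congr (Filter.Eventually.of_forall fun x => ?_)
    simp; ring
  · have := hg'.integrable_mul_exp (μ := μ) (by fun_prop) hQ hQc (a := 1 / 2) (by norm_num)
    refine this.congr (Filter.Eventually.of_forall fun x => ?_)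
    simp; ring
  · have := hg.integrable_mul_exp (μ := μ) (by fun_prop) hQ hQc (a := 1 / 2) (by norm_num)
    refine this.congr (Filter.Eventually.of_forall fun x => ?_)
    simp; ring

end Stein

/-! ### Loop equations -/

theorem hasDerivAt_multiset_prod {f : ℕ → ℝ → ℝ} {f' : ℕ → ℝ} {t : ℝ}
    (h : ∀ l, HasDerivAt (f l) (f' l) t) (s : Multiset ℕ) :
    HasDerivAt (fun t => (s.map fun l => f l t).prod)
      (s.map fun l => f' l * ((s.erase l).map fun l => f l t).prod).sum t := by
  induction s using Multiset.induction_on with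
  | empty => simpa using hasDerivAt_const t (1 : ℝ)
  | cons a s ih =>
    simp only [Multiset.map_cons, Multiset.prod_cons, Multiset.sum_cons, Multiset.erase_cons_head]
    refine ((h a).mul ih).congr_deriv ?_
    congr 1
    rw [← Multiset.sum_map_mul_left]
    refine congrArg _ (Multiset.map_congr rfl fun l hl => ?_)
    rw [Multiset.erase_cons_tail_of_mem hl, Multiset.map_cons, Multiset.prod_cons]
    ring

/-- The loop equations for the mixed moments `A s` of the power sums `p_k`, `k ∈ s`, in `n`
variables. -/
structure LoopEquations (β n : ℕ) (A : Multiset ℕ → ℝ) : Prop where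
  zero_cons : ∀ s, A (0 ::ₘ s) = n * A s
  succ_cons : ∀ k s, A ((k + 1) ::ₘ s)
    = (β : ℝ) / 2 * ∑ a ∈ Finset.range k, A (a ::ₘ (k - 1 - a) ::ₘ s)
      + (1 - (β : ℝ) / 2) * k * A ((k - 1) ::ₘ s)
      + (s.map fun l => l * A ((l - 1 + k) ::ₘ s.erase l)).sum

/-- Each loop equation expresses a moment through moments with smaller `s.sum + s.card`. By
induction all moments are determined, linearly, by the moment of the empty multiset. -/
theorem LoopEquations.proportional {β n : ℕ} {A B : Multiset ℕ → ℝ} (hA : LoopEquations β n A)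
    (hB : LoopEquations β n B) (s : Multiset ℕ) : A s * B 0 = B s * A 0 := by
  induction hN : s.sum + s.card using Nat.strong_induction_on generalizing s with
  | _ N ih =>
    induction s using Multiset.induction_on with
    | empty => exact mul_comm _ _
    | cons m s _ =>
      rw [Multiset.sum_cons, Multiset.card_cons] at hN
      rcases m with - | k
      · rw [hA.zero_cons, hB.zero_cons, mul_assoc, ih _ (by omega) s rfl, mul_assoc]
      · rw [hA.succ_cons, hB.succ_cons]
        simp only [add_mul, mul_assoc, Finset.sum_mul, ← Multiset.sum_map_mul_right]
        congr 1
        · congr 1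
          · congr 1
            refine Finset.sum_congr rfl fun a ha => ih _ ?_ _ rfl
            rw [Finset.mem_range] at ha
            simp only [Multiset.sum_cons, Multiset.card_cons]
            omega
          · rcases k with - | k
            · simp
            · rw [ih _ ?_ _ rfl]
              simp only [Multiset.sum_cons, Multiset.card_cons]
              omega
        · refine congrArg _ (Multiset.map_congr rfl fun l hl => ?_)
          rcases l with - | l
          · simp
          · rw [ih _ ?_ _ rfl]
            have h1 := Multiset.sum_erase hl
            have h2 := Multiset.card_erase_add_one hl
            simp only [Multiset.sum_cons, Multiset.card_cons]
            omega

end ExternalSource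

/-! ### Coordinate calculus: `Tr XY` as a weighted dot product and the divergence of `X B Y`. -/

namespace ExternalSource

open MeasureTheory Matrix Module

theorem sum_sum_eq_diag_add_offDiag {n : ℕ} (f : Fin n → Fin n → ℝ) :
    ∑ i, ∑ j, f i j
      = ∑ i, f i i + ∑ p : OffDiag n, (f p.1.1 p.1.2 + f p.1.2 p.1.1) := by
  have h1 : ∀ g : Fin n → Fin n → ℝ,
      ∑ p : OffDiag n, g p.1.1 p.1.2 = ∑ i, ∑ j, if i < j then g i j else 0 := by
    intro g
    rw [← Fintype.sum_prod_type' (fun i j => if i < j then g i j else 0), ← Finset.sum_filter]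
    exact (Finset.sum_subtype (Finset.univ.filter fun p : Fin n × Fin n => p.1 < p.2)
      (by simp) fun p => g p.1 p.2).symm
  rw [Finset.sum_add_distrib, h1, h1 fun i j => f j i,
    Finset.sum_comm (f := fun i j => if i < j then f j i else 0), ← Finset.sum_add_distrib,
    ← Finset.sum_add_distrib]
  refine Finset.sum_congr rfl fun i _ => ?_
  rw [← Finset.sum_add_distrib]
  have h2 : f i i = ∑ j, if i = j then f i j else 0 := by simp
  rw [h2, ← Finset.sum_add_distrib]
  refine Finset.sum_congr rfl fun j _ => ?_
  rcases lt_trichotomy i j with h | rfl | h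
  · simp [h, h.ne, h.not_gt]
  · simp
  · simp [h, h.ne', h.not_gt]

/-- Indices of the real coordinates of a Hermitian matrix. -/
abbrev CoordIndex (n β : ℕ) : Type := Fin n ⊕ (OffDiag n × Fin β)

/-- The basis vectors of the coordinate space. -/
def coordUnit {n β : ℕ} : CoordIndex n β → HermCoord n β
  | .inl i => (Pi.single i 1, 0)
  | .inr (p, k) => (0, Pi.single p (Pi.single k 1))

/-- The coordinate functionals. -/
def coordFun {n β : ℕ} : CoordIndex n β → HermCoord n β →L[ℝ] ℝ
  | .inl i => (ContinuousLinearMap.proj (R := ℝ) (φ := fun _ : Fin n => ℝ) i).comp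
      (ContinuousLinearMap.fst ℝ _ _)
  | .inr (p, k) => (ContinuousLinearMap.proj (R := ℝ) (φ := fun _ : Fin β => ℝ) k).comp
      ((ContinuousLinearMap.proj (R := ℝ) (φ := fun _ : OffDiag n => Fin β → ℝ) p).comp
        (ContinuousLinearMap.snd ℝ _ _))

/-- The weights of the coordinates in `Tr M²`. -/
def coordWeight {n β : ℕ} : CoordIndex n β → ℝ
  | .inl _ => 1
  | .inr _ => 2

/-- The quadratic form `Tr M²` in coordinates. -/
noncomputable def coordQuad {n β : ℕ} (c : HermCoord n β) : ℝ :=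
  ∑ α, coordWeight α * coordFun α c ^ 2

section Coordinates

variable {n β : ℕ}

theorem sum_coordFun_smul (c : HermCoord n β) : ∑ α, coordFun α c • coordUnit α = c := by
  rw [Fintype.sum_sum_type, Fintype.sum_prod_type]
  refine Prod.ext ?_ ?_
  · rw [Prod.fst_add, Prod.fst_sum, Prod.fst_sum]
    ext i
    simp [coordFun, coordUnit, Finset.sum_apply, Pi.single_apply, Prod.fst_sum]
  · rw [Prod.snd_add, Prod.snd_sum, Prod.snd_sum]
    ext p k
    simp [coordFun, coordUnit, Finset.sum_apply, Pi.single_apply, Prod.snd_sum]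

theorem coordFun_coordUnit (α α' : CoordIndex n β) :
    coordFun α (coordUnit α') = if α = α' then 1 else 0 := by
  rcases α with i | ⟨p, k⟩ <;> rcases α' with i' | ⟨p', k'⟩
  · simp [coordFun, coordUnit, Pi.single_apply]
  · simp [coordFun, coordUnit]
  · simp [coordFun, coordUnit]
  · by_cases hp : p = p'
    · subst hp; simp [coordFun, coordUnit, Pi.single_apply]
    · simp [coordFun, coordUnit, hp]

theorem continuous_coordQuad : Continuous (coordQuad : HermCoord n β → ℝ) := by
  unfold coordQuad
  fun_prop

theorem norm_sq_le_coordQuad (c : HermCoord n β) : ‖c‖ ^ 2 ≤ coordQuad c := by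
  have hw : ∀ α : CoordIndex n β, 1 ≤ coordWeight α := by
    rintro (i | p) <;> simp [coordWeight]
  have h0 : ∀ α, coordFun α c ^ 2 ≤ coordQuad c := fun α =>
    calc coordFun α c ^ 2 ≤ coordWeight α * coordFun α c ^ 2 :=
          le_mul_of_one_le_left (sq_nonneg _) (hw α)
      _ ≤ _ := Finset.single_le_sum (f := fun α => coordWeight α * coordFun α c ^ 2)
          (fun α _ => mul_nonneg (zero_le_one.trans (hw α)) (sq_nonneg _)) (Finset.mem_univ α)
  have hQ : 0 ≤ coordQuad c :=
    Finset.sum_nonneg fun α _ => mul_nonneg (zero_le_one.trans (hw α)) (sq_nonneg _)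
  have h1 : ∀ α, ‖coordFun α c‖ ≤ √(coordQuad c) := fun α => Real.abs_le_sqrt (h0 α)
  have h2 : ‖c‖ ≤ √(coordQuad c) := by
    refine norm_prod_le_iff.2 ⟨?_, ?_⟩
    · exact (pi_norm_le_iff_of_nonneg (Real.sqrt_nonneg _)).2 fun i => h1 (.inl i)
    · refine (pi_norm_le_iff_of_nonneg (Real.sqrt_nonneg _)).2 fun p => ?_
      exact (pi_norm_le_iff_of_nonneg (Real.sqrt_nonneg _)).2 fun k => h1 (.inr (p, k))
  calc ‖c‖ ^ 2 ≤ √(coordQuad c) ^ 2 := by gcongr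
    _ = coordQuad c := Real.sq_sqrt hQ

theorem hasLineDerivAt_coordQuad (c : HermCoord n β) (α : CoordIndex n β) :
    HasLineDerivAt ℝ coordQuad (2 * (coordWeight α * coordFun α c)) c (coordUnit α) := by
  have h1 : ∀ α', HasDerivAt (fun t : ℝ => coordWeight α' * coordFun α' (c + t • coordUnit α) ^ 2)
      (if α' = α then 2 * (coordWeight α * coordFun α c) else 0) 0 := by
    intro α'
    have h2 : HasDerivAt (fun t : ℝ => coordFun α' (c + t • coordUnit α))
        (if α' = α then 1 else 0) 0 := by
      have h3 := ((hasDerivAt_id (0 : ℝ)).mul_const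
        (if α' = α then (1 : ℝ) else 0)).const_add (coordFun α' c)
      rw [one_mul] at h3
      refine h3.congr_of_eventuallyEq (Filter.Eventually.of_forall fun t => ?_)
      simp [coordFun_coordUnit]
    refine ((h2.pow 2).const_mul _).congr_deriv ?_
    split_ifs with h
    · subst h; simp; ring
    · simp
  have h2 := HasDerivAt.fun_sum (u := Finset.univ) fun α' _ => h1 α'
  refine h2.congr_deriv ?_
  simp

end Coordinates

namespace HurwitzFrame

section Algebra

variable {F : Type} [DivisionRing F] [Algebra ℝ F] [StarRing F] [StarModule ℝ F] {β : ℕ}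
  (H : HurwitzFrame F β) {n : ℕ}

theorem rtr_mul (X Y : Matrix (Fin n) (Fin n) F) :
    H.rtr (X * Y) = ∑ i, ∑ j, H.re (X i j * Y j i) := by
  simp [rtr, trace, mul_apply, map_sum]

theorem rtr_mul_comm (X Y : Matrix (Fin n) (Fin n) F) : H.rtr (X * Y) = H.rtr (Y * X) := by
  rw [rtr_mul, rtr_mul, Finset.sum_comm]
  simp only [H.re_mul_comm]

theorem rtr_add (X Y : Matrix (Fin n) (Fin n) F) : H.rtr (X + Y) = H.rtr X + H.rtr Y := by
  simp [rtr]

theorem rtr_smul (r : ℝ) (X : Matrix (Fin n) (Fin n) F) : H.rtr (r • X) = r * H.rtr X := by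
  simp [rtr]

theorem rtr_one : H.rtr (1 : Matrix (Fin n) (Fin n) F) = n := by
  have h := H.re_algebraMap (n : ℝ)
  rw [map_natCast] at h
  simp [rtr, trace, h]

theorem re_mul_of_isHermitian {X Y : Matrix (Fin n) (Fin n) F} (hX : X.IsHermitian)
    (i : Fin n) : H.re (X i i * Y i i) = H.re (X i i) * H.re (Y i i) := by
  conv_lhs => rw [← H.algebraMap_re _ (hX.apply i i)]
  rw [← Algebra.smul_def, map_smul, smul_eq_mul]

/-- Off the diagonal the entries `(i, j)` and `(j, i)` contribute equally to the trace, which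
explains the weight `2`. -/
theorem sum_coordWeight {X Y : Matrix (Fin n) (Fin n) F} (hX : X.IsHermitian)
    (hY : Y.IsHermitian) : ∑ α, coordWeight α * coordFun α (H.coordOf X) *
      coordFun α (H.coordOf Y) = H.rtr (X * Y) := by
  rw [rtr_mul, sum_sum_eq_diag_add_offDiag fun i j => H.re (X i j * Y j i), Fintype.sum_sum_type,
    Fintype.sum_prod_type]
  congr 1
  · refine Finset.sum_congr rfl fun i _ => ?_
    rw [H.re_mul_of_isHermitian hX]
    simp [coordWeight, coordFun, coordOf]
  · refine Finset.sum_congr rfl fun p _ => ?_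
    rw [H.re_mul_comm (X p.1.2 p.1.1), ← hY.apply p.1.2 p.1.1, ← hX.apply p.1.2 p.1.1,
      H.re_mul_star_eq_sum, H.re_mul_star_eq_sum, ← Finset.sum_add_distrib]
    refine Finset.sum_congr rfl fun k _ => ?_
    simp [coordWeight, coordFun, coordOf]
    ring

/-- By linearity, expanding `X` in the coordinate basis. It contracts the gradient of `tr M ^ l`,
where `Y` is a multiple of `M ^ (l - 1)`, with the vector field `X = M ^ k`. -/
theorem sum_coordFun_mul_rtr {X : Matrix (Fin n) (Fin n) F} (hX : X.IsHermitian)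
    (Y : Matrix (Fin n) (Fin n) F) :
    ∑ α, coordFun α (H.coordOf X) * H.rtr (Y * H.herm (coordUnit α)) = H.rtr (Y * X) := by
  let L : HermCoord n β →ₗ[ℝ] ℝ :=
    { toFun := fun c => H.rtr (Y * H.herm c)
      map_add' := fun c d => by rw [H.herm_add, mul_add, H.rtr_add]
      map_smul' := fun r c => by rw [H.herm_smul, mul_smul_comm, H.rtr_smul]; rfl }
  have h1 := congrArg L (sum_coordFun_smul (H.coordOf X))
  rw [map_sum] at h1
  simp only [map_smul, smul_eq_mul] at h1
  change ∑ α, coordFun α (H.coordOf X) * H.rtr (Y * H.herm (coordUnit α))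
    = H.rtr (Y * H.herm (H.coordOf X)) at h1
  rw [h1, H.herm_coordOf hX]

theorem herm_coordUnit_inl (i : Fin n) :
    H.herm (coordUnit (.inl i)) = Matrix.single i i (1 : F) := by
  ext a b
  rcases lt_trichotomy a b with h | rfl | h
  · rw [H.herm_lt _ h, single_apply_of_ne]
    · simp [coordUnit]
    · rintro ⟨rfl, rfl⟩; exact lt_irrefl _ h
  · rw [H.herm_diag, single_apply]
    by_cases h : i = a
    · subst h; simp [coordUnit]
    · simp [coordUnit, h, Ne.symm h]
  · rw [H.herm_gt _ h, single_apply_of_ne]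
    · simp [coordUnit]
    · rintro ⟨rfl, rfl⟩; exact lt_irrefl _ h

theorem coord_symm_single (k : Fin β) : H.coord.symm (Pi.single k 1) = H.e k := by
  rw [coord_symm_apply]
  simp [Pi.single_apply]

theorem herm_coordUnit_inr (p : OffDiag n) (k : Fin β) :
    H.herm (coordUnit (.inr (p, k)))
      = Matrix.single p.1.1 p.1.2 (H.e k) + Matrix.single p.1.2 p.1.1 (star (H.e k)) := by
  obtain ⟨⟨i, j⟩, hij⟩ := p
  change i < j at hij
  ext a b
  rw [Matrix.add_apply, single_apply, single_apply]
  rcases lt_trichotomy a b with h | rfl | h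
  · rw [H.herm_lt _ h]
    have h0 : ¬ (j = a ∧ i = b) := by rintro ⟨rfl, rfl⟩; exact lt_asymm h hij
    rw [if_neg h0, add_zero]
    by_cases h1 : i = a ∧ j = b
    · obtain ⟨rfl, rfl⟩ := h1
      simp [coordUnit, H.coord_symm_single]
    · rw [if_neg h1]
      have : (⟨(a, b), h⟩ : OffDiag n) ≠ ⟨(i, j), hij⟩ := by
        intro h2
        simp only [Subtype.mk.injEq, Prod.mk.injEq] at h2
        exact h1 ⟨h2.1.symm, h2.2.symm⟩
      simp [coordUnit, this]
  · have h0 : ¬ (j = a ∧ i = a) := by rintro ⟨rfl, rfl⟩; exact lt_irrefl _ hij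
    have h1 : ¬ (i = a ∧ j = a) := by rintro ⟨rfl, rfl⟩; exact lt_irrefl _ hij
    rw [H.herm_diag, if_neg h0, if_neg h1]
    simp [coordUnit]
  · rw [H.herm_gt _ h]
    have h0 : ¬ (i = a ∧ j = b) := by rintro ⟨rfl, rfl⟩; exact lt_asymm h hij
    rw [if_neg h0, zero_add]
    by_cases h1 : j = a ∧ i = b
    · obtain ⟨rfl, rfl⟩ := h1
      simp [coordUnit, H.coord_symm_single]
    · rw [if_neg h1]
      have : (⟨(b, a), h⟩ : OffDiag n) ≠ ⟨(i, j), hij⟩ := by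
        intro h2
        simp only [Subtype.mk.injEq, Prod.mk.injEq] at h2
        exact h1 ⟨h2.2.symm, h2.1.symm⟩
      simp [coordUnit, this]

theorem mul_single_mul_apply (X Y : Matrix (Fin n) (Fin n) F) (a b i j : Fin n) (q : F) :
    (X * Matrix.single a b q * Y) i j = X i a * q * Y b j := by
  rw [mul_apply, Finset.sum_eq_single b]
  · simp
  · intro l _ hl
    simp [hl]
  · simp

/-- The conjugate of the frame identity `sum_mul_mul`, which is the source of the coefficient `2 -
β` in the loop equations. -/
theorem sum_star_mul_mul_star (q : F) :
    ∑ k, star (H.e k) * q * star (H.e k) = ((2 : ℝ) - β) • star q := by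
  have := congrArg star (H.sum_mul_mul (star q))
  simpa [star_sum, mul_assoc] using this

/-- The divergence of the vector field `X B Y` on the space of Hermitian matrices. -/
noncomputable def casimir (X Y : Matrix (Fin n) (Fin n) F) : ℝ :=
  ∑ α, coordFun α (H.coordOf (X * H.herm (coordUnit α) * Y))

/-- The coordinate direction `(i, j), k` has `e_k` at `(i, j)` and its conjugate at `(j, i)`. The
first entry gives `X_ii Y_jj` for each of the `β` values of `k`; the second gives `X_ij ē_k Y_ij
ē_k`, whose sum over `k` is `(2 - β) X_ij Y_ji`. -/
theorem casimir_eq {X Y : Matrix (Fin n) (Fin n) F} (hX : X.IsHermitian) (hY : Y.IsHermitian) :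
    H.casimir X Y = ∑ i, H.re (X i i) * H.re (Y i i)
      + ∑ p : OffDiag n, ((β : ℝ) * (H.re (X p.1.1 p.1.1) * H.re (Y p.1.2 p.1.2))
        + ((2 : ℝ) - β) * H.re (X p.1.1 p.1.2 * Y p.1.2 p.1.1)) := by
  rw [casimir, Fintype.sum_sum_type, Fintype.sum_prod_type]
  congr 1
  · refine Finset.sum_congr rfl fun i _ => ?_
    rw [H.herm_coordUnit_inl]
    change H.re ((X * Matrix.single i i (1 : F) * Y : Matrix (Fin n) (Fin n) F) i i) = _
    rw [mul_single_mul_apply, mul_one, H.re_mul_of_isHermitian hX]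
  · refine Finset.sum_congr rfl fun p _ => ?_
    obtain ⟨⟨i, j⟩, hij⟩ := p
    have h1 : ∀ k, coordFun (.inr (⟨(i, j), hij⟩, k))
        (H.coordOf (X * H.herm (coordUnit (.inr (⟨(i, j), hij⟩, k))) * Y))
        = H.re (X i i) * H.re (Y j j)
          + H.re (X i j * (star (H.e k) * Y i j * star (H.e k))) := by
      intro k
      rw [H.herm_coordUnit_inr]
      change H.re ((X * (Matrix.single i j (H.e k) + Matrix.single j i (star (H.e k))) * Y :
        Matrix (Fin n) (Fin n) F) i j
        * star (H.e k)) = _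
      rw [mul_add, add_mul, Matrix.add_apply, mul_single_mul_apply, mul_single_mul_apply, add_mul,
        map_add]
      congr 1
      · rw [← H.algebraMap_re _ (hX.apply i i), ← H.algebraMap_re _ (hY.apply j j),
          H.re_algebraMap, H.re_algebraMap, ← Algebra.smul_def, ← Algebra.commutes,
          ← Algebra.smul_def, smul_mul_assoc, smul_mul_assoc, map_smul, map_smul, H.re_mul_star]
        simp; ring
      · simp only [mul_assoc]
    rw [Finset.sum_congr rfl fun k _ => h1 k, Finset.sum_add_distrib, ← map_sum,
      ← Finset.mul_sum (f := fun k => star (H.e k) * Y i j * star (H.e k)),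
      H.sum_star_mul_mul_star]
    simp [hY.apply]

/-- Adding the two orders completes the sums over `i < j` to sums over all pairs. The diagonal terms
fit because `1 + 1 = β + (2 - β)`. -/
theorem casimir_add_casimir {X Y : Matrix (Fin n) (Fin n) F} (hX : X.IsHermitian)
    (hY : Y.IsHermitian) : H.casimir X Y + H.casimir Y X
      = β * (H.rtr X * H.rtr Y) + (2 - β) * H.rtr (X * Y) := by
  rw [H.casimir_eq hX hY, H.casimir_eq hY hX, rtr_mul, rtr, rtr, trace, trace, map_sum, map_sum,
    Finset.sum_mul_sum, sum_sum_eq_diag_add_offDiag, sum_sum_eq_diag_add_offDiag, mul_add, mul_add,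
    Finset.mul_sum, Finset.mul_sum, Finset.mul_sum, Finset.mul_sum]
  have h1 : ∀ i, H.re (X i i * Y i i) = H.re (X i i) * H.re (Y i i) :=
    H.re_mul_of_isHermitian hX
  have h2 : ∀ i j, H.re (Y i j * X j i) = H.re (X j i * Y i j) := fun i j => H.re_mul_comm _ _
  simp only [diag_apply, h1, h2]
  have e1 : ∑ i, H.re (X i i) * H.re (Y i i) + ∑ i, H.re (Y i i) * H.re (X i i)
      = ∑ i, (β : ℝ) * (H.re (X i i) * H.re (Y i i))
        + ∑ i, ((2 : ℝ) - β) * (H.re (X i i) * H.re (Y i i)) := by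
    rw [← Finset.sum_add_distrib, ← Finset.sum_add_distrib]
    exact Finset.sum_congr rfl fun i _ => by ring
  have e2 : ∑ p : OffDiag n, ((β : ℝ) * (H.re (X p.1.1 p.1.1) * H.re (Y p.1.2 p.1.2))
        + ((2 : ℝ) - β) * H.re (X p.1.1 p.1.2 * Y p.1.2 p.1.1))
      + ∑ p : OffDiag n, ((β : ℝ) * (H.re (Y p.1.1 p.1.1) * H.re (X p.1.2 p.1.2))
        + ((2 : ℝ) - β) * H.re (X p.1.2 p.1.1 * Y p.1.1 p.1.2))
      = ∑ p : OffDiag n, (β : ℝ) * (H.re (X p.1.1 p.1.1) * H.re (Y p.1.2 p.1.2)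
          + H.re (X p.1.2 p.1.2) * H.re (Y p.1.1 p.1.1))
        + ∑ p : OffDiag n, ((2 : ℝ) - β) * (H.re (X p.1.1 p.1.2 * Y p.1.2 p.1.1)
          + H.re (X p.1.2 p.1.1 * Y p.1.1 p.1.2)) := by
    rw [← Finset.sum_add_distrib, ← Finset.sum_add_distrib]
    exact Finset.sum_congr rfl fun i _ => by ring
  linarith

/-- Reversing `a ↦ k - 1 - a` shows that the symmetrized sum is twice the original one. -/
theorem sum_casimir_pow {M : Matrix (Fin n) (Fin n) F} (hM : M.IsHermitian) (k : ℕ) :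
    ∑ a ∈ Finset.range k, H.casimir (M ^ a) (M ^ (k - 1 - a))
      = (β : ℝ) / 2 * ∑ a ∈ Finset.range k, H.rtr (M ^ a) * H.rtr (M ^ (k - 1 - a))
        + (1 - (β : ℝ) / 2) * k * H.rtr (M ^ (k - 1)) := by
  have h1 : ∑ a ∈ Finset.range k, H.casimir (M ^ (k - 1 - a)) (M ^ a)
      = ∑ a ∈ Finset.range k, H.casimir (M ^ a) (M ^ (k - 1 - a)) := by
    rw [← Finset.sum_range_reflect]
    refine Finset.sum_congr rfl fun a ha => ?_
    rw [Finset.mem_range] at ha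
    rw [Nat.sub_sub_self (by omega)]
  have h2 : ∑ a ∈ Finset.range k, (H.casimir (M ^ a) (M ^ (k - 1 - a))
      + H.casimir (M ^ (k - 1 - a)) (M ^ a))
      = ∑ a ∈ Finset.range k, ((β : ℝ) * (H.rtr (M ^ a) * H.rtr (M ^ (k - 1 - a)))
        + (2 - β) * H.rtr (M ^ (k - 1))) := by
    refine Finset.sum_congr rfl fun a ha => ?_
    rw [Finset.mem_range] at ha
    rw [H.casimir_add_casimir (hM.pow a) (hM.pow _), ← pow_add]
    congr 4
    omega
  rw [Finset.sum_add_distrib, h1, Finset.sum_add_distrib, ← Finset.mul_sum, Finset.sum_const,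
    Finset.card_range, nsmul_eq_mul] at h2
  linarith

end Algebra

end HurwitzFrame

end ExternalSource

/-! ### Loop equations of the Gaussian matrix ensembles. -/

namespace ExternalSource

open MeasureTheory Matrix Module

section Loop

variable {E : Type*} [NormedAddCommGroup E] [NormedSpace ℝ E] [FiniteDimensional ℝ E]
  [MeasurableSpace E] [BorelSpace E] {μ : Measure E} [μ.IsAddHaarMeasure]

/-- The Gaussian divergence theorem for a vector field with components `g α`. -/
theorem integral_sum_mul_sub_lineDeriv {ι : Type*} [Fintype ι] {Q : E → ℝ} {q : ι → E → ℝ}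
    (hQ : ∀ x, ‖x‖ ^ 2 ≤ Q x) (hQc : Continuous Q) {v : ι → E}
    (hQd : ∀ α x, HasLineDerivAt ℝ Q (2 * q α x) x (v α)) (hq : ∀ α, PolyGrowth (q α))
    (hqc : ∀ α, Continuous (q α)) {g g' : ι → E → ℝ}
    (hgd : ∀ α x, HasLineDerivAt ℝ (g α) (g' α x) x (v α)) (hg : ∀ α, PolyGrowth (g α))
    (hg' : ∀ α, PolyGrowth (g' α)) (hgc : ∀ α, Continuous (g α)) (hgc' : ∀ α, Continuous (g' α)) :
    ∫ x, (∑ α, g α x * q α x - ∑ α, g' α x) * Real.exp (-(1 / 2) * Q x) ∂μ = 0 := by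
  have h1 : ∀ α, Integrable (fun x => g α x * q α x * Real.exp (-(1 / 2) * Q x)) μ := fun α =>
    ((hg α).mul (hq α)).integrable_mul_exp (((hgc α).mul (hqc α)).aestronglyMeasurable) hQ hQc
      (by norm_num)
  have h2 : ∀ α, Integrable (fun x => g' α x * Real.exp (-(1 / 2) * Q x)) μ := fun α =>
    (hg' α).integrable_mul_exp (hgc' α).aestronglyMeasurable hQ hQc (by norm_num)
  simp only [sub_mul, Finset.sum_mul]
  rw [integral_sub (integrable_finsetSum _ fun α _ => h1 α)
    (integrable_finsetSum _ fun α _ => h2 α), integral_finsetSum _ fun α _ => h1 α,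
    integral_finsetSum _ fun α _ => h2 α, sub_eq_zero]
  exact Finset.sum_congr rfl fun α _ =>
    (integral_lineDeriv_mul_gaussian hQ hQc (hQd α) (hq α) (hqc α) (hgd α) (hg α) (hg' α) (hgc α)
      (hgc' α)).symm

theorem sum_multiset_sum_map {ι κ R : Type*} [AddCommMonoid R] (t : Finset ι) (s : Multiset κ)
    (f : ι → κ → R) : ∑ α ∈ t, (s.map (f α)).sum = (s.map fun l => ∑ α ∈ t, f α l).sum := by
  induction s using Multiset.induction_on with
  | empty => simp
  | cons a s ih => simp [Finset.sum_add_distrib, ih]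

theorem integral_multiset_sum {Ω : Type*} [MeasurableSpace Ω] {ν : Measure Ω} {f : ℕ → Ω → ℝ}
    {s : Multiset ℕ} (hf : ∀ l, Integrable (f l) ν) :
    Integrable (fun x => (s.map fun l => f l x).sum) ν ∧
    ∫ x, (s.map fun l => f l x).sum ∂ν = (s.map fun l => ∫ x, f l x ∂ν).sum := by
  induction s using Multiset.induction_on with
  | empty => simp
  | cons a s ih =>
    simp only [Multiset.map_cons, Multiset.sum_cons]
    exact ⟨(hf a).add ih.1, by rw [integral_add (hf a) ih.1, ih.2]⟩

/-- The defect of the loop equation for functions `P k` at a point. -/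
noncomputable def loopDefect (β : ℕ) (P : ℕ → ℝ) (k : ℕ) (s : Multiset ℕ) : ℝ :=
  P (k + 1) * (s.map P).prod
    - ((β : ℝ) / 2 * ∑ a ∈ Finset.range k, P a * P (k - 1 - a) * (s.map P).prod
      + (1 - (β : ℝ) / 2) * k * (P (k - 1) * (s.map P).prod)
      + (s.map fun l : ℕ => (l : ℝ) * (P (l - 1 + k) * ((s.erase l).map P).prod)).sum)

theorem loopEquations_of_integral {β n : ℕ} {P : ℕ → E → ℝ} {ω : E → ℝ}
    (hint : ∀ s : Multiset ℕ, Integrable (fun x => (s.map fun k => P k x).prod * ω x) μ)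
    (h0 : ∀ x, P 0 x = n)
    (hdef : ∀ k s, ∫ x, loopDefect β (fun k => P k x) k s * ω x ∂μ = 0) :
    LoopEquations β n (fun s => ∫ x, (s.map fun k => P k x).prod * ω x ∂μ) where
  zero_cons s := by
    simp only [Multiset.map_cons, Multiset.prod_cons, h0, mul_assoc]
    rw [integral_const_mul]
  succ_cons k s := by
    have h1 := hdef k s
    have e : ∀ x, loopDefect β (fun k => P k x) k s * ω x
        = (((k + 1) ::ₘ s).map fun k => P k x).prod * ω x
          - ((β : ℝ) / 2 * ∑ a ∈ Finset.range k,
              ((a ::ₘ (k - 1 - a) ::ₘ s).map fun k => P k x).prod * ω x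
            + (1 - (β : ℝ) / 2) * k * ((((k - 1) ::ₘ s).map fun k => P k x).prod * ω x)
            + (s.map fun l : ℕ => (l : ℝ) *
              ((((l - 1 + k) ::ₘ s.erase l).map fun k => P k x).prod * ω x)).sum) := by
      intro x
      simp only [loopDefect, Multiset.map_cons, Multiset.prod_cons, sub_mul, add_mul, ← mul_assoc,
        Finset.sum_mul, Finset.mul_sum, Multiset.sum_map_mul_right]
    simp only [e] at h1
    have i1 := integral_multiset_sum (ν := μ) (s := s)
      (f := fun (l : ℕ) x => (l : ℝ) * ((((l - 1 + k) ::ₘ s.erase l).map fun k => P k x).prod * ω x))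
      (fun l => (hint _).const_mul _)
    have i2 : Integrable (fun x => (β : ℝ) / 2 * ∑ a ∈ Finset.range k,
        ((a ::ₘ (k - 1 - a) ::ₘ s).map fun k => P k x).prod * ω x) μ :=
      (integrable_finsetSum _ fun a _ => hint _).const_mul _
    have i3 : Integrable (fun x => (1 - (β : ℝ) / 2) * k *
        ((((k - 1) ::ₘ s).map fun k => P k x).prod * ω x)) μ := (hint _).const_mul _
    rw [integral_sub (hint _) (by exact (i2.add i3).add i1.1), sub_eq_zero,
      integral_add (by exact i2.add i3) i1.1,
      integral_add i2 i3, i1.2, integral_const_mul, integral_const_mul,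
      integral_finsetSum _ fun a _ => hint _] at h1
    simp only [integral_const_mul] at h1
    exact h1

end Loop

namespace HurwitzFrame

variable {F : Type} [NormedDivisionRing F] [NormedAlgebra ℝ F] [StarRing F] [StarModule ℝ F]
  {β : ℕ} (H : HurwitzFrame F β) {n : ℕ}

theorem hasDerivAt_pow_apply (M B : Matrix (Fin n) (Fin n) F) (k : ℕ) (i j : Fin n) :
    HasDerivAt (fun t : ℝ => ((M + t • B) ^ k) i j)
      ((∑ a ∈ Finset.range k, M ^ a * B * M ^ (k - 1 - a)) i j) 0 := by
  induction k generalizing i j with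
  | zero => simpa using hasDerivAt_const (0 : ℝ) ((1 : Matrix (Fin n) (Fin n) F) i j)
  | succ k ih =>
    have h1 : ∀ l, HasDerivAt (fun t : ℝ => (M + t • B) l j) (B l j) 0 := by
      intro l
      have := ((hasDerivAt_id (0 : ℝ)).smul_const (B l j)).const_add (M l j)
      simpa using this
    have h2 := HasDerivAt.fun_sum (u := Finset.univ) fun l _ => (ih i l).mul (h1 l)
    refine (h2.congr_of_eventuallyEq (Filter.Eventually.of_forall fun t => ?_)).congr_deriv ?_
    · simp [pow_succ, mul_apply]
    · have h3 : ∑ a ∈ Finset.range (k + 1), M ^ a * B * M ^ (k + 1 - 1 - a)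
          = (∑ a ∈ Finset.range k, M ^ a * B * M ^ (k - 1 - a)) * M + M ^ k * B := by
        rw [Finset.sum_range_succ, Finset.sum_mul]
        congr 1
        · refine Finset.sum_congr rfl fun a ha => ?_
          rw [Finset.mem_range] at ha
          have : k + 1 - 1 - a = (k - 1 - a) + 1 := by omega
          rw [this, pow_succ]
          simp only [mul_assoc]
        · simp
      rw [h3, Matrix.add_apply, mul_apply, mul_apply, ← Finset.sum_add_distrib]
      simp

theorem exists_coordFun_coordOf (α : CoordIndex n β) : ∃ (L : F →L[ℝ] ℝ) (i j : Fin n),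
    ∀ X : Matrix (Fin n) (Fin n) F, coordFun α (H.coordOf X) = L (X i j) := by
  have := H.finiteDimensional
  rcases α with i | ⟨p, k⟩
  · exact ⟨LinearMap.toContinuousLinearMap H.re, i, i, fun X => rfl⟩
  · exact ⟨LinearMap.toContinuousLinearMap (LinearMap.proj k ∘ₗ H.coord.toLinearMap), p.1.1, p.1.2,
      fun X => rfl⟩

theorem exists_rtr : ∃ L : F →L[ℝ] ℝ, ∀ X : Matrix (Fin n) (Fin n) F, H.rtr X = ∑ i, L (X i i) := by
  have := H.finiteDimensional
  exact ⟨LinearMap.toContinuousLinearMap H.re, fun X => by simp [rtr, trace]⟩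

theorem continuous_herm_pow_apply (k : ℕ) (i j : Fin n) :
    Continuous fun c : HermCoord n β => (H.herm c ^ k) i j :=
  (H.continuous_herm.pow k).matrix_elem i j

theorem polyGrowth_herm_pow_apply (k : ℕ) (i j : Fin n) :
    PolyGrowth fun c : HermCoord n β => (H.herm c ^ k) i j := by
  induction k generalizing i j with
  | zero => simpa using PolyGrowth.const _
  | succ k ih =>
    simp only [pow_succ, mul_apply]
    refine PolyGrowth.sum _ fun l _ => (ih i l).mul ?_
    have := H.finiteDimensional
    let L : HermCoord n β →ₗ[ℝ] F :=
      { toFun := fun c => H.herm c l j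
        map_add' := fun c d => by rw [H.herm_add]; rfl
        map_smul' := fun r c => by rw [H.herm_smul]; rfl }
    exact PolyGrowth.clm (LinearMap.toContinuousLinearMap L)

theorem continuous_rtr_herm_pow (k : ℕ) :
    Continuous fun c : HermCoord n β => H.rtr (H.herm c ^ k) :=
  H.continuous_rtr.comp (H.continuous_herm.pow k)

theorem polyGrowth_rtr_herm_pow (k : ℕ) :
    PolyGrowth fun c : HermCoord n β => H.rtr (H.herm c ^ k) := by
  obtain ⟨L, hL⟩ := H.exists_rtr (n := n)
  simp only [hL]
  exact PolyGrowth.sum _ fun i _ => (H.polyGrowth_herm_pow_apply k i i).clm_comp L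

theorem hasDerivAt_coordOf_pow (c d : HermCoord n β) (α : CoordIndex n β) (k : ℕ) :
    HasDerivAt (fun t : ℝ => coordFun α (H.coordOf (H.herm (c + t • d) ^ k)))
      (∑ a ∈ Finset.range k, coordFun α
        (H.coordOf (H.herm c ^ a * H.herm d * H.herm c ^ (k - 1 - a)))) 0 := by
  obtain ⟨L, i, j, hL⟩ := H.exists_coordFun_coordOf α
  simp only [hL, H.herm_add, H.herm_smul]
  have h1 := L.hasFDerivAt.comp_hasDerivAt (0 : ℝ)
    (hasDerivAt_pow_apply (H.herm c) (H.herm d) k i j)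
  rwa [Matrix.sum_apply, map_sum] at h1

/-- Cyclicity of `re ∘ trace` makes the `k` terms of the noncommutative Leibniz rule equal. -/
theorem hasDerivAt_rtr_pow (c d : HermCoord n β) (k : ℕ) :
    HasDerivAt (fun t : ℝ => H.rtr (H.herm (c + t • d) ^ k))
      (k * H.rtr (H.herm c ^ (k - 1) * H.herm d)) 0 := by
  obtain ⟨L, hL⟩ := H.exists_rtr (n := n)
  have h1 := HasDerivAt.fun_sum (u := Finset.univ) fun i _ => L.hasFDerivAt.comp_hasDerivAt (0 : ℝ)
    (hasDerivAt_pow_apply (H.herm c) (H.herm d) k i i)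
  rw [← hL] at h1
  refine (h1.congr_of_eventuallyEq (Filter.Eventually.of_forall fun t => ?_)).congr_deriv ?_
  · simp only [hL, H.herm_add, H.herm_smul]
    rfl
  · have h2 : ∀ s : Finset ℕ, ∀ f : ℕ → Matrix (Fin n) (Fin n) F,
        H.rtr (∑ a ∈ s, f a) = ∑ a ∈ s, H.rtr (f a) := fun s f => by simp [rtr, trace_sum]
    rw [h2, Finset.sum_congr rfl (g := fun _ => H.rtr (H.herm c ^ (k - 1) * H.herm d))]
    · simp
    · intro a ha
      rw [Finset.mem_range] at ha
      rw [H.rtr_mul_comm, ← mul_assoc, ← pow_add]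
      congr 3
      omega

instance {β n : ℕ} : (volume : Measure (HermCoord n β)).IsAddHaarMeasure :=
  have : (volume : Measure (Fin n → ℝ)).IsAddHaarMeasure := inferInstance
  have : (volume : Measure (OffDiag n → Fin β → ℝ)).IsAddHaarMeasure :=
    Measure.pi.isAddHaarMeasure fun _ : OffDiag n => (volume : Measure (Fin β → ℝ))
  Measure.prod.instIsAddHaarMeasure _ _

/-- The loop equations of the Gaussian matrix ensembles. -/
theorem loopEquations_herm : LoopEquations β n fun s => ∫ c : HermCoord n β,
    (s.map fun k => H.rtr (H.herm c ^ k)).prod * Real.exp (-(1 / 2) * coordQuad c) := by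
  have hcF : ∀ s : Multiset ℕ,
      Continuous fun c : HermCoord n β => (s.map fun k => H.rtr (H.herm c ^ k)).prod := fun s =>
    continuous_multiset_prod s fun k _ => H.continuous_rtr_herm_pow k
  have hgF : ∀ s : Multiset ℕ,
      PolyGrowth fun c : HermCoord n β => (s.map fun k => H.rtr (H.herm c ^ k)).prod := fun s =>
    PolyGrowth.multiset_prod s fun k => H.polyGrowth_rtr_herm_pow k
  refine loopEquations_of_integral (μ := volume)
    (P := fun k (c : HermCoord n β) => H.rtr (H.herm c ^ k)) (fun s => ?_)
    (fun c => by rw [pow_zero, H.rtr_one]) fun k s => ?_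
  · exact (hgF s).integrable_mul_exp (hcF s).aestronglyMeasurable norm_sq_le_coordQuad
      continuous_coordQuad (by norm_num)
  have hcoordc : ∀ (α : CoordIndex n β) (a b : ℕ) (d : HermCoord n β), Continuous fun c =>
      coordFun α (H.coordOf (H.herm c ^ a * H.herm d * H.herm c ^ b)) := by
    intro α a b d
    obtain ⟨L, i, j, hL⟩ := H.exists_coordFun_coordOf α
    simp only [hL, mul_apply, Finset.sum_mul]
    refine L.continuous.comp (continuous_finsetSum _ fun x _ => continuous_finsetSum _ fun y _ => ?_)
    exact ((H.continuous_herm_pow_apply a i y).mul continuous_const).mul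
      (H.continuous_herm_pow_apply b x j)
  have hcoordg : ∀ (α : CoordIndex n β) (a b : ℕ) (d : HermCoord n β), PolyGrowth fun c =>
      coordFun α (H.coordOf (H.herm c ^ a * H.herm d * H.herm c ^ b)) := by
    intro α a b d
    obtain ⟨L, i, j, hL⟩ := H.exists_coordFun_coordOf α
    simp only [hL, mul_apply, Finset.sum_mul]
    refine PolyGrowth.clm_comp L (PolyGrowth.sum _ fun x _ => PolyGrowth.sum _ fun y _ => ?_)
    exact ((H.polyGrowth_herm_pow_apply a i y).mul (PolyGrowth.const _)).mul
      (H.polyGrowth_herm_pow_apply b x j)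
  have hcp : ∀ (α : CoordIndex n β), Continuous fun c =>
      coordFun α (H.coordOf (H.herm c ^ k)) := by
    intro α
    obtain ⟨L, i, j, hL⟩ := H.exists_coordFun_coordOf α
    simp only [hL]
    exact L.continuous.comp (H.continuous_herm_pow_apply k i j)
  have hgp : ∀ (α : CoordIndex n β), PolyGrowth fun c =>
      coordFun α (H.coordOf (H.herm c ^ k)) := by
    intro α
    obtain ⟨L, i, j, hL⟩ := H.exists_coordFun_coordOf α
    simp only [hL]
    exact PolyGrowth.clm_comp L (H.polyGrowth_herm_pow_apply k i j)
  have hcr : ∀ (l : ℕ) (d : HermCoord n β), Continuous fun c =>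
      H.rtr (H.herm c ^ l * H.herm d) := fun l d =>
    H.continuous_rtr.comp ((H.continuous_herm.pow l).matrix_mul continuous_const)
  have hgr : ∀ (l : ℕ) (d : HermCoord n β), PolyGrowth fun c =>
      H.rtr (H.herm c ^ l * H.herm d) := by
    intro l d
    obtain ⟨L, hL⟩ := H.exists_rtr (n := n)
    simp only [hL, mul_apply]
    exact PolyGrowth.sum _ fun i _ => PolyGrowth.clm_comp L (PolyGrowth.sum _ fun j _ =>
      (H.polyGrowth_herm_pow_apply l i j).mul (PolyGrowth.const _))
  have hsumc : ∀ d : HermCoord n β, Continuous fun c => (s.map fun l : ℕ =>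
      (l * H.rtr (H.herm c ^ (l - 1) * H.herm d)) *
        ((s.erase l).map fun l => H.rtr (H.herm c ^ l)).prod).sum := fun d =>
    continuous_multiset_sum s fun l _ => (continuous_const.mul (hcr _ d)).mul (hcF _)
  have hsumg : ∀ (t : Multiset ℕ) (d : HermCoord n β), PolyGrowth fun c => (t.map fun l : ℕ =>
      (l * H.rtr (H.herm c ^ (l - 1) * H.herm d)) *
        ((s.erase l).map fun l => H.rtr (H.herm c ^ l)).prod).sum := by
    intro t d
    induction t using Multiset.induction_on with
    | empty => simpa using PolyGrowth.const (E := HermCoord n β) (0 : ℝ)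
    | cons a t ih =>
      simp only [Multiset.map_cons, Multiset.sum_cons]
      exact (((PolyGrowth.const _).mul (hgr _ d)).mul (hgF _)).add ih
  -- Divergence theorem for the field `M ^ k ∏ tr M ^ l`. Pairing it with the gradient of the
  -- Gaussian exponent gives `tr M ^ (k+1)` (`e1`), the divergence of `M ^ k` gives the casimirs
  -- (`e2`), and the derivative of the product gives the terms in which `l` is replaced by `l - 1 +
  -- k` (`e3`).
  have key := integral_sum_mul_sub_lineDeriv (μ := (volume : Measure (HermCoord n β)))
    (Q := coordQuad) (q := fun α c => coordWeight α * coordFun α c) (v := coordUnit)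
    (g := fun α c => coordFun α (H.coordOf (H.herm c ^ k)) *
      (s.map fun k => H.rtr (H.herm c ^ k)).prod)
    (g' := fun α c => (∑ a ∈ Finset.range k, coordFun α
        (H.coordOf (H.herm c ^ a * H.herm (coordUnit α) * H.herm c ^ (k - 1 - a)))) *
        (s.map fun k => H.rtr (H.herm c ^ k)).prod
      + coordFun α (H.coordOf (H.herm c ^ k)) * (s.map fun l : ℕ =>
        (l * H.rtr (H.herm c ^ (l - 1) * H.herm (coordUnit α))) *
          ((s.erase l).map fun l => H.rtr (H.herm c ^ l)).prod).sum)
    norm_sq_le_coordQuad continuous_coordQuad (fun α x => hasLineDerivAt_coordQuad x α)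
    (fun α => (PolyGrowth.const _).mul (PolyGrowth.clm (coordFun α))) (fun α => by fun_prop)
    (fun α c => ?_) (fun α => (hgp α).mul (hgF s))
    (fun α => ((PolyGrowth.sum _ fun a _ => hcoordg α _ _ _).mul (hgF s)).add
      ((hgp α).mul (hsumg s _)))
    (fun α => (hcp α).mul (hcF s))
    (fun α => ((continuous_finsetSum _ fun a _ => hcoordc α _ _ _).mul (hcF s)).add
      ((hcp α).mul (hsumc _)))
  · rw [← key]
    congr 1
    ext c
    congr 1
    have hM := H.isHermitian_herm c
    have e1 : ∑ α, coordFun α (H.coordOf (H.herm c ^ k)) *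
        (s.map fun k => H.rtr (H.herm c ^ k)).prod * (coordWeight α * coordFun α c)
        = H.rtr (H.herm c ^ (k + 1)) * (s.map fun k => H.rtr (H.herm c ^ k)).prod := by
      rw [pow_succ, ← H.sum_coordWeight (hM.pow k) hM, H.coordOf_herm, Finset.sum_mul]
      exact Finset.sum_congr rfl fun α _ => by ring
    have e2 : ∑ α, (∑ a ∈ Finset.range k, coordFun α
        (H.coordOf (H.herm c ^ a * H.herm (coordUnit α) * H.herm c ^ (k - 1 - a)))) *
        (s.map fun k => H.rtr (H.herm c ^ k)).prod
        = (∑ a ∈ Finset.range k, H.casimir (H.herm c ^ a) (H.herm c ^ (k - 1 - a))) *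
        (s.map fun k => H.rtr (H.herm c ^ k)).prod := by
      rw [← Finset.sum_mul, Finset.sum_comm]
      rfl
    have e3 : ∑ α, coordFun α (H.coordOf (H.herm c ^ k)) * (s.map fun l : ℕ =>
        (l * H.rtr (H.herm c ^ (l - 1) * H.herm (coordUnit α))) *
          ((s.erase l).map fun l => H.rtr (H.herm c ^ l)).prod).sum
        = (s.map fun l : ℕ => l * (H.rtr (H.herm c ^ (l - 1 + k)) *
          ((s.erase l).map fun l => H.rtr (H.herm c ^ l)).prod)).sum := by
      simp only [← Multiset.sum_map_mul_left]
      rw [sum_multiset_sum_map]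
      refine congrArg _ (Multiset.map_congr rfl fun l _ => ?_)
      rw [pow_add, ← H.sum_coordFun_mul_rtr (hM.pow k), Finset.sum_mul, Finset.mul_sum]
      exact Finset.sum_congr rfl fun α _ => by ring
    rw [Finset.sum_add_distrib, e1, e2, e3, H.sum_casimir_pow hM, loopDefect, add_mul]
    simp only [Finset.sum_mul, Finset.mul_sum, mul_assoc]
  · exact (H.hasDerivAt_coordOf_pow c (coordUnit α) α k).mul
      (hasDerivAt_multiset_prod (fun l => H.hasDerivAt_rtr_pow c (coordUnit α) l) s) |>.congr_deriv
        (by simp)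

end HurwitzFrame

end ExternalSource

/-! ### Loop equations of the Gaussian ensembles with Vandermonde weight. -/

namespace ExternalSource

open MeasureTheory Matrix Module Filter Topology

/-- The Vandermonde product. -/
noncomputable def vandermondeProd {n : ℕ} (x : Fin n → ℝ) : ℝ :=
  ∏ p : OffDiag n, (x p.1.2 - x p.1.1)

theorem vandermondeProd_eq {n : ℕ} (x : Fin n → ℝ) :
    vandermondeProd x = ∏ i, ∏ j ∈ Finset.Ioi i, (x j - x i) := by
  rw [Finset.prod_sigma', vandermondeProd]
  refine Finset.prod_bij (fun p _ => ⟨p.1.1, p.1.2⟩) (fun p _ => by simpa using p.2) ?_ ?_ ?_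
  · rintro ⟨⟨a, b⟩, h⟩ - ⟨⟨c, d⟩, h'⟩ - e
    simp at e
    simp [e]
  · rintro ⟨i, j⟩ h
    exact ⟨⟨(i, j), by simpa using h⟩, Finset.mem_univ _, rfl⟩
  · intros; rfl

@[fun_prop]
theorem continuous_vandermondeProd {n : ℕ} :
    Continuous (vandermondeProd : (Fin n → ℝ) → ℝ) := by
  unfold vandermondeProd
  fun_prop

theorem polyGrowth_apply {n : ℕ} (i : Fin n) : PolyGrowth fun x : Fin n → ℝ => x i :=
  PolyGrowth.clm (ContinuousLinearMap.proj (R := ℝ) (φ := fun _ : Fin n => ℝ) i)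

theorem polyGrowth_vandermondeProd {n : ℕ} :
    PolyGrowth (vandermondeProd : (Fin n → ℝ) → ℝ) :=
  PolyGrowth.prod _ fun p _ => PolyGrowth.clm
    (ContinuousLinearMap.proj (R := ℝ) (φ := fun _ : Fin n => ℝ) p.1.2 -
      ContinuousLinearMap.proj (R := ℝ) (φ := fun _ : Fin n => ℝ) p.1.1)

/-- The derivative of the Vandermonde product at `x` in direction `v`. -/
noncomputable def vandermondeDeriv {n : ℕ} (x v : Fin n → ℝ) : ℝ :=
  ∑ p : OffDiag n, (∏ q ∈ Finset.univ.erase p, (x q.1.2 - x q.1.1)) * (v p.1.2 - v p.1.1)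

theorem hasDerivAt_vandermondeProd {n : ℕ} (x v : Fin n → ℝ) :
    HasDerivAt (fun t : ℝ => vandermondeProd (x + t • v)) (vandermondeDeriv x v) 0 := by
  have h1 : ∀ i, HasDerivAt (fun t : ℝ => (x + t • v) i) (v i) 0 := fun i => by
    simpa using ((hasDerivAt_id (0 : ℝ)).smul_const (v i)).const_add (x i)
  have h2 := HasDerivAt.fun_finsetProd (u := Finset.univ)
    fun (p : OffDiag n) _ => (h1 p.1.2).sub (h1 p.1.1)
  refine h2.congr_deriv ?_
  simp [vandermondeDeriv]

theorem continuous_vandermondeDeriv {n : ℕ} (v : Fin n → ℝ) :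
    Continuous fun x => vandermondeDeriv x v := by
  unfold vandermondeDeriv
  fun_prop

theorem polyGrowth_vandermondeDeriv {n : ℕ} (v : Fin n → ℝ) :
    PolyGrowth fun x => vandermondeDeriv x v :=
  PolyGrowth.sum _ fun p _ => (PolyGrowth.prod _ fun q _ => PolyGrowth.clm
    (ContinuousLinearMap.proj (R := ℝ) (φ := fun _ : Fin n => ℝ) q.1.2 -
      ContinuousLinearMap.proj (R := ℝ) (φ := fun _ : Fin n => ℝ) q.1.1)).mul (PolyGrowth.const _)

/-- The logarithmic derivative of `Δ` along `x_i ^ k` is the sum over pairs of `(x_j^k - x_i^k)/(x_j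
- x_i)`, which is a geometric sum. Twice it, summed over pairs, is the product of power sums minus
its diagonal part. -/
theorem sum_pow_mul_vandermondeDeriv {n : ℕ} (x : Fin n → ℝ) (k : ℕ) :
    2 * ∑ i, x i ^ k * vandermondeDeriv x (Pi.single i 1)
      = vandermondeProd x * (∑ a ∈ Finset.range k, (∑ i, x i ^ a) * (∑ i, x i ^ (k - 1 - a))
        - k * ∑ i, x i ^ (k - 1)) := by
  have h1 : ∑ i, x i ^ k * vandermondeDeriv x (Pi.single i 1)
      = vandermondeProd x * ∑ p : OffDiag n, ∑ a ∈ Finset.range k,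
        x p.1.2 ^ a * x p.1.1 ^ (k - 1 - a) := by
    simp only [vandermondeDeriv, Finset.mul_sum]
    rw [Finset.sum_comm]
    refine Finset.sum_congr rfl fun p _ => ?_
    have h2 : ∑ i, x i ^ k * ((∏ q ∈ Finset.univ.erase p, (x q.1.2 - x q.1.1)) *
        ((Pi.single i 1 : Fin n → ℝ) p.1.2 - (Pi.single i 1 : Fin n → ℝ) p.1.1))
        = (∏ q ∈ Finset.univ.erase p, (x q.1.2 - x q.1.1)) * (x p.1.2 ^ k - x p.1.1 ^ k) := by
      simp only [mul_sub, Finset.sum_sub_distrib, Pi.single_apply, mul_ite, mul_one, mul_zero,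
        Finset.sum_ite_eq, Finset.mem_univ, if_true]
      ring
    rw [h2, ← Finset.mul_sum, ← geom_sum₂_mul, vandermondeProd,
      ← Finset.mul_prod_erase Finset.univ _ (Finset.mem_univ p)]
    ring
  have h3 : ∑ a ∈ Finset.range k, (∑ i, x i ^ a) * (∑ i, x i ^ (k - 1 - a))
      = k * ∑ i, x i ^ (k - 1)
        + 2 * ∑ p : OffDiag n, ∑ a ∈ Finset.range k, x p.1.2 ^ a * x p.1.1 ^ (k - 1 - a) := by
    have h4 : ∀ a ∈ Finset.range k, (∑ i, x i ^ a) * (∑ i, x i ^ (k - 1 - a))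
        = ∑ i, x i ^ (k - 1) + ∑ p : OffDiag n, (x p.1.1 ^ a * x p.1.2 ^ (k - 1 - a)
          + x p.1.2 ^ a * x p.1.1 ^ (k - 1 - a)) := by
      intro a ha
      rw [Finset.mem_range] at ha
      rw [Finset.sum_mul_sum, sum_sum_eq_diag_add_offDiag]
      congr 1
      refine Finset.sum_congr rfl fun i _ => ?_
      rw [← pow_add]
      congr 1
      omega
    rw [Finset.sum_congr rfl h4, Finset.sum_add_distrib, Finset.sum_const, Finset.card_range,
      nsmul_eq_mul, Finset.sum_comm, two_mul, ← Finset.sum_add_distrib]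
    congr 1
    refine Finset.sum_congr rfl fun p _ => ?_
    rw [Finset.sum_add_distrib]
    congr 1
    rw [← Finset.sum_range_reflect]
    refine Finset.sum_congr rfl fun a ha => ?_
    rw [Finset.mem_range] at ha
    have : k - 1 - (k - 1 - a) = a := by omega
    rw [this, mul_comm]
  rw [h1, h3]
  ring

theorem norm_sq_le_sum_sq {n : ℕ} (x : Fin n → ℝ) : ‖x‖ ^ 2 ≤ ∑ i, x i ^ 2 := by
  rw [← Real.sqrt_le_sqrt_iff (by positivity), Real.sqrt_sq (norm_nonneg _)]
  refine (pi_norm_le_iff_of_nonneg (Real.sqrt_nonneg _)).2 fun i => ?_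
  refine Real.le_sqrt_of_sq_le ?_
  rw [Real.norm_eq_abs, sq_abs]
  exact Finset.single_le_sum (f := fun i => x i ^ 2) (fun i _ => sq_nonneg _) (Finset.mem_univ i)

theorem polyGrowth_psum {n : ℕ} (k : ℕ) : PolyGrowth fun x : Fin n → ℝ => ∑ i, x i ^ k :=
  PolyGrowth.sum _ fun i _ => (polyGrowth_apply i).pow k

theorem rpow_le_one_add_pow {y r : ℝ} (hy : 0 ≤ y) (hr : 0 ≤ r) {N : ℕ} (hN : r ≤ N) :
    y ^ r ≤ 1 + y ^ N := by
  rcases le_total y 1 with h | h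
  · have := Real.rpow_le_one hy h hr
    have h2 : 0 ≤ y ^ N := by positivity
    linarith
  · have := Real.rpow_le_rpow_of_exponent_le h hN
    rw [Real.rpow_natCast] at this
    linarith

theorem PolyGrowth.rpow {E : Type*} [NormedAddCommGroup E] {f : E → ℝ} (hf : PolyGrowth f)
    (h0 : ∀ x, 0 ≤ f x) {r : ℝ} (hr : 0 ≤ r) : PolyGrowth fun x => f x ^ r := by
  obtain ⟨N, hN⟩ := exists_nat_ge r
  refine ((PolyGrowth.const (1 : ℝ)).add (hf.pow N)).mono fun x => ?_
  rw [Real.norm_of_nonneg (Real.rpow_nonneg (h0 x) r)]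
  exact (rpow_le_one_add_pow (h0 x) hr hN).trans (le_abs_self _)

section Regularized

variable {n : ℕ} {r : ℝ}

/-- `|Δ|^β` need not be differentiable where `Δ` vanishes (for instance when `β = 1`). Integration
by parts is therefore done with `(Δ² + ε)^{β/2}`, and `ε` tends to zero afterwards. -/
theorem continuous_regularized {ε : ℝ} (hε : 0 < ε) :
    Continuous fun x : Fin n → ℝ => (vandermondeProd x ^ 2 + ε) ^ r := by
  refine Continuous.rpow_const (by fun_prop) fun x => Or.inl ?_
  positivity

theorem polyGrowth_regularized {ε : ℝ} (hε : 0 < ε) (hr : 0 ≤ r) :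
    PolyGrowth fun x : Fin n → ℝ => (vandermondeProd x ^ 2 + ε) ^ r :=
  PolyGrowth.rpow ((polyGrowth_vandermondeProd.pow 2).add (PolyGrowth.const ε))
    (fun x => by positivity) hr

/-- The exponent `r - 1` may be negative; the lower bound `Δ² + ε ≥ ε` trades the missing power for
the constant `ε⁻¹`. -/
theorem polyGrowth_regularized_sub_one {ε : ℝ} (hε : 0 < ε) (hr : 0 ≤ r) :
    PolyGrowth fun x : Fin n → ℝ => (vandermondeProd x ^ 2 + ε) ^ (r - 1) := by
  refine ((PolyGrowth.const (ε⁻¹)).mul (polyGrowth_regularized hε hr)).mono fun x => ?_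
  have h0 : 0 < vandermondeProd x ^ 2 + ε := by positivity
  rw [Real.norm_of_nonneg (by positivity), Real.norm_of_nonneg (by positivity),
    Real.rpow_sub_one h0.ne', div_eq_inv_mul]
  gcongr
  exact le_add_of_nonneg_left (sq_nonneg _)

theorem hasDerivAt_regularized {ε : ℝ} (hε : 0 < ε) (x v : Fin n → ℝ) :
    HasDerivAt (fun t : ℝ => (vandermondeProd (x + t • v) ^ 2 + ε) ^ r)
      (2 * r * vandermondeProd x * vandermondeDeriv x v *
        (vandermondeProd x ^ 2 + ε) ^ (r - 1)) 0 := by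
  have h := (((hasDerivAt_vandermondeProd x v).fun_pow 2).add_const ε).rpow_const (p := r)
    (Or.inl (by positivity))
  refine h.congr_deriv ?_
  simp only [zero_smul, add_zero, Nat.add_one_sub_one, pow_one]
  push_cast
  ring

end Regularized

theorem abs_rpow_two_mul (d r : ℝ) : |d| ^ (2 * r) = (d ^ 2) ^ r := by
  rw [Real.rpow_mul (abs_nonneg d), Real.rpow_two, sq_abs]

theorem tendsto_regularized {d r : ℝ} (hr : 0 ≤ r) :
    Tendsto (fun m : ℕ => (d ^ 2 + 1 / ((m : ℝ) + 1)) ^ r) atTop (𝓝 (|d| ^ (2 * r))) := by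
  have h := (((tendsto_one_div_add_atTop_nhds_zero_nat (𝕜 := ℝ)).const_add (d ^ 2))).rpow_const
    (p := r) (Or.inr hr)
  rwa [add_zero, ← abs_rpow_two_mul] at h

/-- The factor `d ^ 2` removes the singularity that a negative exponent would cause at `d = 0`. -/
theorem tendsto_regularized_sub_one {d r : ℝ} (hr : 0 < r) :
    Tendsto (fun m : ℕ => d ^ 2 * (d ^ 2 + 1 / ((m : ℝ) + 1)) ^ (r - 1)) atTop
      (𝓝 (|d| ^ (2 * r))) := by
  rcases eq_or_ne d 0 with rfl | hd
  · simp [Real.zero_rpow (mul_pos two_pos hr).ne']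
  · have hd2 : 0 < d ^ 2 := by positivity
    have h := ((((tendsto_one_div_add_atTop_nhds_zero_nat (𝕜 := ℝ)).const_add (d ^ 2))).rpow_const
      (p := r - 1) (Or.inl (by positivity))).const_mul (d ^ 2)
    rwa [add_zero, Real.rpow_sub_one hd2.ne', mul_div_cancel₀ _ hd2.ne', ← abs_rpow_two_mul] at h

/-- The loop equations of the Gaussian `β`-ensembles. -/
theorem loopEquations_vandermonde {β n : ℕ} (hβ : 0 < β) : LoopEquations β n fun s =>
    ∫ x : Fin n → ℝ, (s.map fun k => ∑ i, x i ^ k).prod *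
      (|vandermondeProd x| ^ β * Real.exp (-(1 / 2) * ∑ i, x i ^ 2)) := by
  have hcF : ∀ s : Multiset ℕ,
      Continuous fun x : Fin n → ℝ => (s.map fun k => ∑ i, x i ^ k).prod := fun s =>
    continuous_multiset_prod s fun k _ => by fun_prop
  have hgF : ∀ s : Multiset ℕ,
      PolyGrowth fun x : Fin n → ℝ => (s.map fun k => ∑ i, x i ^ k).prod := fun s =>
    PolyGrowth.multiset_prod s fun k => polyGrowth_psum k
  have hQc : Continuous fun x : Fin n → ℝ => ∑ i, x i ^ 2 := by fun_prop
  have hr : 0 < (β : ℝ) / 2 := by positivity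
  refine loopEquations_of_integral (μ := volume)
    (P := fun k (x : Fin n → ℝ) => ∑ i, x i ^ k) (fun s => ?_) (fun c => by simp) fun k s => ?_
  · have h1 : PolyGrowth fun x : Fin n → ℝ => |vandermondeProd x| ^ β :=
      polyGrowth_vandermondeProd.norm.pow β
    have h2 := ((hgF s).mul h1).integrable_mul_exp (μ := volume)
      ((hcF s).mul (by fun_prop)).aestronglyMeasurable norm_sq_le_sum_sq hQc
      (a := 1 / 2) (by norm_num)
    simpa only [mul_assoc] using h2
  -- abbreviations
  let F : (Fin n → ℝ) → ℝ := fun x => (s.map fun k => ∑ i, x i ^ k).prod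
  let D : (Fin n → ℝ) → Fin n → ℝ := fun x i => (s.map fun l : ℕ => (l * x i ^ (l - 1)) *
    ((s.erase l).map fun l => ∑ i, x i ^ l).prod).sum
  let A : (Fin n → ℝ) → ℝ := fun x => (∑ i, x i ^ (k + 1)) * F x - k * (∑ i, x i ^ (k - 1)) * F x
    - (s.map fun l : ℕ => (l : ℝ) * ((∑ i, x i ^ (l - 1 + k)) *
      ((s.erase l).map fun l => ∑ i, x i ^ l).prod)).sum
  let B : (Fin n → ℝ) → ℝ := fun x => (β : ℝ) / 2 * F x *
    (∑ a ∈ Finset.range k, (∑ i, x i ^ a) * (∑ i, x i ^ (k - 1 - a)) - k * ∑ i, x i ^ (k - 1))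
  have hsg : ∀ (t : Multiset ℕ) (G : ℕ → (Fin n → ℝ) → ℝ), (∀ l, PolyGrowth (G l)) →
      PolyGrowth fun x => (t.map fun l : ℕ => G l x).sum := by
    intro t G hG
    induction t using Multiset.induction_on with
    | empty => simpa using PolyGrowth.const (E := Fin n → ℝ) (0 : ℝ)
    | cons a t ih =>
      simp only [Multiset.map_cons, Multiset.sum_cons]
      exact (hG a).add ih
  have hDg : ∀ i, PolyGrowth fun x => D x i := fun i => hsg s _ fun l =>
    ((PolyGrowth.const _).mul ((polyGrowth_apply i).pow _)).mul (hgF _)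
  have hDc : ∀ i, Continuous fun x => D x i := fun i =>
    continuous_multiset_sum s fun l _ => (by fun_prop : Continuous fun x : Fin n → ℝ =>
      (l : ℝ) * x i ^ (l - 1)).mul (hcF _)
  have hAc : Continuous A := by
    refine (((by fun_prop : Continuous _).mul (hcF s)).sub
      ((by fun_prop : Continuous _).mul (hcF s))).sub ?_
    exact continuous_multiset_sum s fun l _ => continuous_const.mul
      ((by fun_prop : Continuous _).mul (hcF _))
  have hneg : ∀ {G : (Fin n → ℝ) → ℝ}, PolyGrowth G → PolyGrowth fun x => -G x := fun h =>
    h.mono fun x => by simp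
  have hAg : PolyGrowth A := by
    simp only [A, sub_eq_add_neg]
    exact (((polyGrowth_psum _).mul (hgF s)).add
      (hneg (((PolyGrowth.const _).mul (polyGrowth_psum _)).mul (hgF s)))).add
      (hneg (hsg s _ fun l => (PolyGrowth.const _).mul ((polyGrowth_psum _).mul (hgF _))))
  have hBc : Continuous B := (continuous_const.mul (hcF s)).mul (by fun_prop)
  have hBg : PolyGrowth B := by
    simp only [B, sub_eq_add_neg]
    exact ((PolyGrowth.const _).mul (hgF s)).mul ((PolyGrowth.sum _ fun a _ =>
      (polyGrowth_psum a).mul (polyGrowth_psum _)).add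
      (hneg ((PolyGrowth.const _).mul (polyGrowth_psum _))))
  -- Divergence theorem for the field `x_i ^ k F (Δ² + ε)^{β/2}`. `B` carries the terms in which the
  -- regularized Vandermonde weight is differentiated, `A` all others.
  have key : ∀ ε : ℝ, 0 < ε → ∫ x : Fin n → ℝ,
      (A x * (vandermondeProd x ^ 2 + ε) ^ ((β : ℝ) / 2)
        - B x * (vandermondeProd x ^ 2 * (vandermondeProd x ^ 2 + ε) ^ ((β : ℝ) / 2 - 1)))
        * Real.exp (-(1 / 2) * ∑ i, x i ^ 2) = 0 := by
    intro ε hε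
    have hst := integral_sum_mul_sub_lineDeriv (μ := (volume : Measure (Fin n → ℝ)))
      (Q := fun x => ∑ i, x i ^ 2) (q := fun i x => x i) (v := fun i => Pi.single i 1)
      (g := fun i x => x i ^ k * F x * (vandermondeProd x ^ 2 + ε) ^ ((β : ℝ) / 2))
      (g' := fun i x => (k * x i ^ (k - 1) * F x + x i ^ k * D x i) *
        (vandermondeProd x ^ 2 + ε) ^ ((β : ℝ) / 2) + x i ^ k * F x *
        (2 * ((β : ℝ) / 2) * vandermondeProd x * vandermondeDeriv x (Pi.single i 1) *
        (vandermondeProd x ^ 2 + ε) ^ ((β : ℝ) / 2 - 1)))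
      norm_sq_le_sum_sq hQc (fun i x => ?_) (fun i => polyGrowth_apply i) (fun i => by fun_prop)
      (fun i x => ?_)
      (fun i => (((polyGrowth_apply i).pow k).mul (hgF s)).mul (polyGrowth_regularized hε hr.le))
      (fun i => ?_)
      (fun i => ((by fun_prop : Continuous fun x : Fin n → ℝ => x i ^ k).mul (hcF s)).mul
        (continuous_regularized hε))
      (fun i => ?_)
    · rw [← hst]
      congr 1
      ext x
      congr 1
      set h := (vandermondeProd x ^ 2 + ε) ^ ((β : ℝ) / 2)
      set h' := (vandermondeProd x ^ 2 + ε) ^ ((β : ℝ) / 2 - 1)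
      have e1 : ∑ i, x i ^ k * F x * h * x i = (∑ i, x i ^ (k + 1)) * F x * h := by
        rw [Finset.sum_mul, Finset.sum_mul]
        exact Finset.sum_congr rfl fun i _ => by ring
      have e2 : ∑ i, (k * x i ^ (k - 1) * F x + x i ^ k * D x i) * h
          = (k * (∑ i, x i ^ (k - 1)) * F x + (s.map fun l : ℕ => (l : ℝ) *
            ((∑ i, x i ^ (l - 1 + k)) *
              ((s.erase l).map fun l => ∑ i, x i ^ l).prod)).sum) * h := by
        rw [← Finset.sum_mul, Finset.sum_add_distrib]
        congr 2
        · rw [Finset.mul_sum, Finset.sum_mul]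
        · simp only [D, ← Multiset.sum_map_mul_left]
          rw [sum_multiset_sum_map]
          refine congrArg _ (Multiset.map_congr rfl fun l _ => ?_)
          rw [Finset.sum_mul, Finset.mul_sum]
          exact Finset.sum_congr rfl fun i _ => by ring
      have e3 : ∑ i, x i ^ k * F x * (2 * ((β : ℝ) / 2) * vandermondeProd x *
            vandermondeDeriv x (Pi.single i 1) * h')
          = B x * (vandermondeProd x ^ 2 * h') := by
        have := sum_pow_mul_vandermondeDeriv x k
        calc _ = ((β : ℝ) / 2 * F x * vandermondeProd x * h') *
              (2 * ∑ i, x i ^ k * vandermondeDeriv x (Pi.single i 1)) := by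
              simp only [Finset.mul_sum]
              exact Finset.sum_congr rfl fun i _ => by ring
          _ = _ := by rw [this]; simp only [B]; ring
      rw [Finset.sum_add_distrib, e1, e2, e3]
      simp only [A]
      ring
    · have h1 : ∀ j, HasDerivAt (fun t : ℝ => (x + t • (Pi.single i 1 : Fin n → ℝ)) j)
          ((Pi.single i 1 : Fin n → ℝ) j) 0 := fun j => by
        simpa using ((hasDerivAt_id (0 : ℝ)).smul_const
          ((Pi.single i 1 : Fin n → ℝ) j)).const_add (x j)
      refine (HasDerivAt.fun_sum fun j (_ : j ∈ Finset.univ) => (h1 j).fun_pow 2).congr_deriv ?_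
      simp [Pi.single_apply]
    · have h1 : ∀ j, HasDerivAt (fun t : ℝ => (x + t • (Pi.single i 1 : Fin n → ℝ)) j)
          ((Pi.single i 1 : Fin n → ℝ) j) 0 := fun j => by
        simpa using ((hasDerivAt_id (0 : ℝ)).smul_const
          ((Pi.single i 1 : Fin n → ℝ) j)).const_add (x j)
      have h2 : ∀ l : ℕ, HasDerivAt (fun t : ℝ => ∑ j, (x + t • (Pi.single i 1 : Fin n → ℝ)) j ^ l)
          (l * x i ^ (l - 1)) 0 := fun l => by
        refine (HasDerivAt.fun_sum fun j (_ : j ∈ Finset.univ) => (h1 j).fun_pow l).congr_deriv ?_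
        simp [Pi.single_apply]
      have h3 := ((((h1 i).fun_pow k).fun_mul (hasDerivAt_multiset_prod h2 s))).fun_mul
        (hasDerivAt_regularized (r := (β : ℝ) / 2) hε x (Pi.single i 1))
      refine h3.congr_deriv ?_
      simp [F, D]
    · exact (((((PolyGrowth.const _).mul ((polyGrowth_apply i).pow _)).mul (hgF s)).add
        (((polyGrowth_apply i).pow k).mul (hDg i))).mul (polyGrowth_regularized hε hr.le)).add
        ((((polyGrowth_apply i).pow k).mul (hgF s)).mul
          ((((PolyGrowth.const _).mul polyGrowth_vandermondeProd).mul
            (polyGrowth_vandermondeDeriv _)).mul (polyGrowth_regularized_sub_one hε hr.le)))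
    · exact ((((by fun_prop : Continuous fun x : Fin n → ℝ => (k : ℝ) * x i ^ (k - 1)).mul
        (hcF s)).add ((by fun_prop : Continuous fun x : Fin n → ℝ => x i ^ k).mul (hDc i))).mul
        (continuous_regularized hε)).add
        (((by fun_prop : Continuous fun x : Fin n → ℝ => x i ^ k).mul (hcF s)).mul
          (((continuous_const.mul continuous_vandermondeProd).mul
            (continuous_vandermondeDeriv _)).mul (continuous_regularized hε)))
  -- Dominated convergence with `ε = 1/(m + 1) ≤ 1`: both `(Δ² + ε)^{β/2}` and `Δ² (Δ² + ε)^{β/2 -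
  -- 1}` are at most `(Δ² + 1)^{β/2}` and tend to `|Δ|^β`.
  have hlim : Tendsto (fun m : ℕ => ∫ x : Fin n → ℝ,
      (A x * (vandermondeProd x ^ 2 + 1 / ((m : ℝ) + 1)) ^ ((β : ℝ) / 2)
        - B x * (vandermondeProd x ^ 2 *
          (vandermondeProd x ^ 2 + 1 / ((m : ℝ) + 1)) ^ ((β : ℝ) / 2 - 1)))
        * Real.exp (-(1 / 2) * ∑ i, x i ^ 2)) atTop (𝓝 (∫ x : Fin n → ℝ,
      (A x * |vandermondeProd x| ^ (2 * ((β : ℝ) / 2))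
        - B x * |vandermondeProd x| ^ (2 * ((β : ℝ) / 2)))
        * Real.exp (-(1 / 2) * ∑ i, x i ^ 2))) := by
    refine tendsto_integral_of_dominated_convergence (fun x => ((|A x| + |B x|) *
      (vandermondeProd x ^ 2 + 1) ^ ((β : ℝ) / 2)) * Real.exp (-(1 / 2) * ∑ i, x i ^ 2))
      (fun m => ?_) ?_ (fun m => Eventually.of_forall fun x => ?_)
      (Eventually.of_forall fun x => ?_)
    · have hm : (0 : ℝ) < 1 / ((m : ℝ) + 1) := by positivity
      have h1 := continuous_regularized (n := n) (r := (β : ℝ) / 2) hm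
      have h2 := continuous_regularized (n := n) (r := (β : ℝ) / 2 - 1) hm
      exact (((hAc.mul h1).sub (hBc.mul ((continuous_vandermondeProd.pow 2).mul h2))).mul
        (by fun_prop)).aestronglyMeasurable
    · exact ((hAg.norm.add hBg.norm).mul (polyGrowth_regularized one_pos hr.le)).integrable_mul_exp
        (((hAc.abs.add hBc.abs).mul (continuous_regularized one_pos)).aestronglyMeasurable)
        norm_sq_le_sum_sq hQc (by norm_num)
    · have hm : (0 : ℝ) < 1 / ((m : ℝ) + 1) := by positivity
      have hm1 : 1 / ((m : ℝ) + 1) ≤ 1 := by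
        rw [div_le_one (by positivity)]
        linarith [(Nat.cast_nonneg m : (0 : ℝ) ≤ m)]
      have hd : 0 < vandermondeProd x ^ 2 + 1 / ((m : ℝ) + 1) := by positivity
      have h1 : (vandermondeProd x ^ 2 + 1 / ((m : ℝ) + 1)) ^ ((β : ℝ) / 2)
          ≤ (vandermondeProd x ^ 2 + 1) ^ ((β : ℝ) / 2) := by gcongr
      have h2 : vandermondeProd x ^ 2 * (vandermondeProd x ^ 2 + 1 / ((m : ℝ) + 1)) ^
          ((β : ℝ) / 2 - 1) ≤ (vandermondeProd x ^ 2 + 1) ^ ((β : ℝ) / 2) := by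
        refine le_trans ?_ h1
        rw [Real.rpow_sub_one hd.ne', ← mul_div_assoc, div_le_iff₀ hd, mul_comm]
        gcongr
        linarith
      rw [norm_mul, Real.norm_of_nonneg (Real.exp_pos _).le]
      refine mul_le_mul_of_nonneg_right ?_ (Real.exp_pos _).le
      refine (norm_sub_le _ _).trans ?_
      rw [norm_mul, norm_mul, add_mul, Real.norm_eq_abs, Real.norm_eq_abs (B x)]
      rw [Real.norm_of_nonneg (by positivity), Real.norm_of_nonneg (by positivity)]
      gcongr
    · exact (((tendsto_regularized hr.le).const_mul _).sub
        ((tendsto_regularized_sub_one hr).const_mul _)).mul_const _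
  have h0 := tendsto_nhds_unique (hlim.congr fun m => key _ (by positivity)) tendsto_const_nhds
  rw [← h0]
  congr 1
  ext x
  rw [mul_div_cancel₀ _ (two_ne_zero' ℝ), Real.rpow_natCast]
  simp only [loopDefect, A, B, F]
  rw [← Finset.sum_mul]
  ring

end ExternalSource

/-! ### Symmetric polynomials and determinacy of the moment problem. -/

namespace ExternalSource

open MeasureTheory Matrix Module Filter Topology

section Symmetric

open MvPolynomial

/-- Newton's identities, solved for `k e_k`; the division by `k` is possible over the reals. -/
theorem esymm_mem_adjoin_psum (n k : ℕ) :
    esymm (Fin n) ℝ k ∈ Algebra.adjoin ℝ (Set.range (psum (Fin n) ℝ)) := by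
  induction k using Nat.strong_induction_on with
  | _ k ih =>
    rcases Nat.eq_zero_or_pos k with rfl | hk
    · simp
    have h := mul_esymm_eq_sum (Fin n) ℝ k
    have hk' : (k : ℝ) ≠ 0 := by positivity
    have h1 : esymm (Fin n) ℝ k = (k : ℝ)⁻¹ • ((k : MvPolynomial (Fin n) ℝ) * esymm (Fin n) ℝ k) := by
      rw [← nsmul_eq_mul, ← Nat.cast_smul_eq_nsmul ℝ, smul_smul, inv_mul_cancel₀ hk', one_smul]
    rw [h1, h]
    have hneg : ∀ m : ℕ, ((-1 : MvPolynomial (Fin n) ℝ) ^ m) ∈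
        Algebra.adjoin ℝ (Set.range (psum (Fin n) ℝ)) := fun m =>
      Subalgebra.pow_mem _ (Subalgebra.neg_mem _ (Subalgebra.one_mem _)) _
    refine Subalgebra.smul_mem _ (Subalgebra.mul_mem _ (hneg _) (Subalgebra.sum_mem _ ?_)) _
    intro a ha
    rw [Finset.mem_filter] at ha
    exact Subalgebra.mul_mem _ (Subalgebra.mul_mem _ (hneg _) (ih _ ha.2))
      (Algebra.subset_adjoin ⟨_, rfl⟩)

/-- Symmetric polynomials are polynomials in the power sums. -/
theorem exists_aeval_psum {n : ℕ} {P : MvPolynomial (Fin n) ℝ} (hP : P.IsSymmetric) :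
    ∃ q : MvPolynomial ℕ ℝ, aeval (psum (Fin n) ℝ) q = P := by
  obtain ⟨r, hr⟩ := esymmAlgHom_surjective (σ := Fin n) (n := n) ℝ (by simp) ⟨P, hP⟩
  have h1 : aeval (fun i : Fin n => esymm (Fin n) ℝ (i + 1)) r = P := by
    rw [← esymmAlgHom_apply, hr]
  have h2 : P ∈ Algebra.adjoin ℝ (Set.range (psum (Fin n) ℝ)) := by
    rw [← h1]
    have h3 : aeval (fun i : Fin n => esymm (Fin n) ℝ (i + 1)) r ∈
        Algebra.adjoin ℝ (Set.range fun i : Fin n => esymm (Fin n) ℝ (i + 1)) := by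
      rw [Algebra.adjoin_range_eq_range_aeval]
      exact ⟨r, rfl⟩
    refine Algebra.adjoin_le ?_ h3
    rintro _ ⟨i, rfl⟩
    exact esymm_mem_adjoin_psum n _
  rw [Algebra.adjoin_range_eq_range_aeval] at h2
  exact h2

theorem polyGrowth_eval {n : ℕ} (P : MvPolynomial (Fin n) ℝ) : PolyGrowth fun x => eval x P := by
  induction P using MvPolynomial.induction_on with
  | C a => simpa using PolyGrowth.const a
  | add p q hp hq => simpa using hp.add hq
  | mul_X p i hp => simpa using hp.mul (polyGrowth_apply i)

theorem PolyGrowth.integrable_of_exp {E : Type*} [NormedAddCommGroup E] [MeasurableSpace E]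
    {ν : Measure E} {f : E → ℝ} (hf : PolyGrowth f) (hm : AEStronglyMeasurable f ν)
    (hexp : Integrable (fun x => Real.exp ‖x‖) ν) : Integrable f ν := by
  obtain ⟨C, K, hC⟩ := hf
  have hC0 := PolyGrowth.nonneg hC
  refine (hexp.const_mul (C * (K.factorial * Real.exp 1))).mono' hm (Eventually.of_forall fun x => ?_)
  have := Real.pow_div_factorial_le_exp (1 + ‖x‖) (by positivity) K
  rw [div_le_iff₀ (by positivity), Real.exp_add] at this
  refine (hC x).trans ?_
  rw [mul_assoc]
  gcongr
  linarith

theorem integral_eval_eq_of_psum {n : ℕ} {ν₁ ν₂ : Measure (Fin n → ℝ)}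
    (h₁ : Integrable (fun x => Real.exp ‖x‖) ν₁) (h₂ : Integrable (fun x => Real.exp ‖x‖) ν₂)
    (h : ∀ s : Multiset ℕ, ∫ x, (s.map fun k => ∑ i, x i ^ k).prod ∂ν₁
      = ∫ x, (s.map fun k => ∑ i, x i ^ k).prod ∂ν₂)
    {P : MvPolynomial (Fin n) ℝ} (hP : P.IsSymmetric) :
    ∫ x, eval x P ∂ν₁ = ∫ x, eval x P ∂ν₂ := by
  obtain ⟨q, rfl⟩ := exists_aeval_psum hP
  have hint : ∀ {ν : Measure (Fin n → ℝ)}, Integrable (fun x => Real.exp ‖x‖) ν →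
      ∀ (Q : MvPolynomial (Fin n) ℝ) (s : Multiset ℕ),
      Integrable (fun x => eval x Q * (s.map fun k => ∑ i, x i ^ k).prod) ν := by
    intro ν hν Q s
    refine ((polyGrowth_eval Q).mul (PolyGrowth.multiset_prod s polyGrowth_psum)).integrable_of_exp
      ?_ hν
    exact ((MvPolynomial.continuous_eval Q).mul
      (continuous_multiset_prod s fun k _ => by fun_prop)).aestronglyMeasurable
  -- The additional product of power sums makes the induction work: multiplying the polynomial by
  -- its `k`-th variable inserts `k` into `s`.
  suffices H : ∀ s : Multiset ℕ,
      ∫ x, eval x (aeval (psum (Fin n) ℝ) q) * (s.map fun k => ∑ i, x i ^ k).prod ∂ν₁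
      = ∫ x, eval x (aeval (psum (Fin n) ℝ) q) * (s.map fun k => ∑ i, x i ^ k).prod ∂ν₂ by
    simpa using H 0
  clear hP
  induction q using MvPolynomial.induction_on with
  | C a =>
    intro s
    simp only [algHom_C, MvPolynomial.algebraMap_eq, eval_C, integral_const_mul, h s]
  | add p q hp hq =>
    intro s
    simp only [map_add, add_mul]
    rw [integral_add (hint h₁ _ s) (hint h₁ _ s), integral_add (hint h₂ _ s) (hint h₂ _ s), hp, hq]
  | mul_X p k hp =>
    intro s
    have := hp (k ::ₘ s)
    simp only [Multiset.map_cons, Multiset.prod_cons, ← mul_assoc] at this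
    simpa [psum] using this

end Symmetric

section Determinacy

variable {n : ℕ}

theorem norm_comp_perm_le (x : Fin n → ℝ) (σ : Equiv.Perm (Fin n)) : ‖x ∘ σ‖ ≤ ‖x‖ :=
  (pi_norm_le_iff_of_nonneg (norm_nonneg _)).2 fun i => norm_le_pi_norm x (σ i)

theorem measurable_comp_perm (σ : Equiv.Perm (Fin n)) :
    Measurable fun x : Fin n → ℝ => x ∘ σ :=
  measurable_pi_lambda _ fun i => measurable_pi_apply (σ i)

/-- The symmetrization of a measure under permutations of the coordinates. -/
noncomputable def symmetrize (ν : Measure (Fin n → ℝ)) : Measure (Fin n → ℝ) :=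
  ∑ σ : Equiv.Perm (Fin n), ν.map fun x => x ∘ σ

instance (ν : Measure (Fin n → ℝ)) [IsFiniteMeasure ν] : IsFiniteMeasure (symmetrize ν) := by
  unfold symmetrize
  infer_instance

theorem lintegral_symmetrize (ν : Measure (Fin n → ℝ)) {F : (Fin n → ℝ) → ENNReal}
    (hF : Measurable F) (hs : ∀ x (σ : Equiv.Perm (Fin n)), F (x ∘ σ) = F x) :
    ∫⁻ x, F x ∂symmetrize ν = (n.factorial : ENNReal) * ∫⁻ x, F x ∂ν := by
  rw [symmetrize, lintegral_finsetSum_measure]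
  simp_rw [lintegral_map hF (measurable_comp_perm _), hs]
  simp [Finset.card_univ, Fintype.card_perm]

/-- The polynomial `∑_σ L(x ∘ σ) ^ m`. -/
noncomputable def symPow (L : (Fin n → ℝ) →L[ℝ] ℝ) (m : ℕ) : MvPolynomial (Fin n) ℝ :=
  ∑ σ : Equiv.Perm (Fin n),
    MvPolynomial.rename σ ((∑ i, MvPolynomial.C (L (Pi.single i 1)) * MvPolynomial.X i) ^ m)

theorem eval_symPow (L : (Fin n → ℝ) →L[ℝ] ℝ) (m : ℕ) (x : Fin n → ℝ) :
    MvPolynomial.eval x (symPow L m) = ∑ σ : Equiv.Perm (Fin n), L (x ∘ σ) ^ m := by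
  have h : ∀ y : Fin n → ℝ, L y = ∑ i, L (Pi.single i 1) * y i := by
    intro y
    conv_lhs => rw [← Finset.univ_sum_single y, map_sum]
    refine Finset.sum_congr rfl fun i _ => ?_
    have : (Pi.single i (y i) : Fin n → ℝ) = y i • Pi.single i 1 := by
      rw [← Pi.single_smul, smul_eq_mul, mul_one]
    rw [this, map_smul, smul_eq_mul, mul_comm]
  simp only [symPow, map_sum, MvPolynomial.eval_rename, map_pow, map_mul, MvPolynomial.eval_C,
    MvPolynomial.eval_X]
  exact Finset.sum_congr rfl fun σ _ => by rw [h]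

theorem isSymmetric_symPow (L : (Fin n → ℝ) →L[ℝ] ℝ) (m : ℕ) : (symPow L m).IsSymmetric := by
  intro τ
  simp only [symPow]
  rw [map_sum]
  simp only [MvPolynomial.rename_rename]
  exact Fintype.sum_equiv (Equiv.mulLeft τ) _ _ fun σ => rfl

/-- Expand the exponential in powers of `L` and integrate term by term, which the exponential
moments permit. The terms are integrals of symmetric polynomials, so the characteristic function
depends only on symmetric moments. -/
theorem hasSum_charFunDual_symmetrize {ν : Measure (Fin n → ℝ)} [IsFiniteMeasure ν]
    (hexp : ∀ r : ℝ, Integrable (fun x => Real.exp (r * ‖x‖)) ν) (L : (Fin n → ℝ) →L[ℝ] ℝ) :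
    HasSum (fun m : ℕ => Complex.I ^ m / m.factorial *
      ((∫ x, MvPolynomial.eval x (symPow L m) ∂ν : ℝ) : ℂ)) (charFunDual (symmetrize ν) L) := by
  have h1 : charFunDual (symmetrize ν) L
      = ∫ x, ∑ σ : Equiv.Perm (Fin n), Complex.exp (L (x ∘ σ) * Complex.I) ∂ν := by
    have hc : Continuous fun x : Fin n → ℝ => Complex.exp (L x * Complex.I) := by fun_prop
    have hb : ∀ x : Fin n → ℝ, ‖Complex.exp (L x * Complex.I)‖ ≤ 1 := fun x => by
      rw [Complex.norm_exp_ofReal_mul_I]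
    have hi : ∀ μ : Measure (Fin n → ℝ), IsFiniteMeasure μ →
        Integrable (fun x : Fin n → ℝ => Complex.exp (L x * Complex.I)) μ := fun μ _ =>
      Integrable.of_bound hc.aestronglyMeasurable 1 (Eventually.of_forall hb)
    rw [charFunDual_apply, symmetrize, integral_finsetSum_measure fun σ _ => hi _ inferInstance,
      integral_finsetSum]
    · refine Finset.sum_congr rfl fun σ _ => ?_
      rw [integral_map (measurable_comp_perm σ).aemeasurable hc.aestronglyMeasurable]
    · intro σ _
      exact (integrable_map_measure hc.aestronglyMeasurable
        (measurable_comp_perm σ).aemeasurable).1 (hi _ inferInstance)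
  rw [h1]
  have h2 : ∀ (m : ℕ), Complex.I ^ m / m.factorial *
      ((∫ x, MvPolynomial.eval x (symPow L m) ∂ν : ℝ) : ℂ)
      = ∫ x, ∑ σ : Equiv.Perm (Fin n), (L (x ∘ σ) * Complex.I) ^ m / m.factorial ∂ν := by
    intro m
    rw [← integral_complex_ofReal, ← integral_const_mul]
    congr 1
    ext x
    rw [eval_symPow]
    push_cast
    rw [Finset.mul_sum]
    exact Finset.sum_congr rfl fun σ _ => by rw [mul_pow]; ring
  simp only [h2]
  have hperm : ∀ σ : Equiv.Perm (Fin n), Continuous fun x : Fin n → ℝ => x ∘ σ := fun σ =>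
    continuous_pi fun i => continuous_apply _
  refine hasSum_integral_of_dominated_convergence
    (fun m x => n.factorial * ((‖L‖ * ‖x‖) ^ m / m.factorial)) (fun m => ?_)
    (fun m => Eventually.of_forall fun x => ?_) (Eventually.of_forall fun x => ?_) ?_
    (Eventually.of_forall fun x => ?_)
  · refine Continuous.aestronglyMeasurable (continuous_finsetSum _ fun σ _ => ?_)
    have := hperm σ
    fun_prop
  · refine (norm_sum_le _ _).trans ?_
    have h3 : ∀ σ ∈ (Finset.univ : Finset (Equiv.Perm (Fin n))),
        ‖(L (x ∘ σ) * Complex.I) ^ m / (m.factorial : ℂ)‖ ≤ (‖L‖ * ‖x‖) ^ m / m.factorial := by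
      intro σ _
      rw [norm_div, norm_pow, norm_mul, Complex.norm_I, mul_one, Complex.norm_natCast,
        Complex.norm_real]
      gcongr
      exact (L.le_opNorm _).trans (by gcongr; exact norm_comp_perm_le x σ)
    refine (Finset.sum_le_sum h3).trans (le_of_eq ?_)
    simp [Finset.card_univ, Fintype.card_perm]
  · exact (Real.summable_pow_div_factorial _).mul_left _
  · have h4 : ∀ x : Fin n → ℝ, ∑' m : ℕ, (n.factorial : ℝ) * ((‖L‖ * ‖x‖) ^ m / m.factorial)
        = n.factorial * Real.exp (‖L‖ * ‖x‖) := fun x => by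
      rw [tsum_mul_left, Real.exp_eq_exp_ℝ, NormedSpace.exp_eq_tsum_div]
    simp only [h4]
    exact (hexp _).const_mul _
  · refine hasSum_sum fun σ _ => ?_
    rw [Complex.exp_eq_exp_ℂ]
    exact NormedSpace.expSeries_div_hasSum_exp _

/-- A measure with exponential moments is determined, on symmetric functions, by the moments of
the power sums. -/
theorem lintegral_eq_of_psum {ν₁ ν₂ : Measure (Fin n → ℝ)} [IsFiniteMeasure ν₁] [IsFiniteMeasure ν₂]
    (h₁ : ∀ r : ℝ, Integrable (fun x => Real.exp (r * ‖x‖)) ν₁)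
    (h₂ : ∀ r : ℝ, Integrable (fun x => Real.exp (r * ‖x‖)) ν₂)
    (h : ∀ s : Multiset ℕ, ∫ x, (s.map fun k => ∑ i, x i ^ k).prod ∂ν₁
      = ∫ x, (s.map fun k => ∑ i, x i ^ k).prod ∂ν₂)
    {F : (Fin n → ℝ) → ENNReal} (hF : Measurable F)
    (hs : ∀ x (σ : Equiv.Perm (Fin n)), F (x ∘ σ) = F x) :
    ∫⁻ x, F x ∂ν₁ = ∫⁻ x, F x ∂ν₂ := by
  -- Characteristic functions of the symmetrizations have the same series. On symmetric functions a
  -- symmetrization is `n!` times the measure, and this factor cancels.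
  have h3 : symmetrize ν₁ = symmetrize ν₂ := by
    refine Measure.ext_of_charFunDual ?_
    ext L
    refine (hasSum_charFunDual_symmetrize h₁ L).unique ?_
    have h4 := hasSum_charFunDual_symmetrize h₂ L
    simpa only [integral_eval_eq_of_psum (by simpa using h₁ 1) (by simpa using h₂ 1) h
      (isSymmetric_symPow L _)] using h4
  have h5 := lintegral_symmetrize ν₁ hF hs
  rw [h3, lintegral_symmetrize ν₂ hF hs] at h5
  exact ((ENNReal.mul_right_inj (by positivity) (ENNReal.natCast_ne_top _)).1 h5).symm

end Determinacy

end ExternalSource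

/-! ### Weyl's integration formula from the loop equations. -/

namespace ExternalSource

open MeasureTheory Matrix Module Filter Topology

theorem integrable_withDensity_ofReal {X : Type*} [MeasurableSpace X] {μ : Measure X} {w f : X → ℝ}
    (hw : Measurable w) (h0 : ∀ x, 0 ≤ w x) (hf : Integrable (fun x => f x * w x) μ) :
    Integrable f (μ.withDensity fun x => ENNReal.ofReal (w x)) := by
  rw [integrable_withDensity_iff_integrable_smul' hw.ennreal_ofReal
    (Eventually.of_forall fun x => ENNReal.ofReal_lt_top)]
  refine hf.congr (Eventually.of_forall fun x => ?_)
  simp [ENNReal.toReal_ofReal (h0 x), mul_comm]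

theorem integral_withDensity_ofReal {X : Type*} [MeasurableSpace X] {μ : Measure X} {w f : X → ℝ}
    (hw : Measurable w) (h0 : ∀ x, 0 ≤ w x) :
    ∫ x, f x ∂μ.withDensity (fun x => ENNReal.ofReal (w x)) = ∫ x, f x * w x ∂μ := by
  rw [integral_withDensity_eq_integral_toReal_smul hw.ennreal_ofReal
    (Eventually.of_forall fun x => ENNReal.ofReal_lt_top)]
  congr 1
  ext x
  simp [ENNReal.toReal_ofReal (h0 x), mul_comm]

theorem lintegral_withDensity_ofReal {X : Type*} [MeasurableSpace X] {μ : Measure X} {w : X → ℝ}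
    (hw : Measurable w) {F : X → ENNReal} (hF : Measurable F) :
    ∫⁻ x, F x ∂μ.withDensity (fun x => ENNReal.ofReal (w x))
      = ∫⁻ x, F x * ENNReal.ofReal (w x) ∂μ := by
  rw [lintegral_withDensity_eq_lintegral_mul _ hw.ennreal_ofReal hF]
  simp [mul_comm]

theorem isFiniteMeasure_withDensity_integrable {X : Type*} [MeasurableSpace X] {μ : Measure X}
    {w : X → ℝ} (hw : Integrable w μ) :
    IsFiniteMeasure (μ.withDensity fun x => ENNReal.ofReal (w x)) :=
  isFiniteMeasure_withDensity_ofReal hw.2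

theorem exp_mul_le_of_norm_sq_le {r y Q : ℝ} (h : y ^ 2 ≤ Q) :
    Real.exp (r * y) * Real.exp (-(1 / 2) * Q) ≤ Real.exp (r ^ 2) * Real.exp (-(1 / 4) * Q) := by
  rw [← Real.exp_add, ← Real.exp_add, Real.exp_le_exp]
  nlinarith [sq_nonneg (r - y / 2)]

theorem lintegral_gaussian_weight_pos {E : Type*} [MeasurableSpace E] [TopologicalSpace E]
    [BorelSpace E] {μ : Measure E} [μ.IsOpenPosMeasure] {f : E → ℝ} (hf : Continuous f)
    (h0 : ∀ x, 0 ≤ f x) (hi : Integrable f μ) {x : E} (hx : f x ≠ 0) : 0 < ∫ x, f x ∂μ := by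
  rw [integral_pos_iff_support_of_nonneg h0 hi]
  exact (hf.isOpen_support).measure_pos μ ⟨x, hx⟩

namespace HurwitzFrame

variable {F : Type} [NormedDivisionRing F] [NormedAlgebra ℝ F] [StarRing F] [StarModule ℝ F]
  {β : ℕ} (H : HurwitzFrame F β) {n : ℕ} [NeZero β]

theorem coordQuad_eq (c : HermCoord n β) : coordQuad c = ∑ j, H.eig c j ^ 2 := by
  have h := H.sum_coordWeight (H.isHermitian_herm c) (H.isHermitian_herm c)
  rw [H.coordOf_herm, ← sq, H.rtr_herm_pow] at h
  rw [← h, coordQuad]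
  exact Finset.sum_congr rfl fun α _ => by ring

/-- The Weyl integration formula. -/
theorem exists_lintegral_eig : ∃ κ : ENNReal, κ ≠ 0 ∧ κ ≠ ⊤ ∧ ∀ G : (Fin n → ℝ) → ENNReal,
    Measurable G → (∀ x (σ : Equiv.Perm (Fin n)), G (x ∘ σ) = G x) →
    ∫⁻ c : HermCoord n β, G (H.eig c)
      = κ * ∫⁻ x, G x * ENNReal.ofReal (|vandermondeProd x| ^ β) := by
  set w₁ : HermCoord n β → ℝ := fun c => Real.exp (-(1 / 2) * coordQuad c) with hw₁
  set w₂ : (Fin n → ℝ) → ℝ := fun x =>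
    |vandermondeProd x| ^ β * Real.exp (-(1 / 2) * ∑ i, x i ^ 2) with hw₂
  have hc₁ : Continuous w₁ := by
    have := continuous_coordQuad (n := n) (β := β)
    fun_prop
  have hc₂ : Continuous w₂ := by fun_prop
  have hQc : Continuous fun x : Fin n → ℝ => ∑ i, x i ^ 2 := by fun_prop
  have hp₁ : ∀ c, 0 ≤ w₁ c := fun c => (Real.exp_pos _).le
  have hp₂ : ∀ x, 0 ≤ w₂ x := fun x => by positivity
  have hV : PolyGrowth fun x : Fin n → ℝ => |vandermondeProd x| ^ β :=
    polyGrowth_vandermondeProd.norm.pow β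
  have hVc : Continuous fun x : Fin n → ℝ => |vandermondeProd x| ^ β := by fun_prop
  have e₁ : ∀ r : ℝ, Integrable fun c => Real.exp (r * ‖H.eig c‖) * w₁ c := by
    intro r
    have h1 := ((PolyGrowth.const (E := HermCoord n β) (Real.exp (r ^ 2)))).integrable_mul_exp
      (μ := volume) (by fun_prop) norm_sq_le_coordQuad continuous_coordQuad
      (a := 1 / 4) (by norm_num)
    refine h1.mono' ?_ (Eventually.of_forall fun c => ?_)
    · exact ((Real.measurable_exp.comp (measurable_const.mul H.measurable_eig.norm)).mul
        hc₁.measurable).aestronglyMeasurable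
    · rw [Real.norm_of_nonneg (by positivity)]
      refine exp_mul_le_of_norm_sq_le ?_
      rw [H.coordQuad_eq]
      exact norm_sq_le_sum_sq _
  have e₂ : ∀ r : ℝ, Integrable fun x => Real.exp (r * ‖x‖) * w₂ x := by
    intro r
    have h1 := ((PolyGrowth.const (E := Fin n → ℝ) (Real.exp (r ^ 2))).mul hV).integrable_mul_exp
      (μ := volume) (by fun_prop) norm_sq_le_sum_sq hQc (a := 1 / 4) (by norm_num)
    refine h1.mono' (by fun_prop) (Eventually.of_forall fun x => ?_)
    rw [Real.norm_of_nonneg (by positivity)]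
    have := exp_mul_le_of_norm_sq_le (r := r) (norm_sq_le_sum_sq x)
    calc _ = |vandermondeProd x| ^ β *
          (Real.exp (r * ‖x‖) * Real.exp (-(1 / 2) * ∑ i, x i ^ 2)) := by simp only [hw₂]; ring
      _ ≤ |vandermondeProd x| ^ β *
          (Real.exp (r ^ 2) * Real.exp (-(1 / 4) * ∑ i, x i ^ 2)) := by gcongr
      _ = _ := by ring
  have i₁ : Integrable w₁ := by simpa using e₁ 0
  have i₂ : Integrable w₂ := by simpa using e₂ 0
  have a₁ : 0 < ∫ c, w₁ c :=
    lintegral_gaussian_weight_pos hc₁ hp₁ i₁ (x := 0) (Real.exp_pos _).ne'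
  have a₂ : 0 < ∫ x, w₂ x := by
    refine lintegral_gaussian_weight_pos hc₂ hp₂ i₂ (x := fun i => (i : ℝ)) ?_
    have : vandermondeProd (fun i : Fin n => (i : ℝ)) ≠ 0 :=
      Finset.prod_ne_zero_iff.2 fun p _ => by
        have := p.2
        rw [sub_ne_zero]
        exact Nat.cast_injective.ne (Fin.val_injective.ne this.ne')
    positivity
  set μ₁ : Measure (Fin n → ℝ) := Measure.map H.eig
    (volume.withDensity fun c => ENNReal.ofReal (w₁ c)) with hμ₁
  set μ₂ : Measure (Fin n → ℝ) := volume.withDensity fun x => ENNReal.ofReal (w₂ x) with hμ₂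
  have := isFiniteMeasure_withDensity_integrable i₁
  have f₂ : IsFiniteMeasure μ₂ := isFiniteMeasure_withDensity_integrable i₂
  have f₁ : IsFiniteMeasure μ₁ := by rw [hμ₁]; infer_instance
  -- Both Gaussian ensembles satisfy the same loop equations, so their mixed moments are
  -- proportional. The proportionality factor is the ratio of total masses.
  have hmom : ∀ s : Multiset ℕ, (∫ x, (s.map fun k => ∑ i, x i ^ k).prod ∂μ₁) * ∫ x, w₂ x
      = (∫ x, (s.map fun k => ∑ i, x i ^ k).prod ∂μ₂) * ∫ c, w₁ c := by
    intro s
    have hcs : Continuous fun x : Fin n → ℝ => (s.map fun k => ∑ i, x i ^ k).prod :=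
      continuous_multiset_prod s fun k _ => by fun_prop
    have h := H.loopEquations_herm.proportional
      (loopEquations_vandermonde (n := n) (Nat.pos_of_ne_zero (NeZero.ne β))) s
    simp only [Multiset.map_zero, Multiset.prod_zero, one_mul] at h
    rw [hμ₁, integral_map H.measurable_eig.aemeasurable hcs.aestronglyMeasurable,
      integral_withDensity_ofReal hc₁.measurable hp₁, hμ₂,
      integral_withDensity_ofReal hc₂.measurable hp₂]
    simp only [H.rtr_herm_pow] at h
    exact h
  have hF : ∀ F : (Fin n → ℝ) → ENNReal, Measurable F →
      (∀ x (σ : Equiv.Perm (Fin n)), F (x ∘ σ) = F x) →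
      ENNReal.ofReal (∫ x, w₂ x) * ∫⁻ x, F x ∂μ₁ = ENNReal.ofReal (∫ c, w₁ c) * ∫⁻ x, F x ∂μ₂ := by
    intro F hF hs
    -- Each measure is scaled by the total mass of the other, which makes all moments equal.
    have h := lintegral_eq_of_psum (ν₁ := (∫ x, w₂ x).toNNReal • μ₁)
      (ν₂ := (∫ c, w₁ c).toNNReal • μ₂) (fun r => ?_) (fun r => ?_) (fun s => ?_) hF hs
    · rw [lintegral_smul_measure, lintegral_smul_measure] at h
      exact h
    · refine Integrable.smul_measure_nnreal ?_
      rw [hμ₁, integrable_map_measure (by fun_prop) H.measurable_eig.aemeasurable]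
      exact integrable_withDensity_ofReal hc₁.measurable hp₁ (e₁ r)
    · refine Integrable.smul_measure_nnreal ?_
      exact integrable_withDensity_ofReal hc₂.measurable hp₂ (e₂ r)
    · rw [integral_smul_nnreal_measure, integral_smul_nnreal_measure, NNReal.smul_def,
        NNReal.smul_def, Real.coe_toNNReal _ a₁.le, Real.coe_toNNReal _ a₂.le, smul_eq_mul,
        smul_eq_mul, mul_comm, hmom s, mul_comm]
  have n₂ : ENNReal.ofReal (∫ x, w₂ x) ≠ 0 := by simpa using a₂
  have n₁ : ENNReal.ofReal (∫ c, w₁ c) ≠ 0 := by simpa using a₁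
  refine ⟨ENNReal.ofReal (∫ c, w₁ c) / ENNReal.ofReal (∫ x, w₂ x),
    ENNReal.div_ne_zero.2 ⟨n₁, ENNReal.ofReal_ne_top⟩, ENNReal.div_ne_top ENNReal.ofReal_ne_top n₂,
    fun G hG hs => ?_⟩
  -- The Gaussian weight is removed by testing with `G` times the inverse weight. This is legitimate
  -- because `Tr M² = ∑ x_j²` is a symmetric function of the eigenvalues.
  have hGm : Measurable fun x : Fin n → ℝ =>
      G x * ENNReal.ofReal (Real.exp (1 / 2 * ∑ i, x i ^ 2)) := by
    refine hG.mul (Continuous.measurable ?_).ennreal_ofReal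
    fun_prop
  have h := hF (fun x => G x * ENNReal.ofReal (Real.exp (1 / 2 * ∑ i, x i ^ 2))) hGm
    (fun x σ => by
      have : ∑ i, (x ∘ σ) i ^ 2 = ∑ i, x i ^ 2 := Equiv.sum_comp σ fun i => x i ^ 2
      simp only [hs, this])
  rw [hμ₁, lintegral_map hGm H.measurable_eig, lintegral_withDensity_ofReal hc₁.measurable
    (by exact hGm.comp H.measurable_eig), hμ₂, lintegral_withDensity_ofReal hc₂.measurable hGm] at h
  have s₁ : ∀ c, G (H.eig c) * ENNReal.ofReal (Real.exp (1 / 2 * ∑ i, H.eig c i ^ 2)) *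
      ENNReal.ofReal (w₁ c) = G (H.eig c) := by
    intro c
    rw [mul_assoc, ← ENNReal.ofReal_mul (Real.exp_pos _).le]
    simp only [hw₁]
    rw [H.coordQuad_eq, ← Real.exp_add]
    ring_nf
    simp
  have s₂ : ∀ x, G x * ENNReal.ofReal (Real.exp (1 / 2 * ∑ i, x i ^ 2)) *
      ENNReal.ofReal (w₂ x) = G x * ENNReal.ofReal (|vandermondeProd x| ^ β) := by
    intro x
    rw [mul_assoc, ← ENNReal.ofReal_mul (Real.exp_pos _).le]
    simp only [hw₂]
    rw [mul_left_comm, ← Real.exp_add]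
    ring_nf
    simp
  simp only [s₁, s₂] at h
  rw [ENNReal.mul_comm_div, ← mul_div_assoc, ENNReal.eq_div_iff n₂ ENNReal.ofReal_ne_top, h]

end HurwitzFrame

end ExternalSource

/-! ### Householder reflections and averaging over directions. -/

namespace ExternalSource

open MeasureTheory Matrix Module Filter Topology

namespace HurwitzFrame

section Reflection

variable {F : Type} [DivisionRing F] [Algebra ℝ F] [StarRing F] [StarModule ℝ F] {β : ℕ}
  (H : HurwitzFrame F β) {n : ℕ}

theorem mul_star_self (p : F) : p * star p = algebraMap ℝ F (H.re (p * star p)) :=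
  (H.algebraMap_re _ (by simp)).symm

theorem star_mul_self (p : F) : star p * p = algebraMap ℝ F (H.re (p * star p)) := by
  rw [H.re_mul_comm]
  exact (H.algebraMap_re _ (by simp)).symm

theorem re_mul_star_self_nonneg (p : F) : 0 ≤ H.re (p * star p) := by
  rw [H.re_mul_star_eq_sum]
  exact Finset.sum_nonneg fun k _ => mul_self_nonneg _

theorem re_mul_star_self_pos {p : F} (hp : p ≠ 0) : 0 < H.re (p * star p) := by
  refine lt_of_le_of_ne (H.re_mul_star_self_nonneg p) fun h => ?_
  have h1 := H.mul_star_self p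
  rw [← h, map_zero, mul_eq_zero] at h1
  rcases h1 with h1 | h1
  · exact hp h1
  · exact hp (star_eq_zero.1 h1)

/-- For `p ≠ 0` take `q = -p̄/|p|`. Rotating to the negative axis, not the positive one, keeps the
normalization `1 + t` of the reflection away from zero. -/
theorem exists_unit_mul (H : HurwitzFrame F β) (p : F) : ∃ q : F, star q * q = 1 ∧ q * star q = 1 ∧
    ∃ t : ℝ, 0 ≤ t ∧ q * p = algebraMap ℝ F (-t) := by
  rcases eq_or_ne p 0 with rfl | hp
  · exact ⟨1, by simp, by simp, 0, le_rfl, by simp⟩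
  have h0 := H.re_mul_star_self_pos hp
  set a := H.re (p * star p) with ha
  have hr : √a * √a = a := Real.mul_self_sqrt h0.le
  have hs : √a ≠ 0 := (Real.sqrt_pos.2 h0).ne'
  have h1 : (√a)⁻¹ * ((√a)⁻¹ * a) = 1 := by
    nth_rw 3 [← hr]
    field_simp
  refine ⟨-((√a)⁻¹ • star p), ?_, ?_, √a, Real.sqrt_nonneg _, ?_⟩
  · rw [star_neg, star_smul, star_star, neg_mul_neg, smul_mul_smul_comm, H.mul_star_self, ← ha,
      Algebra.smul_def, ← map_mul, star_trivial, mul_assoc, h1, map_one]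
  · rw [star_neg, star_smul, star_star, neg_mul_neg, smul_mul_smul_comm, H.star_mul_self, ← ha,
      Algebra.smul_def, ← map_mul, star_trivial, mul_assoc, h1, map_one]
  · rw [neg_mul, smul_mul_assoc, H.star_mul_self, ← ha, Algebra.smul_def, ← map_mul, map_neg]
    congr 2
    nth_rw 2 [← hr]
    field_simp

/-- Normalize the row vector of `y` and multiply it from the left by a unit that makes its
coordinate `i₀` real and nonpositive. Such a unit cancels in the quadratic form because `re (q z q̄)
= re z`. -/
theorem exists_unit_vector {y : EuclideanSpace ℝ (Fin n × Fin β)} (hy : y ≠ 0) (i₀ : Fin n) :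
    ∃ u : Fin n → F, (∃ t : ℝ, 0 ≤ t ∧ u i₀ = algebraMap ℝ F (-t)) ∧ u ⬝ᵥ star u = 1 ∧
      ∀ X : Matrix (Fin n) (Fin n) F,
        H.re (u ⬝ᵥ X *ᵥ star u) = inner ℝ (H.op X y) y / ‖y‖ ^ 2 := by
  obtain ⟨q, hq, hq', t, ht, hqt⟩ := H.exists_unit_mul (H.vec y i₀)
  have hN : ‖y‖ ≠ 0 := norm_ne_zero_iff.2 hy
  have hX : ∀ X : Matrix (Fin n) (Fin n) F,
      (‖y‖⁻¹ • q • H.vec y) ⬝ᵥ X *ᵥ star (‖y‖⁻¹ • q • H.vec y)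
        = (‖y‖ ^ 2)⁻¹ • (q * (H.vec y ⬝ᵥ X *ᵥ star (H.vec y)) * star q) := by
    intro X
    simp only [dotProduct, mulVec, Pi.smul_apply, Pi.star_apply, star_smul, star_trivial,
      smul_eq_mul, star_mul, Finset.mul_sum, Finset.sum_mul, Finset.smul_sum, mul_smul_comm,
      smul_mul_assoc, smul_smul, mul_assoc]
    refine Finset.sum_congr rfl fun i _ => Finset.sum_congr rfl fun j _ => ?_
    congr 1
    field_simp
  refine ⟨‖y‖⁻¹ • q • H.vec y, ⟨‖y‖⁻¹ * t, by positivity, ?_⟩, ?_, fun X => ?_⟩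
  · rw [Pi.smul_apply, Pi.smul_apply, smul_eq_mul, hqt, Algebra.smul_def, ← map_mul, mul_neg]
  · have h1 := hX 1
    rw [one_mulVec, one_mulVec] at h1
    have h2 : H.vec y ⬝ᵥ star (H.vec y) = algebraMap ℝ F (‖y‖ ^ 2) := by
      rw [← real_inner_self_eq_norm_sq, H.inner_eq_re, H.algebraMap_re]
      simp [dotProduct]
    rw [h1, h2, ← Algebra.commutes, mul_assoc, hq', mul_one, Algebra.smul_def, ← map_mul,
      inv_mul_cancel₀ (pow_ne_zero 2 hN), map_one]
  · rw [hX, map_smul, H.re_mul_comm, ← mul_assoc, hq, one_mul, H.inner_op, smul_eq_mul,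
      div_eq_inv_mul]

/-- The Householder reflection that maps a coordinate vector to a given direction. -/
theorem exists_reflection {y : EuclideanSpace ℝ (Fin n × Fin β)} (hy : y ≠ 0) (i₀ : Fin n) :
    ∃ R : Matrix (Fin n) (Fin n) F, R.IsHermitian ∧ R * R = 1 ∧ ∀ X : Matrix (Fin n) (Fin n) F,
      H.re ((R * X * R) i₀ i₀) = inner ℝ (H.op X y) y / ‖y‖ ^ 2 := by
  obtain ⟨u, ⟨t, ht, hu⟩, huu, hX⟩ := H.exists_unit_vector hy i₀
  -- The reflection along `w = e - u` exchanges `e` and `u`. As `u_{i₀} = -t` is real, `|w|² = 2(1 +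
  -- t)`, which is why `R = 1 - (1 + t)⁻¹ w* w` is an involution.
  set w : Fin n → F := Pi.single i₀ 1 - u with hw
  have hs : (1 + t) ≠ 0 := by positivity
  have hw0 : w i₀ = algebraMap ℝ F (1 + t) := by
    simp [hw, hu]
  have hww : w ⬝ᵥ star w = algebraMap ℝ F (2 * (1 + t)) := by
    have h1 : (Pi.single i₀ 1 : Fin n → F) ⬝ᵥ star u = algebraMap ℝ F (-t) := by
      rw [single_dotProduct, one_mul, Pi.star_apply, hu, ← algebraMap_star_comm, star_trivial]
    have h2 : u ⬝ᵥ (Pi.single i₀ 1 : Fin n → F) = algebraMap ℝ F (-t) := by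
      rw [dotProduct_single, mul_one, hu]
    have h3 : star (Pi.single i₀ 1 : Fin n → F) = Pi.single i₀ 1 := by
      rw [← Pi.single_star, star_one]
    rw [hw, star_sub, sub_dotProduct, dotProduct_sub, dotProduct_sub, h3, h1, h2, huu,
      single_dotProduct, Pi.single_eq_same, mul_one]
    simp only [map_neg, map_mul, map_add, map_one, map_ofNat]
    noncomm_ring
  set V : Matrix (Fin n) (Fin n) F := Matrix.of fun i j => star (w i) * w j with hV
  have hVV : V * V = (2 * (1 + t)) • V := by
    ext i j
    have : ∑ k, star (w i) * w k * (star (w k) * w j) = star (w i) * (w ⬝ᵥ star w) * w j := by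
      simp only [dotProduct, Finset.mul_sum, Finset.sum_mul, mul_assoc, Pi.star_apply]
    rw [mul_apply, Matrix.smul_apply]
    simp only [hV, Matrix.of_apply]
    rw [this, hww, ← Algebra.commutes, mul_assoc, Algebra.smul_def]
  have hVh : V.IsHermitian := by
    ext i j
    simp [hV, conjTranspose_apply]
  set R : Matrix (Fin n) (Fin n) F := 1 - (1 + t)⁻¹ • V with hR
  have hRh : R.IsHermitian := by
    refine isHermitian_one.sub ?_
    rw [IsHermitian, conjTranspose_smul, hVh.eq, star_trivial]
  -- Row `i₀` of `R` is `u`, so the entry `(i₀, i₀)` of `R X R` is the quadratic form of `X` at `u`.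
  have hrow : R i₀ = u := by
    ext j
    simp only [hR, Matrix.sub_apply, Matrix.smul_apply, hV, Matrix.of_apply, hw0]
    rw [← algebraMap_star_comm, star_trivial, ← Algebra.smul_def, smul_smul, inv_mul_cancel₀ hs,
      one_smul, hw, Pi.sub_apply, Matrix.one_apply, Pi.single_apply]
    simp [eq_comm]
  refine ⟨R, hRh, ?_, fun X => ?_⟩
  · rw [hR, sub_mul, mul_sub, mul_sub, mul_one, mul_one, one_mul, smul_mul_smul_comm, hVV,
      smul_smul]
    have : (1 + t)⁻¹ * (1 + t)⁻¹ * (2 * (1 + t)) = (1 + t)⁻¹ + (1 + t)⁻¹ := by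
      field_simp; norm_num
    rw [this, add_smul]
    abel
  · rw [← hX]
    congr 1
    have h1 : ∀ l, R l i₀ = star (u l) := fun l => by rw [← hrow]; exact (hRh.apply l i₀).symm
    rw [mul_assoc, mul_apply, dotProduct]
    refine Finset.sum_congr rfl fun k _ => ?_
    rw [hrow, mul_apply, mulVec, dotProduct]
    simp only [h1, Pi.star_apply]

/-- Conjugation by a Hermitian matrix, in coordinates. -/
noncomputable def conj {R : Matrix (Fin n) (Fin n) F} (hR : R.IsHermitian) :
    HermCoord n β →ₗ[ℝ] HermCoord n β where
  toFun c := H.coordOf (R * H.herm c * R)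
  map_add' c d := by
    rw [H.herm_add, mul_add, add_mul]
    refine Prod.ext (funext fun i => ?_) (funext fun p => ?_)
    · simp [coordOf]
    · simp [coordOf]
  map_smul' r c := by
    rw [H.herm_smul, mul_smul_comm, smul_mul_assoc]
    refine Prod.ext (funext fun i => ?_) (funext fun p => ?_)
    · simp [coordOf]
    · simp [coordOf]

theorem herm_conj {R : Matrix (Fin n) (Fin n) F} (hR : R.IsHermitian) (c : HermCoord n β) :
    H.herm (H.conj hR c) = R * H.herm c * R := by
  refine H.herm_coordOf ?_
  have := isHermitian_mul_mul_conjTranspose R (H.isHermitian_herm c)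
  rwa [hR.eq] at this

theorem conj_conj {R : Matrix (Fin n) (Fin n) F} (hR : R.IsHermitian) (hRR : R * R = 1)
    (c : HermCoord n β) : H.conj hR (H.conj hR c) = c := by
  have h1 : H.herm (H.conj hR (H.conj hR c)) = H.herm c := by
    rw [herm_conj, herm_conj]
    calc _ = (R * R) * H.herm c * (R * R) := by simp only [mul_assoc]
      _ = _ := by rw [hRR, one_mul, mul_one]
  rw [← H.coordOf_herm (H.conj hR (H.conj hR c)), h1, H.coordOf_herm]

/-- Conjugation by an involution leaves traces of powers unchanged, and these determine the ordered
eigenvalues. -/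
theorem eig_conj [NeZero β] {R : Matrix (Fin n) (Fin n) F} (hR : R.IsHermitian) (hRR : R * R = 1)
    (c : HermCoord n β) : H.eig (H.conj hR c) = H.eig c := by
  refine Antitone.eq_of_psum (H.antitone_eig _) (H.antitone_eig _) fun k => ?_
  rw [← H.rtr_herm_pow, ← H.rtr_herm_pow, H.herm_conj hR]
  have h1 : (R * H.herm c * R) ^ k = R * H.herm c ^ k * R := by
    induction k with
    | zero => simp [hRR]
    | succ k ih =>
      rw [pow_succ, ih, pow_succ]
      calc _ = R * H.herm c ^ k * (R * R) * H.herm c * R := by simp only [mul_assoc]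
        _ = _ := by rw [hRR, mul_one]; simp only [mul_assoc]
  rw [h1, H.rtr_mul_comm, ← mul_assoc, hRR, one_mul]

/-- Conjugation by an involution is itself a linear involution, so its determinant is `±1`. -/
theorem measurePreserving_conj {R : Matrix (Fin n) (Fin n) F} (hR : R.IsHermitian)
    (hRR : R * R = 1) : MeasurePreserving (H.conj hR : HermCoord n β → HermCoord n β) := by
  have h1 : H.conj hR * H.conj hR = 1 := LinearMap.ext fun c => H.conj_conj hR hRR c
  have h2 : LinearMap.det (H.conj hR) * LinearMap.det (H.conj hR) = 1 := by
    rw [← map_mul, h1, map_one]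
  have h0 : LinearMap.det (H.conj hR) ≠ 0 := left_ne_zero_of_mul_eq_one h2
  refine ⟨(LinearMap.continuous_of_finiteDimensional _).measurable, ?_⟩
  rw [Measure.map_linearMap_addHaar_eq_smul_addHaar volume h0, abs_inv]
  have h3 : |LinearMap.det (H.conj hR)| = 1 := by
    rcases mul_self_eq_one_iff.1 h2 with h | h <;> simp [h]
  simp [h3]

end Reflection

section Average

variable {F : Type} [NormedDivisionRing F] [NormedAlgebra ℝ F] [StarRing F] [StarModule ℝ F]
  {β : ℕ} (H : HurwitzFrame F β) {n : ℕ}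

theorem continuous_inner_op :
    Continuous fun p : HermCoord n β × EuclideanSpace ℝ (Fin n × Fin β) =>
      inner ℝ (H.op (H.herm p.1) p.2) p.2 := by
  let L : HermCoord n β →ₗ[ℝ]
      (EuclideanSpace ℝ (Fin n × Fin β) →L[ℝ] EuclideanSpace ℝ (Fin n × Fin β)) :=
    { toFun := fun c => LinearMap.toContinuousLinearMap (H.op (H.herm c))
      map_add' := fun c d => by
        ext1 y
        apply H.vec.injective
        simp [H.herm_add, vec_op, vecMul_add]
      map_smul' := fun r c => by
        ext1 y
        apply H.vec.injective
        simp [H.herm_smul, vec_op, vecMul_smul] }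
  have hL : Continuous L := LinearMap.continuous_of_finiteDimensional _
  have h1 : Continuous fun p : HermCoord n β × EuclideanSpace ℝ (Fin n × Fin β) => L p.1 p.2 :=
    (hL.comp continuous_fst).clm_apply continuous_snd
  exact h1.inner continuous_snd

/-- Integration over the direction of an eigenvector frame: a diagonal entry may be replaced by the
Rayleigh quotient of a Gaussian vector. -/
theorem lintegral_eig_mul_diag [NeZero β] (i₀ : Fin n) {Φ : (Fin n → ℝ) → ENNReal}
    (hΦ : Measurable Φ) {g : ℝ → ENNReal} (hg : Measurable g) :
    gauss (Fin n × Fin β) Set.univ * ∫⁻ c : HermCoord n β, Φ (H.eig c) * g (c.1 i₀)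
      = ∫⁻ c : HermCoord n β, Φ (H.eig c) *
        ∫⁻ y, g (rayleigh (fun p : Fin n × Fin β => H.eig c p.1) y) ∂gauss (Fin n × Fin β) := by
  have : Nonempty (Fin n × Fin β) := ⟨(i₀, 0)⟩
  have hm := H.measurable_eig (n := n)
  -- For each `y ≠ 0`, changing variables by the reflection attached to `y` fixes the eigenvalues
  -- and turns the diagonal entry into the Rayleigh quotient at `y`. The left side does not depend
  -- on `y`.
  have h1 : ∀ᵐ y ∂gauss (Fin n × Fin β), ∫⁻ c : HermCoord n β, Φ (H.eig c) * g (c.1 i₀)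
      = ∫⁻ c : HermCoord n β, Φ (H.eig c) * g (inner ℝ (H.op (H.herm c) y) y / ‖y‖ ^ 2) := by
    filter_upwards [ae_gauss_ne_zero] with y hy
    obtain ⟨R, hR, hRR, hX⟩ := H.exists_reflection hy i₀
    have hmc : Measurable fun c : HermCoord n β => Φ (H.eig c) * g (c.1 i₀) :=
      (hΦ.comp hm).mul (hg.comp ((measurable_pi_apply i₀).comp measurable_fst))
    rw [← (H.measurePreserving_conj hR hRR).lintegral_comp hmc]
    refine lintegral_congr fun c => ?_
    rw [H.eig_conj hR hRR, ← hX]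
    rfl
  obtain ⟨k, hk, hkg⟩ : ∃ k : HermCoord n β × EuclideanSpace ℝ (Fin n × Fin β) → ENNReal,
      Measurable k ∧ ∀ c y, g (inner ℝ (H.op (H.herm c) y) y / ‖y‖ ^ 2) = k (c, y) :=
    ⟨_, hg.comp (H.continuous_inner_op.measurable.div (measurable_snd.norm.pow_const 2)),
      fun _ _ => rfl⟩
  simp only [hkg] at h1
  have hq : Measurable fun p : EuclideanSpace ℝ (Fin n × Fin β) × HermCoord n β =>
      Φ (H.eig p.2) * k (p.2, p.1) :=
    ((hΦ.comp hm).comp measurable_snd).mul (hk.comp measurable_swap)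
  -- Integrating over `y` multiplies the left side by the total Gaussian mass. After Tonelli the
  -- inner integral on the right depends only on the eigenvalues, by rotation invariance.
  have s1 := lintegral_congr_ae h1
  rw [lintegral_const, mul_comm, lintegral_lintegral_swap hq.aemeasurable] at s1
  rw [s1]
  refine lintegral_congr fun c => ?_
  have h4 : Measurable fun y => k (c, y) := hk.comp measurable_prodMk_left
  rw [lintegral_const_mul _ h4, ← H.lintegral_gauss_op c hg]
  simp only [hkg]

end Average

end HurwitzFrame

end ExternalSource

namespace ExternalSource

open MeasureTheory Matrix Module Filter Topology

/-! ### Confining potentials -/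

/-- Subtracting half the leading coefficient times `x²` leaves a polynomial of the same even degree
with positive leading coefficient, also in degree two. It tends to infinity at both ends and attains
a minimum. -/
theorem exists_quadratic_le_eval {V : Polynomial ℝ} (hdeg : Even V.natDegree)
    (hpos : 0 < V.natDegree) (hlead : 0 < V.leadingCoeff) :
    ∃ δ b : ℝ, 0 < δ ∧ ∀ x, δ * x ^ 2 - b ≤ V.eval x := by
  have h2 : 2 ≤ V.natDegree := by
    obtain ⟨k, hk⟩ := hdeg
    omega
  set d := V.natDegree with hd
  set δ := V.leadingCoeff / 2 with hδ
  have hδ0 : 0 < δ := by positivity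
  set W : Polynomial ℝ := V - Polynomial.C δ * Polynomial.X ^ 2 with hW
  have hc : 0 < W.coeff d := by
    rw [hW, Polynomial.coeff_sub, Polynomial.coeff_C_mul, Polynomial.coeff_X_pow]
    change 0 < V.leadingCoeff - _
    split_ifs
    · rw [hδ]; linarith
    · simpa using hlead
  have hle : W.natDegree ≤ d := by
    refine (Polynomial.natDegree_sub_le _ _).trans (max_le le_rfl ?_)
    exact (Polynomial.natDegree_C_mul_X_pow_le _ _).trans h2
  have hWd : W.natDegree = d := le_antisymm hle (Polynomial.le_natDegree_of_ne_zero hc.ne')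
  have hWl : 0 < W.leadingCoeff := by rw [Polynomial.leadingCoeff, hWd]; exact hc
  have htop : ∀ P : Polynomial ℝ, P.natDegree = d → 0 < P.leadingCoeff →
      Tendsto (fun x => P.eval x) atTop atTop := fun P h1 h2 => by
    refine P.tendsto_atTop_of_leadingCoeff_nonneg ?_ h2.le
    rw [← Polynomial.natDegree_pos_iff_degree_pos, h1]
    exact hpos
  have h1 := htop W hWd hWl
  have h3 : Tendsto (fun x => W.eval x) atBot atTop := by
    have h4 := htop (W.comp (-Polynomial.X)) (by simp [Polynomial.natDegree_comp, hWd]) (by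
      rw [Polynomial.leadingCoeff_comp (by simp), Polynomial.leadingCoeff_neg,
        Polynomial.leadingCoeff_X, hWd, hdeg.neg_one_pow, mul_one]
      exact hWl)
    have h5 := h4.comp tendsto_neg_atBot_atTop
    refine h5.congr fun x => ?_
    simp
  have h6 : Tendsto (fun x => W.eval x) (cocompact ℝ) atTop := by
    rw [cocompact_eq_atBot_atTop]
    exact h3.sup h1
  obtain ⟨x₀, hx₀⟩ := W.continuous.exists_forall_le h6
  refine ⟨δ, -W.eval x₀, hδ0, fun x => ?_⟩
  have h7 := hx₀ x
  simp only [hW, Polynomial.eval_sub, Polynomial.eval_mul, Polynomial.eval_C, Polynomial.eval_pow,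
    Polynomial.eval_X] at h7 ⊢
  linarith

/-- Functions of at most exponential growth are integrable against a confining weight. -/
theorem integrable_mul_prod_exp_eval {V : Polynomial ℝ} (hdeg : Even V.natDegree)
    (hpos : 0 < V.natDegree) (hlead : 0 < V.leadingCoeff) {k : ℕ} {κ : ℝ} (hκ : 0 < κ)
    {f g : (Fin k → ℝ) → ℝ} (hf : Measurable f) (hg : PolyGrowth g) (hgm : Measurable g) {r : ℝ}
    (hfg : ∀ x, ‖f x‖ ≤ ‖g x‖ * Real.exp (r * ‖x‖)) :
    Integrable fun x => f x * ∏ j, Real.exp (-κ * V.eval (x j)) := by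
  obtain ⟨δ, b, hδ, hb⟩ := exists_quadratic_le_eval hdeg hpos hlead
  set q := κ * δ with hq
  have hq0 : 0 < q := by positivity
  have h1 := ((hg.norm).mul (PolyGrowth.const (E := Fin k → ℝ)
    (Real.exp (r ^ 2 / (2 * q)) * Real.exp (k * (κ * b))))).integrable_mul_exp
    (μ := volume) (by fun_prop) norm_sq_le_sum_sq (by fun_prop) (a := q / 2) (by positivity)
  refine h1.mono' ?_ (Eventually.of_forall fun x => ?_)
  · have : Measurable fun x : Fin k → ℝ => ∏ j, Real.exp (-κ * V.eval (x j)) := by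
      refine Finset.measurable_fun_prod _ fun j _ => ?_
      have := V.continuous.measurable
      fun_prop
    exact (hf.mul this).aestronglyMeasurable
  have h2 : ∏ j, Real.exp (-κ * V.eval (x j)) ≤
      Real.exp (k * (κ * b)) * Real.exp (-q * ∑ j, x j ^ 2) := by
    rw [← Real.exp_sum, ← Real.exp_add, Real.exp_le_exp]
    have h3 : ∀ j ∈ (Finset.univ : Finset (Fin k)),
        -κ * V.eval (x j) ≤ κ * b + -q * x j ^ 2 := fun j _ => by
      have := mul_le_mul_of_nonneg_left (hb (x j)) hκ.le
      rw [hq]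
      linarith
    refine (Finset.sum_le_sum h3).trans (le_of_eq ?_)
    rw [Finset.sum_add_distrib, Finset.sum_const, Finset.card_univ, Fintype.card_fin,
      nsmul_eq_mul, ← Finset.mul_sum]
  -- Half of the Gaussian rate pays for the linear exponent: `r|x| ≤ r²/(2q) + (q/2)|x|²`.
  have h4 : Real.exp (r * ‖x‖) * Real.exp (-q * ∑ j, x j ^ 2)
      ≤ Real.exp (r ^ 2 / (2 * q)) * Real.exp (-(q / 2) * ∑ j, x j ^ 2) := by
    rw [← Real.exp_add, ← Real.exp_add, Real.exp_le_exp]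
    have h5 : 0 ≤ (r - q * ‖x‖) ^ 2 / (2 * q) := by positivity
    have h6 : (r - q * ‖x‖) ^ 2 / (2 * q) = r ^ 2 / (2 * q) - r * ‖x‖ + q / 2 * ‖x‖ ^ 2 := by
      field_simp; ring
    have h7 := mul_le_mul_of_nonneg_left (norm_sq_le_sum_sq x) (by positivity : 0 ≤ q / 2)
    linarith
  rw [norm_mul, Real.norm_of_nonneg (Finset.prod_nonneg fun j _ => (Real.exp_pos _).le)]
  calc _ ≤ (‖g x‖ * Real.exp (r * ‖x‖)) *
        (Real.exp (k * (κ * b)) * Real.exp (-q * ∑ j, x j ^ 2)) := by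
        gcongr
        exact hfg x
    _ = ‖g x‖ * Real.exp (k * (κ * b)) * (Real.exp (r * ‖x‖) * Real.exp (-q * ∑ j, x j ^ 2)) := by
        ring
    _ ≤ ‖g x‖ * Real.exp (k * (κ * b)) *
        (Real.exp (r ^ 2 / (2 * q)) * Real.exp (-(q / 2) * ∑ j, x j ^ 2)) := by gcongr
    _ = _ := by ring

/-! ### The spherical average -/

section Spherical

variable {n β : ℕ}

theorem abs_rayleigh_le {ι : Type} [Fintype ι] {X : ι → ℝ} {r : ℝ} (hr : 0 ≤ r)
    (hX : ∀ p, |X p| ≤ r) (y : EuclideanSpace ℝ ι) : |rayleigh X y| ≤ r := by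
  rw [rayleigh, abs_div, abs_of_nonneg (sq_nonneg ‖y‖)]
  refine div_le_of_le_mul₀ (sq_nonneg _) hr ((Finset.abs_sum_le_sum_abs _ _).trans ?_)
  rw [EuclideanSpace.real_norm_sq_eq, Finset.mul_sum]
  refine Finset.sum_le_sum fun p _ => ?_
  rw [abs_mul, abs_of_nonneg (sq_nonneg (y p))]
  exact mul_le_mul_of_nonneg_right (hX p) (sq_nonneg _)

theorem measurable_rayleigh_uncurry :
    Measurable fun p : (Fin n → ℝ) × EuclideanSpace ℝ (Fin n × Fin β) =>
      rayleigh (fun q : Fin n × Fin β => p.1 q.1) p.2 := by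
  unfold rayleigh
  refine Measurable.div (Finset.measurable_fun_sum _ fun q _ => ?_) (by fun_prop)
  exact ((measurable_pi_apply q.1).comp measurable_fst).mul
    (((by fun_prop : Measurable fun y : EuclideanSpace ℝ (Fin n × Fin β) => y q).comp
      measurable_snd).pow_const 2)

theorem exp_mul_rayleigh_le {c : ℝ} (hc : 0 ≤ c) (X : Fin n → ℝ)
    (y : EuclideanSpace ℝ (Fin n × Fin β)) :
    Real.exp (c * rayleigh (fun p : Fin n × Fin β => X p.1) y) ≤ Real.exp (c * ‖X‖) := by
  rw [Real.exp_le_exp]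
  refine mul_le_mul_of_nonneg_left ((le_abs_self _).trans ?_) hc
  exact abs_rayleigh_le (norm_nonneg _) (fun p => norm_le_pi_norm X p.1) y

theorem integrable_exp_mul_rayleigh {c : ℝ} (hc : 0 ≤ c) (X : Fin n → ℝ) :
    Integrable (fun y => Real.exp (c * rayleigh (fun p : Fin n × Fin β => X p.1) y))
      (gauss (Fin n × Fin β)) := by
  have := measurable_rayleigh fun p : Fin n × Fin β => X p.1
  refine Integrable.of_bound (Measurable.aestronglyMeasurable (by fun_prop)) (Real.exp (c * ‖X‖))
    (Eventually.of_forall fun y => ?_)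
  rw [Real.norm_of_nonneg (Real.exp_pos _).le]
  exact exp_mul_rayleigh_le hc X y

theorem measurable_sphericalAverage (c : ℝ) :
    Measurable (sphericalAverage n β c) := by
  have h : StronglyMeasurable fun p : (Fin n → ℝ) × EuclideanSpace ℝ (Fin n × Fin β) =>
      Real.exp (c * rayleigh (fun q : Fin n × Fin β => p.1 q.1) p.2) :=
    (Real.measurable_exp.comp (measurable_const.mul measurable_rayleigh_uncurry)).stronglyMeasurable
  exact h.integral_prod_right.measurable

theorem gauss_univ_ne_zero [NeZero n] [NeZero β] : gauss (Fin n × Fin β) Set.univ ≠ 0 := by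
  intro h
  rw [Measure.measure_univ_eq_zero] at h
  have h1 := volume_absolutelyContinuous_gauss (ι := Fin n × Fin β)
  rw [h, Measure.absolutelyContinuous_zero_iff] at h1
  exact (NeZero.ne (volume : Measure (EuclideanSpace ℝ (Fin n × Fin β)))) h1

theorem sphericalAverage_pos [NeZero n] [NeZero β] {c : ℝ} (hc : 0 ≤ c) (X : Fin n → ℝ) :
    0 < sphericalAverage n β c X := by
  rw [sphericalAverage, integral_pos_iff_support_of_nonneg (fun y => (Real.exp_pos _).le)
    (integrable_exp_mul_rayleigh hc X)]
  have : (Function.support fun y => Real.exp (c * rayleigh (fun p : Fin n × Fin β => X p.1) y))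
      = Set.univ := Set.eq_univ_of_forall fun y => (Real.exp_pos _).ne'
  rw [this]
  exact pos_iff_ne_zero.2 gauss_univ_ne_zero

theorem sphericalAverage_le {c : ℝ} (hc : 0 ≤ c) (X : Fin n → ℝ) :
    sphericalAverage n β c X ≤ (gauss (Fin n × Fin β)).real Set.univ * Real.exp (c * ‖X‖) := by
  refine (integral_mono (integrable_exp_mul_rayleigh hc X) (integrable_const (Real.exp (c * ‖X‖)))
    fun y => exp_mul_rayleigh_le hc X y).trans (le_of_eq ?_)
  simp

theorem lintegral_exp_mul_rayleigh {c : ℝ} (hc : 0 ≤ c) (X : Fin n → ℝ) :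
    ∫⁻ y, ENNReal.ofReal (Real.exp (c * rayleigh (fun p : Fin n × Fin β => X p.1) y))
      ∂gauss (Fin n × Fin β) = ENNReal.ofReal (sphericalAverage n β c X) :=
  (ofReal_integral_eq_lintegral_ofReal (integrable_exp_mul_rayleigh hc X)
    (Eventually.of_forall fun y => (Real.exp_pos _).le)).symm

/-- The contour formula expresses the average through a product over `j`, which is visibly
symmetric. Any contour around all the `X j` will do. -/
theorem sphericalAverage_comp_perm [NeZero n] [NeZero β] {N : ℕ} (hN : n * β = 2 * (N + 1)) {c : ℝ}
    (hc : 0 < c) (X : Fin n → ℝ) (σ : Equiv.Perm (Fin n)) :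
    sphericalAverage n β c (X ∘ σ) = sphericalAverage n β c X := by
  have h := hankelContour_piContour (lt_add_one ‖X‖) one_pos
  have hX : ∀ j, X j ≤ ‖X‖ := fun j => (le_abs_self _).trans (norm_le_pi_norm X j)
  have h1 := h.integral_exp_mul_prod_cpow hc hN hX
  have h2 := h.integral_exp_mul_prod_cpow hc hN (X := X ∘ σ) fun j => hX (σ j)
  have h3 : ∀ t, ∏ j, ((piContour (‖X‖ + 1) 1 t - ((X ∘ σ) j : ℝ)) ^ ((β : ℂ) / 2))⁻¹
      = ∏ j, ((piContour (‖X‖ + 1) 1 t - (X j : ℝ)) ^ ((β : ℂ) / 2))⁻¹ := fun t =>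
    Equiv.prod_comp σ fun j => ((piContour (‖X‖ + 1) 1 t - (X j : ℝ)) ^ ((β : ℂ) / 2))⁻¹
  simp only [h3, h1] at h2
  have h4 : (2 * Real.pi * Complex.I : ℂ) ≠ 0 := Complex.two_pi_I_ne_zero
  have h5 := Complex.ofReal_injective (mul_left_cancel₀ h4 h2)
  exact (mul_left_cancel₀ (by positivity) h5).symm

end Spherical

end ExternalSource

namespace ExternalSource

open MeasureTheory Matrix Module Filter Topology

/-! ### The law of the maximum under a symmetric density -/

theorem vandermondeProd_cons {m : ℕ} (u : ℝ) (x : Fin m → ℝ) :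
    |vandermondeProd (Fin.cons u x : Fin (m + 1) → ℝ)|
      = |vandermondeProd x| * ∏ j, |u - x j| := by
  rw [vandermondeProd_eq, vandermondeProd_eq, Fin.prod_univ_succ, abs_mul, mul_comm]
  congr 1
  · congr 1
    refine Finset.prod_congr rfl fun i _ => ?_
    rw [Fin.Ioi_succ, Finset.prod_map]
    simp
  · rw [Fin.Ioi_zero_eq_map, Finset.prod_map, Finset.abs_prod]
    refine Finset.prod_congr rfl fun i _ => ?_
    simp [abs_sub_comm]

/-- A product over all ordered pairs does not refer to the order of the indices, so its invariance
under permutations is immediate. -/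
theorem abs_vandermondeProd_sq {n : ℕ} (x : Fin n → ℝ) :
    |vandermondeProd x| ^ 2 = ∏ p ∈ (Finset.univ : Finset (Fin n)).offDiag, |x p.2 - x p.1| := by
  have h1 : (Finset.univ : Finset (Fin n)).offDiag
      = (Finset.univ.filter fun p : Fin n × Fin n => p.1 < p.2)
        ∪ (Finset.univ.filter fun p : Fin n × Fin n => p.2 < p.1) := by
    ext p
    simp [lt_or_lt_iff_ne]
  rw [h1, Finset.prod_union (Finset.disjoint_filter.2 fun p _ h h' => lt_asymm h h')]
  have h2 : ∏ p ∈ Finset.univ.filter (fun p : Fin n × Fin n => p.1 < p.2), |x p.2 - x p.1|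
      = |vandermondeProd x| := by
    rw [vandermondeProd, Finset.abs_prod]
    exact (Finset.prod_subtype _ (fun p => by simp) fun p : Fin n × Fin n => |x p.2 - x p.1|)
  have h3 : ∏ p ∈ Finset.univ.filter (fun p : Fin n × Fin n => p.2 < p.1), |x p.2 - x p.1|
      = ∏ p ∈ Finset.univ.filter (fun p : Fin n × Fin n => p.1 < p.2), |x p.2 - x p.1| := by
    refine Finset.prod_equiv (Equiv.prodComm _ _) (fun p => by simp) fun p _ => ?_
    simp [abs_sub_comm]
  rw [h3, h2, sq]

theorem abs_vandermondeProd_comp_perm {n : ℕ} (x : Fin n → ℝ) (σ : Equiv.Perm (Fin n)) :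
    |vandermondeProd (x ∘ σ)| = |vandermondeProd x| := by
  rw [← sq_eq_sq₀ (abs_nonneg _) (abs_nonneg _), abs_vandermondeProd_sq, abs_vandermondeProd_sq]
  exact Finset.prod_equiv (Equiv.prodCongr σ σ) (fun p => by simp) fun p _ => rfl

theorem vandermondeProd_ne_zero_iff {n : ℕ} {x : Fin n → ℝ} :
    vandermondeProd x ≠ 0 ↔ Function.Injective x := by
  rw [vandermondeProd, Finset.prod_ne_zero_iff]
  constructor
  · intro h i j hij
    by_contra hne
    rcases lt_or_gt_of_ne hne with h' | h'
    · exact h ⟨(i, j), h'⟩ (Finset.mem_univ _) (by simp [hij])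
    · exact h ⟨(j, i), h'⟩ (Finset.mem_univ _) (by simp [hij])
  · intro h p _
    exact sub_ne_zero.2 (h.ne p.2.ne')

/-- Where the coordinates are distinct, exactly one of them is the maximum; ties carry no mass
because `J` vanishes there. The `m + 1` cases contribute equally by symmetry. -/
theorem lintegral_iSup_mul {m : ℕ} {J : (Fin (m + 1) → ℝ) → ENNReal} (hJ : Measurable J)
    (hJs : ∀ x (σ : Equiv.Perm (Fin (m + 1))), J (x ∘ σ) = J x)
    (hJ0 : ∀ x, ¬ Function.Injective x → J x = 0) {h : ℝ → ENNReal} (hh : Measurable h) :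
    ∫⁻ x, h (⨆ i, x i) * J x = (m + 1 : ENNReal) * ∫⁻ u, h u *
      ∫⁻ y : Fin m → ℝ, (Set.univ.pi fun _ => Set.Iio u).indicator (fun y => J (Fin.cons u y)) y := by
  classical
  have hset : ∀ i : Fin (m + 1), MeasurableSet {x : Fin (m + 1) → ℝ | ∀ j, x (i.succAbove j) < x i} :=
    fun i => by
      rw [show {x : Fin (m + 1) → ℝ | ∀ j, x (i.succAbove j) < x i}
        = ⋂ j, {x | x (i.succAbove j) < x i} by ext; simp]
      exact MeasurableSet.iInter fun j =>
        measurableSet_lt (measurable_pi_apply _) (measurable_pi_apply _)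
  have h1 : ∀ x : Fin (m + 1) → ℝ, h (⨆ i, x i) * J x
      = ∑ i, {x : Fin (m + 1) → ℝ | ∀ j, x (i.succAbove j) < x i}.indicator
        (fun x => h (x i) * J x) x := by
    intro x
    by_cases hx : Function.Injective x
    · obtain ⟨i, hi⟩ := Finite.exists_max x
      have hmax : ⨆ k, x k = x i := le_antisymm (ciSup_le hi) (le_ciSup (Finite.bddAbove_range x) i)
      rw [Finset.sum_eq_single i, Set.indicator_of_mem, hmax]
      · intro j
        exact lt_of_le_of_ne (hi _) (hx.ne (Fin.succAbove_ne i j))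
      · intro k _ hk
        refine Set.indicator_of_notMem (fun hmem => ?_) _
        obtain ⟨j, hj⟩ := Fin.exists_succAbove_eq hk.symm
        have := hmem j
        rw [hj] at this
        exact absurd (hi k) (not_le.2 this)
      · simp
    · rw [hJ0 x hx, mul_zero]
      refine (Finset.sum_eq_zero fun i _ => ?_).symm
      rw [Set.indicator_apply, hJ0 x hx, mul_zero, ite_self]
  have h2 : ∀ i : Fin (m + 1), ∫⁻ x, {x : Fin (m + 1) → ℝ | ∀ j, x (i.succAbove j) < x i}.indicator
        (fun x => h (x i) * J x) x
      = ∫⁻ u, h u * ∫⁻ y : Fin m → ℝ,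
        (Set.univ.pi fun _ => Set.Iio u).indicator (fun y => J (Fin.cons u y)) y := by
    intro i
    have hcons : Measurable fun p : ℝ × (Fin m → ℝ) => (Fin.cons p.1 p.2 : Fin (m + 1) → ℝ) := by
      refine measurable_pi_lambda _ fun k => ?_
      refine Fin.cases ?_ (fun j => ?_) k
      · simpa using measurable_fst
      · simp only [Fin.cons_succ]
        exact (measurable_pi_apply j).comp measurable_snd
    have hset' : MeasurableSet {p : ℝ × (Fin m → ℝ) | ∀ j, p.2 j < p.1} := by
      rw [show {p : ℝ × (Fin m → ℝ) | ∀ j, p.2 j < p.1} = ⋂ j, {p | p.2 j < p.1} by ext; simp]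
      exact MeasurableSet.iInter fun j =>
        measurableSet_lt ((measurable_pi_apply j).comp measurable_snd) measurable_fst
    set G : ℝ × (Fin m → ℝ) → ENNReal := {p | ∀ j, p.2 j < p.1}.indicator
      (fun p => h p.1 * J (Fin.cons p.1 p.2)) with hG
    have hGm : Measurable G :=
      ((hh.comp measurable_fst).mul (hJ.comp hcons)).indicator hset'
    have hmp := volume_preserving_piFinSuccAbove (fun _ : Fin (m + 1) => ℝ) i
    have h3 : ∀ x, {x : Fin (m + 1) → ℝ | ∀ j, x (i.succAbove j) < x i}.indicator
        (fun x => h (x i) * J x) x = G (MeasurableEquiv.piFinSuccAbove (fun _ => ℝ) i x) := by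
      intro x
      have h4 : MeasurableEquiv.piFinSuccAbove (fun _ => ℝ) i x
          = (x i, fun j => x (i.succAbove j)) := rfl
      rw [h4, hG]
      by_cases hm : ∀ j, x (i.succAbove j) < x i
      · rw [Set.indicator_of_mem (by exact hm), Set.indicator_of_mem (by exact hm)]
        congr 1
        -- This permutation moves coordinate `i` to the front and keeps the order of the others.
        rw [← hJs x ((finSuccEquiv' 0).trans (finSuccEquiv' i).symm)]
        congr 1
        ext k
        refine Fin.cases ?_ (fun j => ?_) k
        · simp
        · rw [← Fin.succAbove_zero]
          simp [-Fin.succAbove_zero, -Fin.zero_succAbove]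
          simp
      · rw [Set.indicator_of_notMem (by exact hm), Set.indicator_of_notMem (by exact hm)]
    simp only [h3]
    rw [hmp.lintegral_comp hGm, Measure.volume_eq_prod, lintegral_prod _ hGm.aemeasurable]
    refine lintegral_congr fun u => ?_
    rw [← lintegral_const_mul]
    · refine lintegral_congr fun y => ?_
      simp only [hG, Set.indicator_apply, Set.mem_ofPred_eq, Set.mem_univ_pi, Set.mem_Iio]
      split_ifs <;> simp
    · exact ((hJ.comp (hcons.comp measurable_prodMk_left))).indicator
        (MeasurableSet.univ_pi fun _ => measurableSet_Iio)
  simp only [h1]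
  rw [lintegral_finsetSum _ fun i _ => ?_]
  · simp only [h2]
    simp
  · exact ((hh.comp (measurable_pi_apply i)).mul hJ).indicator (hset i)

end ExternalSource

namespace ExternalSource

open MeasureTheory Matrix Module Filter Topology

/-! ### The density of the largest eigenvalue -/

/-- The real factor of `restrictedP`. -/
noncomputable def restrictedWeight (β m : ℕ) (V : Polynomial ℝ) (u : ℝ) (x : Fin m → ℝ) : ℝ :=
  (∏ j, Real.exp (-((β : ℝ) / 2) * V.eval (x j)) * (u - x j) ^ β) *
    ∏ j, (Set.Iio u).indicator (fun _ => (1 : ℝ)) (x j)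

/-- The unnormalized joint density of the eigenvalues of the external source model. -/
noncomputable def eigDensity (β n : ℕ) (V : Polynomial ℝ) (a : ℝ) (x : Fin n → ℝ) : ℝ :=
  |vandermondeProd x| ^ β * (∏ j, Real.exp (-((β : ℝ) / 2) * n * V.eval (x j))) *
    sphericalAverage n β ((β : ℝ) / 2 * a * n) x

section Weights

variable {β m : ℕ} {V : Polynomial ℝ} {u : ℝ}

theorem prod_indicator_Iio (u : ℝ) (x : Fin m → ℝ) :
    ∏ j, (Set.Iio u).indicator (fun _ => (1 : ℝ)) (x j) = if ∀ j, x j < u then 1 else 0 := by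
  split_ifs with h
  · exact Finset.prod_eq_one fun j _ => by simp [h j]
  · push Not at h
    obtain ⟨j, hj⟩ := h
    exact Finset.prod_eq_zero (Finset.mem_univ j) (by simp [hj])

theorem restrictedWeight_of_lt {x : Fin m → ℝ} (h : ∀ j, x j < u) :
    restrictedWeight β m V u x = ∏ j, Real.exp (-((β : ℝ) / 2) * V.eval (x j)) * (u - x j) ^ β := by
  rw [restrictedWeight, prod_indicator_Iio, if_pos h, mul_one]

theorem restrictedWeight_of_not_lt {x : Fin m → ℝ} (h : ¬ ∀ j, x j < u) :
    restrictedWeight β m V u x = 0 := by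
  rw [restrictedWeight, prod_indicator_Iio, if_neg h, mul_zero]

theorem restrictedWeight_nonneg (x : Fin m → ℝ) : 0 ≤ restrictedWeight β m V u x := by
  by_cases h : ∀ j, x j < u
  · rw [restrictedWeight_of_lt h]
    exact Finset.prod_nonneg fun j _ => mul_nonneg (Real.exp_pos _).le
      (pow_nonneg (sub_nonneg.2 (h j).le) _)
  · rw [restrictedWeight_of_not_lt h]

theorem measurable_restrictedWeight_uncurry :
    Measurable fun p : ℝ × (Fin m → ℝ) => restrictedWeight β m V p.1 p.2 := by
  have hV := V.continuous.measurable
  have hs : ∀ j : Fin m, Measurable fun p : ℝ × (Fin m → ℝ) => p.2 j := fun j =>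
    (measurable_pi_apply j).comp measurable_snd
  unfold restrictedWeight
  refine Measurable.mul (Finset.measurable_fun_prod _ fun j _ => ?_)
    (Finset.measurable_fun_prod _ fun j _ => ?_)
  · have := hV.comp (hs j)
    exact (Real.measurable_exp.comp (measurable_const.mul this)).mul
      ((measurable_fst.sub (hs j)).pow_const β)
  · simp only [Set.indicator_apply, Set.mem_Iio]
    exact Measurable.ite (measurableSet_lt (hs j) measurable_fst) measurable_const measurable_const

theorem measurable_cons_uncurry :
    Measurable fun p : ℝ × (Fin m → ℝ) => (Fin.cons p.1 p.2 : Fin (m + 1) → ℝ) := by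
  refine measurable_pi_lambda _ fun k => ?_
  refine Fin.cases ?_ (fun j => ?_) k
  · simpa using measurable_fst
  · simp only [Fin.cons_succ]
    exact (measurable_pi_apply j).comp measurable_snd

theorem norm_cons_le (x : Fin m → ℝ) : ‖(Fin.cons u x : Fin (m + 1) → ℝ)‖ ≤ |u| + ‖x‖ := by
  refine (pi_norm_le_iff_of_nonneg (by positivity)).2 fun k => ?_
  refine Fin.cases ?_ (fun j => ?_) k
  · simp
  · simp only [Fin.cons_succ]
    exact (norm_le_pi_norm x j).trans (by linarith [abs_nonneg u])

/-- The Vandermonde product of `(u, x)` splits off `∏ |u - x_j|`. Of the potential `(m + 1) V(x_j)`,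
the part `m V(x_j)` goes into the `m`-particle ensemble and the remaining `V(x_j)` into the
restricted weight. -/
theorem indicator_eigDensity_cons {a : ℝ} (x : Fin m → ℝ) :
    (Set.univ.pi fun _ => Set.Iio u).indicator
      (fun y => ENNReal.ofReal (eigDensity β (m + 1) V a (Fin.cons u y))) x
      = ENNReal.ofReal (Real.exp (-((β : ℝ) / 2) * (m + 1 : ℕ) * V.eval u)) *
        (ENNReal.ofReal (restrictedWeight β m V u x *
          sphericalAverage (m + 1) β ((β : ℝ) / 2 * a * (m + 1 : ℕ)) (Fin.cons u x)) *
        ENNReal.ofReal (betaWeight β m V x)) := by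
  by_cases h : ∀ j, x j < u
  · rw [Set.indicator_of_mem (by simpa using h), restrictedWeight_of_lt h, eigDensity,
      ← ENNReal.ofReal_mul' (by unfold betaWeight; positivity),
      ← ENNReal.ofReal_mul (Real.exp_pos _).le, vandermondeProd_cons, betaWeight,
      ← vandermondeProd_eq]
    congr 1
    rw [Fin.prod_univ_succ, mul_pow, ← Finset.prod_pow, Finset.prod_mul_distrib]
    simp only [Fin.cons_zero, Fin.cons_succ]
    have h1 : ∏ j, Real.exp (-((β : ℝ) / 2) * (m + 1 : ℕ) * V.eval (x j))
        = (∏ j, Real.exp (-((β : ℝ) / 2) * V.eval (x j))) *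
          ∏ j, Real.exp (-((β : ℝ) / 2) * m * V.eval (x j)) := by
      rw [← Finset.prod_mul_distrib]
      refine Finset.prod_congr rfl fun j _ => ?_
      rw [← Real.exp_add]
      push_cast
      ring_nf
    have h2 : ∏ j, |u - x j| ^ β = ∏ j, (u - x j) ^ β :=
      Finset.prod_congr rfl fun j _ => by rw [abs_of_pos (sub_pos.2 (h j))]
    rw [h1, h2]
    ring
  · rw [Set.indicator_of_notMem (by simpa using h), restrictedWeight_of_not_lt h]
    simp

theorem restrictedP_eq (w : ℂ) (x : Fin m → ℝ) :
    restrictedP β m V u w x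
      = (restrictedWeight β m V u x : ℂ) * ∏ j, ((w - x j) ^ ((β : ℂ) / 2))⁻¹ := by
  have h : ∏ j, (Set.Iio u).indicator (fun _ => (1 : ℂ)) (x j)
      = ((∏ j, (Set.Iio u).indicator (fun _ => (1 : ℝ)) (x j) : ℝ) : ℂ) := by
    rw [Complex.ofReal_prod]
    refine Finset.prod_congr rfl fun j _ => ?_
    by_cases hj : x j ∈ Set.Iio u
    · rw [Set.indicator_of_mem hj, Set.indicator_of_mem hj, Complex.ofReal_one]
    · rw [Set.indicator_of_notMem hj, Set.indicator_of_notMem hj, Complex.ofReal_zero]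
  rw [restrictedP, restrictedWeight, h]
  simp only [div_eq_mul_inv, Finset.prod_mul_distrib]
  push_cast
  ring

/-- The factor `(w - u)^{-β/2}` belongs to the largest eigenvalue: it completes the product over `x`
to the product over all `m + 1` eigenvalues. -/
theorem restrictedP_mul_exp_div (c w : ℂ) (x : Fin m → ℝ) :
    restrictedP β m V u w x * Complex.exp (c * w) / (w - u) ^ ((β : ℂ) / 2)
      = (restrictedWeight β m V u x : ℂ) * (Complex.exp (c * w) *
        ∏ j, ((w - ((Fin.cons u x : Fin (m + 1) → ℝ) j : ℝ)) ^ ((β : ℂ) / 2))⁻¹) := by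
  rw [restrictedP_eq, Fin.prod_univ_succ]
  simp only [Fin.cons_zero, Fin.cons_succ]
  rw [div_eq_mul_inv]
  ring

theorem HankelContour.norm_cpow_inv_le {γ : ℝ → ℂ} (h : HankelContour γ u) (β : ℕ) :
    ∃ D : ℝ, 0 ≤ D ∧ ∀ t, ∀ q : ℝ, q ≤ u → ‖((γ t - q) ^ ((β : ℂ) / 2))⁻¹‖ ≤ D := by
  obtain ⟨δ, hδ, H⟩ := h.away
  refine ⟨(δ ^ ((β : ℝ) / 2))⁻¹, by positivity, fun t q hq => ?_⟩
  have : ((β : ℂ) / 2) = (((β : ℝ) / 2 : ℝ) : ℂ) := by push_cast; rfl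
  rw [norm_inv, this, Complex.norm_cpow_real]
  gcongr
  exact H t q hq

theorem HankelContour.norm_prod_cpow_inv_le {γ : ℝ → ℂ} {D : ℝ} (hD : 0 ≤ D)
    (h : ∀ t, ∀ q : ℝ, q ≤ u → ‖((γ t - q) ^ ((β : ℂ) / 2))⁻¹‖ ≤ D) {k : ℕ} {x : Fin k → ℝ}
    (hx : ∀ j, x j ≤ u) (t : ℝ) : ‖∏ j, ((γ t - x j) ^ ((β : ℂ) / 2))⁻¹‖ ≤ D ^ k := by
  rw [norm_prod]
  refine (Finset.prod_le_prod (fun j _ => norm_nonneg _) fun j _ => h t (x j) (hx j)).trans ?_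
  simp

end Weights

section Ensemble

variable {β m : ℕ} {V : Polynomial ℝ} (hdeg : Even V.natDegree) (hpos : 0 < V.natDegree)
  (hlead : 0 < V.leadingCoeff)

theorem measurable_betaWeight : Measurable (betaWeight β m V) := by
  unfold betaWeight
  have := V.continuous.measurable
  simp only [← vandermondeProd_eq]
  refine Measurable.mul (by fun_prop) (Finset.measurable_fun_prod _ fun j _ => by fun_prop)

theorem betaWeight_nonneg (x : Fin m → ℝ) : 0 ≤ betaWeight β m V x := by
  unfold betaWeight
  positivity

theorem polyGrowth_abs_vandermondeProd_pow {n β : ℕ} :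
    PolyGrowth fun x : Fin n → ℝ => |vandermondeProd x| ^ β :=
  polyGrowth_vandermondeProd.norm.pow β

theorem integrable_mul_betaWeight (hβ : 0 < β) (hdeg : Even V.natDegree) (hpos : 0 < V.natDegree)
    (hlead : 0 < V.leadingCoeff) {f g : (Fin m → ℝ) → ℝ} (hf : Measurable f) (hg : PolyGrowth g)
    (hgm : Measurable g) {r : ℝ} (hfg : ∀ x, ‖f x‖ ≤ ‖g x‖ * Real.exp (r * ‖x‖)) :
    Integrable fun x => f x * betaWeight β m V x := by
  -- For `m = 0` the rate `(β/2) m` is not positive, but the product is empty and any `κ` serves.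
  obtain ⟨κ, hκ, h⟩ : ∃ κ : ℝ, 0 < κ ∧ ∀ x : Fin m → ℝ,
      ∏ j, Real.exp (-((β : ℝ) / 2) * m * V.eval (x j)) = ∏ j, Real.exp (-κ * V.eval (x j)) := by
    rcases Nat.eq_zero_or_pos m with rfl | hm
    · exact ⟨1, one_pos, fun x => by simp⟩
    · exact ⟨(β : ℝ) / 2 * m, by positivity, fun x => by simp only [neg_mul]⟩
  have h1 := integrable_mul_prod_exp_eval hdeg hpos hlead hκ
    (f := fun x => f x * |vandermondeProd x| ^ β) (g := fun x => g x * |vandermondeProd x| ^ β)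
    (hf.mul (by fun_prop)) (hg.mul polyGrowth_abs_vandermondeProd_pow) (by fun_prop) (r := r)
    (fun x => by
      rw [norm_mul, norm_mul, mul_right_comm]
      gcongr
      exact hfg x)
  refine h1.congr (Eventually.of_forall fun x => ?_)
  simp only [betaWeight]
  rw [h, ← vandermondeProd_eq]
  ring

theorem integrable_betaWeight (hβ : 0 < β) (hdeg : Even V.natDegree) (hpos : 0 < V.natDegree)
    (hlead : 0 < V.leadingCoeff) : Integrable (betaWeight β m V) := by
  have h := integrable_mul_betaWeight (m := m) hβ hdeg hpos hlead (f := fun _ => 1)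
    (g := fun _ => 1) measurable_const (PolyGrowth.const 1) measurable_const (r := 0) (by simp)
  simpa using h

theorem measure_vandermondeProd_ne_zero_pos (n : ℕ) :
    0 < volume {x : Fin n → ℝ | vandermondeProd x ≠ 0} := by
  refine IsOpen.measure_pos volume ?_ ⟨fun i => (i : ℝ), ?_⟩
  · exact isOpen_ne_fun continuous_vandermondeProd continuous_const
  · exact vandermondeProd_ne_zero_iff.2 fun i j h => Fin.val_injective (Nat.cast_injective h)

theorem lintegral_betaWeight_ne_zero : ∫⁻ x, ENNReal.ofReal (betaWeight β m V x) ≠ 0 := by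
  rw [← pos_iff_ne_zero, lintegral_pos_iff_support measurable_betaWeight.ennreal_ofReal]
  refine (measure_vandermondeProd_ne_zero_pos m).trans_le (measure_mono fun x hx => ?_)
  rw [Set.mem_ofPred_eq] at hx
  rw [Function.mem_support, ← pos_iff_ne_zero, ENNReal.ofReal_pos, betaWeight,
    ← vandermondeProd_eq]
  positivity

theorem isProbabilityMeasure_betaEnsemble (hβ : 0 < β) (hdeg : Even V.natDegree)
    (hpos : 0 < V.natDegree) (hlead : 0 < V.leadingCoeff) :
    IsProbabilityMeasure (betaEnsemble β m V) := by
  constructor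
  rw [betaEnsemble, Measure.smul_apply, withDensity_apply _ MeasurableSet.univ,
    Measure.restrict_univ, smul_eq_mul]
  refine ENNReal.inv_mul_cancel lintegral_betaWeight_ne_zero ?_
  exact ((hasFiniteIntegral_iff_ofReal (Eventually.of_forall betaWeight_nonneg)).1
    (integrable_betaWeight hβ hdeg hpos hlead).2).ne

theorem integrable_betaEnsemble {f : (Fin m → ℝ) → ℝ}
    (hf : Integrable fun x => f x * betaWeight β m V x) : Integrable f (betaEnsemble β m V) :=
  (integrable_withDensity_ofReal measurable_betaWeight betaWeight_nonneg hf).smul_measure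
    (ENNReal.inv_ne_top.2 lintegral_betaWeight_ne_zero)

theorem lintegral_mul_betaWeight (hβ : 0 < β) (hdeg : Even V.natDegree)
    (hpos : 0 < V.natDegree) (hlead : 0 < V.leadingCoeff) {F : (Fin m → ℝ) → ENNReal}
    (hF : Measurable F) :
    ∫⁻ x, F x * ENNReal.ofReal (betaWeight β m V x)
      = (∫⁻ x, ENNReal.ofReal (betaWeight β m V x)) * ∫⁻ x, F x ∂betaEnsemble β m V := by
  have h1 : ∫⁻ x, ENNReal.ofReal (betaWeight β m V x) ≠ ⊤ :=
    ((hasFiniteIntegral_iff_ofReal (Eventually.of_forall betaWeight_nonneg)).1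
      (integrable_betaWeight hβ hdeg hpos hlead).2).ne
  rw [betaEnsemble, lintegral_smul_measure, smul_eq_mul, ← mul_assoc,
    ENNReal.mul_inv_cancel lintegral_betaWeight_ne_zero h1, one_mul,
    lintegral_withDensity_ofReal measurable_betaWeight hF]

/-- The restricted weight with an additional factor of exponential growth is integrable. -/
theorem integrable_restrictedWeight_mul (hβ : 0 < β) (hdeg : Even V.natDegree)
    (hpos : 0 < V.natDegree) (hlead : 0 < V.leadingCoeff) (u : ℝ) {k : (Fin m → ℝ) → ℝ}
    (hk : Measurable k) {C r : ℝ} (hkC : ∀ x, ‖k x‖ ≤ C * Real.exp (r * ‖x‖)) :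
    Integrable (fun x => restrictedWeight β m V u x * k x) (betaEnsemble β m V) := by
  obtain ⟨δ, b, hδ, hb⟩ := exists_quadratic_le_eval hdeg hpos hlead
  have hR : Measurable (restrictedWeight β m V u) :=
    measurable_restrictedWeight_uncurry.comp measurable_prodMk_left
  have hg : PolyGrowth fun x : Fin m → ℝ => C * ∏ j, (Real.exp ((β : ℝ) / 2 * b) * (u - x j) ^ β) := by
    refine (PolyGrowth.const C).mul (PolyGrowth.prod _ fun j _ => (PolyGrowth.const _).mul
      (PolyGrowth.pow ?_ β))
    refine ((PolyGrowth.const u).add ((PolyGrowth.const (-1)).mul (polyGrowth_apply j))).mono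
      fun x => le_of_eq ?_
    congr 1
    ring
  refine integrable_betaEnsemble (integrable_mul_betaWeight hβ hdeg hpos hlead (hR.mul hk) hg
    (by fun_prop) (r := r) fun x => ?_)
  have h1 : ‖restrictedWeight β m V u x‖
      ≤ ‖∏ j, (Real.exp ((β : ℝ) / 2 * b) * (u - x j) ^ β)‖ := by
    by_cases h : ∀ j, x j < u
    · rw [restrictedWeight_of_lt h, norm_prod, norm_prod]
      refine Finset.prod_le_prod (fun j _ => norm_nonneg _) fun j _ => ?_
      rw [norm_mul, norm_mul, Real.norm_of_nonneg (Real.exp_pos _).le,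
        Real.norm_of_nonneg (Real.exp_pos _).le]
      gcongr ?_ * _
      rw [Real.exp_le_exp]
      have h2 : -b ≤ V.eval (x j) := by
        have := hb (x j)
        nlinarith [sq_nonneg (x j)]
      have h3 := mul_le_mul_of_nonneg_left h2 (by positivity : (0 : ℝ) ≤ (β : ℝ) / 2)
      linarith
    · rw [restrictedWeight_of_not_lt h, norm_zero]
      exact norm_nonneg _
  have hC0 : 0 ≤ C * Real.exp (r * ‖x‖) := (norm_nonneg _).trans (hkC x)
  calc ‖restrictedWeight β m V u x * k x‖
      ≤ ‖∏ j, (Real.exp ((β : ℝ) / 2 * b) * (u - x j) ^ β)‖ * (C * Real.exp (r * ‖x‖)) := by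
        rw [norm_mul]
        gcongr
        exact hkC x
    _ ≤ ‖∏ j, (Real.exp ((β : ℝ) / 2 * b) * (u - x j) ^ β)‖ * (‖C‖ * Real.exp (r * ‖x‖)) := by
        gcongr
        exact Real.le_norm_self C
    _ = _ := by rw [norm_mul]; ring

end Ensemble

end ExternalSource

/-! ### Splitting off the largest eigenvalue and the contour formula. -/

namespace ExternalSource

open MeasureTheory Matrix Module Filter Topology

section Density

variable {β m : ℕ} {V : Polynomial ℝ} {a : ℝ}

/-- The unnormalized density of the largest eigenvalue. -/
noncomputable def maxDensity (β m : ℕ) (V : Polynomial ℝ) (a u : ℝ) : ℝ :=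
  Real.exp (-((β : ℝ) / 2) * (m + 1 : ℕ) * V.eval u) *
    ∫ x, restrictedWeight β m V u x *
      sphericalAverage (m + 1) β ((β : ℝ) / 2 * a * (m + 1 : ℕ)) (Fin.cons u x) ∂betaEnsemble β m V

theorem measurable_restrictedWeight_mul_sphericalAverage :
    Measurable fun p : ℝ × (Fin m → ℝ) => restrictedWeight β m V p.1 p.2 *
      sphericalAverage (m + 1) β ((β : ℝ) / 2 * a * (m + 1 : ℕ)) (Fin.cons p.1 p.2) :=
  measurable_restrictedWeight_uncurry.mul
    ((measurable_sphericalAverage _).comp measurable_cons_uncurry)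

theorem maxDensity_nonneg [NeZero β] (ha : 0 < a) (u : ℝ) : 0 ≤ maxDensity β m V a u :=
  mul_nonneg (Real.exp_pos _).le (integral_nonneg fun x =>
    mul_nonneg (restrictedWeight_nonneg x) (sphericalAverage_pos (by positivity) _).le)

theorem measurable_maxDensity (hβ : 0 < β) (hdeg : Even V.natDegree) (hpos : 0 < V.natDegree)
    (hlead : 0 < V.leadingCoeff) : Measurable (maxDensity β m V a) := by
  have := isProbabilityMeasure_betaEnsemble (m := m) hβ hdeg hpos hlead
  have hV := V.continuous.measurable
  unfold maxDensity
  refine Measurable.mul (by fun_prop) ?_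
  exact (measurable_restrictedWeight_mul_sphericalAverage.stronglyMeasurable.integral_prod_right
    (ν := betaEnsemble β m V)).measurable

theorem integrable_restrictedWeight_mul_sphericalAverage (hβ : 0 < β) (ha : 0 < a)
    (hdeg : Even V.natDegree) (hpos : 0 < V.natDegree) (hlead : 0 < V.leadingCoeff) (u : ℝ) :
    Integrable (fun x => restrictedWeight β m V u x *
      sphericalAverage (m + 1) β ((β : ℝ) / 2 * a * (m + 1 : ℕ)) (Fin.cons u x))
      (betaEnsemble β m V) := by
  have : NeZero β := ⟨hβ.ne'⟩
  set c := (β : ℝ) / 2 * a * (m + 1 : ℕ) with hc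
  have hc0 : 0 ≤ c := by positivity
  refine integrable_restrictedWeight_mul hβ hdeg hpos hlead u
    ((measurable_sphericalAverage _).comp (measurable_cons_uncurry.comp measurable_prodMk_left))
    (C := (gauss (Fin (m + 1) × Fin β)).real Set.univ * Real.exp (c * |u|)) (r := c) fun x => ?_
  rw [Real.norm_of_nonneg (sphericalAverage_pos hc0 _).le]
  refine (sphericalAverage_le hc0 _).trans ?_
  rw [mul_assoc ((gauss _).real _), ← Real.exp_add, ← mul_add]
  gcongr
  exact norm_cons_le x

/-- This evaluates the inner integral produced by `lintegral_iSup_mul`. The factor in front undoes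
the normalization of the `m`-particle ensemble. -/
theorem ofReal_maxDensity (hβ : 0 < β) (ha : 0 < a) (hdeg : Even V.natDegree)
    (hpos : 0 < V.natDegree) (hlead : 0 < V.leadingCoeff) (u : ℝ) :
    ∫⁻ y : Fin m → ℝ, (Set.univ.pi fun _ => Set.Iio u).indicator
      (fun y => ENNReal.ofReal (eigDensity β (m + 1) V a (Fin.cons u y))) y
      = (∫⁻ x, ENNReal.ofReal (betaWeight β m V x)) * ENNReal.ofReal (maxDensity β m V a u) := by
  have : NeZero β := ⟨hβ.ne'⟩
  have hm := measurable_restrictedWeight_mul_sphericalAverage (β := β) (m := m) (V := V) (a := a)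
  have hmu : Measurable fun x : Fin m → ℝ => ENNReal.ofReal (restrictedWeight β m V u x *
      sphericalAverage (m + 1) β ((β : ℝ) / 2 * a * (m + 1 : ℕ)) (Fin.cons u x)) :=
    (hm.comp measurable_prodMk_left).ennreal_ofReal
  simp only [indicator_eigDensity_cons]
  rw [lintegral_const_mul _ (by exact hmu.mul measurable_betaWeight.ennreal_ofReal),
    lintegral_mul_betaWeight hβ hdeg hpos hlead hmu, maxDensity,
    ENNReal.ofReal_mul (Real.exp_pos _).le, ofReal_integral_eq_lintegral_ofReal
      (integrable_restrictedWeight_mul_sphericalAverage hβ ha hdeg hpos hlead u)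
      (Eventually.of_forall fun x => mul_nonneg (restrictedWeight_nonneg x)
        (sphericalAverage_pos (by positivity) _).le)]
  ring

theorem measurable_eigDensity {n : ℕ} : Measurable (eigDensity β n V a) := by
  have hV := V.continuous.measurable
  have := measurable_sphericalAverage (n := n) (β := β) ((β : ℝ) / 2 * a * n)
  unfold eigDensity
  refine Measurable.mul (Measurable.mul (by fun_prop)
    (Finset.measurable_fun_prod _ fun j _ => by fun_prop)) this

theorem eigDensity_comp_perm {N : ℕ} (hβ : 0 < β) (hN : (m + 1) * β = 2 * (N + 1)) (ha : 0 < a)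
    (x : Fin (m + 1) → ℝ) (σ : Equiv.Perm (Fin (m + 1))) :
    eigDensity β (m + 1) V a (x ∘ σ) = eigDensity β (m + 1) V a x := by
  have : NeZero β := ⟨hβ.ne'⟩
  rw [eigDensity, eigDensity, abs_vandermondeProd_comp_perm,
    sphericalAverage_comp_perm hN (by positivity)]
  congr 2
  exact Equiv.prod_comp σ fun j => Real.exp (-((β : ℝ) / 2) * (m + 1 : ℕ) * V.eval (x j))

theorem lintegral_iSup_mul_eigDensity {N : ℕ} (hβ : 0 < β) (hN : (m + 1) * β = 2 * (N + 1))
    (ha : 0 < a) (hdeg : Even V.natDegree) (hpos : 0 < V.natDegree) (hlead : 0 < V.leadingCoeff)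
    {h : ℝ → ENNReal} (hh : Measurable h) :
    ∫⁻ x, h (⨆ i, x i) * ENNReal.ofReal (eigDensity β (m + 1) V a x)
      = (m + 1 : ENNReal) * (∫⁻ x, ENNReal.ofReal (betaWeight β m V x)) *
        ∫⁻ u, h u * ENNReal.ofReal (maxDensity β m V a u) := by
  rw [lintegral_iSup_mul measurable_eigDensity.ennreal_ofReal
    (fun x σ => by rw [eigDensity_comp_perm hβ hN ha]) (fun x hx => ?_) hh]
  · have hf := (measurable_maxDensity (m := m) (a := a) hβ hdeg hpos hlead).ennreal_ofReal
    have h1 : ∀ u, h u * ∫⁻ y : Fin m → ℝ, (Set.univ.pi fun _ => Set.Iio u).indicator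
        (fun y => ENNReal.ofReal (eigDensity β (m + 1) V a (Fin.cons u y))) y
        = (∫⁻ x, ENNReal.ofReal (betaWeight β m V x)) *
          (h u * ENNReal.ofReal (maxDensity β m V a u)) := fun u => by
      rw [ofReal_maxDensity hβ ha hdeg hpos hlead]
      ring
    simp only [h1]
    rw [lintegral_const_mul _ (by exact hh.mul hf), mul_assoc]
  · have h0 : vandermondeProd x = 0 := not_not.1 (mt vandermondeProd_ne_zero_iff.1 hx)
    rw [eigDensity, h0]
    simp [hβ.ne']

theorem lintegral_eigDensity_ne_zero (hβ : 0 < β) (ha : 0 < a) :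
    ∫⁻ x, ENNReal.ofReal (eigDensity β (m + 1) V a x) ≠ 0 := by
  have : NeZero β := ⟨hβ.ne'⟩
  rw [← pos_iff_ne_zero, lintegral_pos_iff_support measurable_eigDensity.ennreal_ofReal]
  refine (measure_vandermondeProd_ne_zero_pos (m + 1)).trans_le (measure_mono fun x hx => ?_)
  rw [Set.mem_ofPred_eq] at hx
  rw [Function.mem_support, ← pos_iff_ne_zero, ENNReal.ofReal_pos, eigDensity]
  have := sphericalAverage_pos (n := m + 1) (β := β)
    (by positivity : 0 ≤ (β : ℝ) / 2 * a * (m + 1 : ℕ)) x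
  positivity

theorem lintegral_eigDensity_ne_top (hβ : 0 < β) (ha : 0 < a) (hdeg : Even V.natDegree)
    (hpos : 0 < V.natDegree) (hlead : 0 < V.leadingCoeff) :
    ∫⁻ x, ENNReal.ofReal (eigDensity β (m + 1) V a x) ≠ ⊤ := by
  have : NeZero β := ⟨hβ.ne'⟩
  set c := (β : ℝ) / 2 * a * (m + 1 : ℕ) with hc
  have hc0 : 0 ≤ c := by positivity
  have hs := measurable_sphericalAverage (n := m + 1) (β := β) c
  have h1 := integrable_mul_prod_exp_eval (k := m + 1) hdeg hpos hlead
    (κ := (β : ℝ) / 2 * (m + 1 : ℕ)) (by positivity)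
    (f := fun x => |vandermondeProd x| ^ β * sphericalAverage (m + 1) β c x)
    (g := fun x => |vandermondeProd x| ^ β * (gauss (Fin (m + 1) × Fin β)).real Set.univ)
    (by fun_prop) (polyGrowth_abs_vandermondeProd_pow.mul (PolyGrowth.const _)) (by fun_prop)
    (r := c) (fun x => by
      rw [norm_mul, norm_mul, mul_assoc, Real.norm_of_nonneg (sphericalAverage_pos hc0 _).le,
        Real.norm_of_nonneg (measureReal_nonneg (μ := gauss (Fin (m + 1) × Fin β)))]
      gcongr
      exact sphericalAverage_le hc0 x)
  have h2 : Integrable (eigDensity β (m + 1) V a) := by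
    refine h1.congr (Eventually.of_forall fun x => ?_)
    simp only [eigDensity, neg_mul]
    ring
  refine ((hasFiniteIntegral_iff_ofReal (Eventually.of_forall fun x => ?_)).1 h2.2).ne
  exact mul_nonneg (by positivity) (sphericalAverage_pos hc0 x).le

/-- The contour integral formula for the density of the largest eigenvalue. -/
theorem formulaAlong_maxDensity {N : ℕ} (hβ : 0 < β) (hN : (m + 1) * β = 2 * (N + 1)) (ha : 0 < a)
    (hdeg : Even V.natDegree) (hpos : 0 < V.natDegree) (hlead : 0 < V.leadingCoeff) (s : ℝ)
    {γ : ℝ → ℂ} {u : ℝ} (h : HankelContour γ u) :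
    FormulaAlong β (m + 1) V a (fun u => s * maxDensity β m V a u)
      (s / (((β : ℝ) / 2 * a * (m + 1 : ℕ)) ^ N / N.factorial /
        (Real.pi ^ ((β : ℝ) / 2)) ^ (m + 1))) u γ := by
  have : NeZero β := ⟨hβ.ne'⟩
  set c := (β : ℝ) / 2 * a * (m + 1 : ℕ) with hc
  have hc0 : 0 < c := by positivity
  -- `D` is the constant in front of the spherical average in
  -- `HankelContour.integral_exp_mul_prod_cpow`; the constant of the contour formula is `s / D`.
  set D := c ^ N / N.factorial / (Real.pi ^ ((β : ℝ) / 2)) ^ (m + 1) with hD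
  have hD0 : 0 < D := by positivity
  have hprob := isProbabilityMeasure_betaEnsemble (m := m) hβ hdeg hpos hlead
  obtain ⟨B, hB, hBq⟩ := h.norm_cpow_inv_le β
  have hR : Measurable (restrictedWeight β m V u) :=
    measurable_restrictedWeight_uncurry.comp measurable_prodMk_left
  have hRi : Integrable (restrictedWeight β m V u) (betaEnsemble β m V) := by
    have := integrable_restrictedWeight_mul hβ hdeg hpos hlead u (k := fun _ : Fin m → ℝ => 1)
      measurable_const (C := 1) (r := 0) (by simp)
    simpa using this
  have hγ := h.continuous.measurable
  have hmain := h.integral_integral hc0 (ν := betaEnsemble β m V)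
    (k := fun w x => (restrictedWeight β m V u x : ℂ) * (Complex.exp (c * w) *
        ∏ j, ((w - ((Fin.cons u x : Fin (m + 1) → ℝ) j : ℝ)) ^ ((β : ℂ) / 2))⁻¹))
    (b := fun x => restrictedWeight β m V u x * B ^ (m + 1)) ?_ (hRi.mul_const _)
    (Eventually.of_forall fun x t => ?_)
  · have hint : ∀ w : ℂ, integrand β (m + 1) V a u w
        = ∫ x, (restrictedWeight β m V u x : ℂ) * (Complex.exp (c * w) *
        ∏ j, ((w - ((Fin.cons u x : Fin (m + 1) → ℝ) j : ℝ)) ^ ((β : ℂ) / 2))⁻¹)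
          ∂betaEnsemble β m V := by
      intro w
      have hcc : (β : ℂ) / 2 * a * (m + 1 : ℕ) = c := by rw [hc]; push_cast; rfl
      rw [integrand, hcc, Nat.add_sub_cancel, Z, ← integral_mul_const, ← integral_div]
      simp only [restrictedP_mul_exp_div]
    refine ⟨fun t => ?_, ?_, ?_⟩
    · rw [Nat.add_sub_cancel]
      refine (hRi.mul_const (B ^ m)).mono' ?_ (Eventually.of_forall fun x => ?_)
      · refine Measurable.aestronglyMeasurable ?_
        rw [funext (restrictedP_eq (V := V) (u := u) (β := β) (γ t))]
        exact (Complex.measurable_ofReal.comp hR).mul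
          (Finset.measurable_fun_prod _ fun j _ => by fun_prop)
      · rw [restrictedP_eq, norm_mul, Complex.norm_real,
          Real.norm_of_nonneg (restrictedWeight_nonneg x)]
        by_cases hx : ∀ j, x j < u
        · exact mul_le_mul_of_nonneg_left (HankelContour.norm_prod_cpow_inv_le hB hBq
            (fun j => (hx j).le) t) (restrictedWeight_nonneg x)
        · simp [restrictedWeight_of_not_lt hx]
    · simp only [hint]
      exact hmain.1
    · simp only [hint]
      rw [hmain.2]
      -- If some `x j ≥ u`, the restricted weight makes both sides vanish. Otherwise all entries of
      -- `(u, x)` are at most `u` and the contour formula for the product applies.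
      have hinner : ∀ x : Fin m → ℝ, ∫ t, (restrictedWeight β m V u x : ℂ) *
          (Complex.exp (c * γ t) * ∏ j, ((γ t - ((Fin.cons u x : Fin (m + 1) → ℝ) j : ℝ)) ^
            ((β : ℂ) / 2))⁻¹) * deriv γ t
          = 2 * Real.pi * Complex.I * D *
            ((restrictedWeight β m V u x * sphericalAverage (m + 1) β c (Fin.cons u x) : ℝ) : ℂ) := by
        intro x
        by_cases hx : ∀ j, x j < u
        · have hX : ∀ j, (Fin.cons u x : Fin (m + 1) → ℝ) j ≤ u := fun j => by
            refine Fin.cases ?_ (fun i => ?_) j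
            · simp
            · simpa using (hx i).le
          have h1 := h.integral_exp_mul_prod_cpow hc0 hN hX
          simp only [mul_assoc] at h1 ⊢
          rw [integral_const_mul, h1, ← hD]
          push_cast
          ring
        · simp [restrictedWeight_of_not_lt hx]
      simp only [hinner]
      rw [integral_const_mul, integral_complex_ofReal, maxDensity, ← hc]
      have hpi : (2 * Real.pi * Complex.I : ℂ) ≠ 0 := Complex.two_pi_I_ne_zero
      have hDc : (D : ℂ) ≠ 0 := Complex.ofReal_ne_zero.2 hD0.ne'
      push_cast
      field_simp
  · refine Measurable.mul (Complex.measurable_ofReal.comp (hR.comp measurable_snd))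
      (Measurable.mul (by fun_prop) (Finset.measurable_fun_prod _ fun j _ => ?_))
    have h2 : Measurable fun p : ℝ × (Fin m → ℝ) => (Fin.cons u p.2 : Fin (m + 1) → ℝ) j :=
      (measurable_pi_apply j).comp (measurable_cons_uncurry.comp
        (measurable_prodMk_left.comp measurable_snd))
    have h3 := (hγ.comp measurable_fst).sub (Complex.measurable_ofReal.comp h2)
    exact (h3.pow_const _).inv
  · rw [norm_mul, norm_mul, Complex.norm_real, Real.norm_of_nonneg (restrictedWeight_nonneg x)]
    by_cases hx : ∀ j, x j < u
    · rw [mul_assoc, mul_comm (B ^ (m + 1))]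
      refine mul_le_mul_of_nonneg_left (mul_le_mul_of_nonneg_left ?_ (norm_nonneg _))
        (restrictedWeight_nonneg x)
      refine HankelContour.norm_prod_cpow_inv_le hB hBq (fun j => ?_) t
      refine Fin.cases ?_ (fun i => ?_) j
      · simp
      · simpa using (hx i).le
    · simp [restrictedWeight_of_not_lt hx]

/-- The largest eigenvalue has a density given by the contour formula, as soon as the joint
density of the eigenvalues is known. -/
theorem exists_density_iSup {N : ℕ} (hβ : 0 < β) (hN : (m + 1) * β = 2 * (N + 1)) (ha : 0 < a)
    (hdeg : Even V.natDegree) (hpos : 0 < V.natDegree) (hlead : 0 < V.leadingCoeff) :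
    ∃ f : ℝ → ℝ, Measurable f ∧ (∀ u, 0 ≤ f u) ∧ HasContourFormula β (m + 1) V a f ∧
      ∀ h : ℝ → ENNReal, Measurable h →
        (∫⁻ x, ENNReal.ofReal (eigDensity β (m + 1) V a x))⁻¹ *
          ∫⁻ x, h (⨆ i, x i) * ENNReal.ofReal (eigDensity β (m + 1) V a x)
        = ∫⁻ u, h u * ENNReal.ofReal (f u) := by
  have : NeZero β := ⟨hβ.ne'⟩
  set I := ∫⁻ x, ENNReal.ofReal (eigDensity β (m + 1) V a x) with hI
  set κ : ENNReal := (m + 1 : ENNReal) * ∫⁻ x, ENNReal.ofReal (betaWeight β m V x) with hκ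
  have hI0 : I ≠ 0 := lintegral_eigDensity_ne_zero hβ ha
  have hκt : κ ≠ ⊤ := by
    refine ENNReal.mul_ne_top (by simp) ?_
    exact ((hasFiniteIntegral_iff_ofReal (Eventually.of_forall betaWeight_nonneg)).1
      (integrable_betaWeight hβ hdeg hpos hlead).2).ne
  have hs : I⁻¹ * κ ≠ ⊤ := ENNReal.mul_ne_top (ENNReal.inv_ne_top.2 hI0) hκt
  have hm := measurable_maxDensity (m := m) (a := a) hβ hdeg hpos hlead
  -- The factor `I⁻¹ κ` normalizes the density. It depends neither on `u` nor on the contour, so one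
  -- constant serves all cases.
  refine ⟨fun u => (I⁻¹ * κ).toReal * maxDensity β m V a u, hm.const_mul _,
    fun u => mul_nonneg ENNReal.toReal_nonneg (maxDensity_nonneg ha u), ⟨?_, _, fun u x hux =>
      ⟨fun s₁ s₂ h₁ _ h₂ => formulaAlong_maxDensity hβ hN ha hdeg hpos hlead _
        (hankelContour_sigmaContour hux h₁ h₂),
      fun s h₁ => formulaAlong_maxDensity hβ hN ha hdeg hpos hlead _
        (hankelContour_piContour hux h₁)⟩⟩, fun h hh => ?_⟩
  · exact isProbabilityMeasure_betaEnsemble hβ hdeg hpos hlead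
  · rw [lintegral_iSup_mul_eigDensity hβ hN ha hdeg hpos hlead hh, ← mul_assoc, ← hκ,
      ← lintegral_const_mul _ (by exact hh.mul hm.ennreal_ofReal)]
    refine lintegral_congr fun u => ?_
    rw [ENNReal.ofReal_mul ENNReal.toReal_nonneg, ENNReal.ofReal_toReal hs]
    ring

end Density

end ExternalSource

namespace ExternalSource

open MeasureTheory Matrix Module Filter Topology

/-! ### From coordinates to matrix models -/

namespace HurwitzFrame

variable {F : Type} [NormedDivisionRing F] [NormedAlgebra ℝ F] [StarRing F] [StarModule ℝ F]
  {β : ℕ} (H : HurwitzFrame F β) {m : ℕ} {V : Polynomial ℝ} {a : ℝ}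

/-- The density of the external source model in terms of eigenvalues and the first diagonal
entry. -/
noncomputable def coordWeight [NeZero β] (V : Polynomial ℝ) (a : ℝ) (c : HermCoord (m + 1) β) : ℝ :=
  Real.exp (-((β : ℝ) / 2) * (m + 1 : ℕ) * ∑ j, V.eval (H.eig c j) +
    (β : ℝ) / 2 * a * (m + 1 : ℕ) * c.1 0)

theorem measurable_coordWeight [NeZero β] :
    Measurable (H.coordWeight V a : HermCoord (m + 1) β → ℝ) := by
  have h1 := H.measurable_eig (n := m + 1)
  have hV := V.continuous.measurable
  unfold coordWeight
  refine Real.measurable_exp.comp (Measurable.add (Measurable.const_mul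
    (Finset.measurable_fun_sum _ fun j _ => hV.comp ((measurable_pi_apply j).comp h1)) _) ?_)
  exact (((measurable_pi_apply (0 : Fin (m + 1))).comp measurable_fst)).const_mul _

theorem measurable_iSup_eig [NeZero β] :
    Measurable fun c : HermCoord (m + 1) β => ⨆ i, H.eig c i :=
  Measurable.iSup fun i => (measurable_pi_apply i).comp H.measurable_eig

/-- Averages over coordinates of functions of the largest eigenvalue reduce to the joint density
of the eigenvalues. -/
theorem exists_lintegral_coordWeight [NeZero β] {N : ℕ} (hN : (m + 1) * β = 2 * (N + 1))
    (ha : 0 < a) :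
    ∃ K : ENNReal, K ≠ 0 ∧ K ≠ ⊤ ∧ ∀ h : ℝ → ENNReal, Measurable h →
      ∫⁻ c : HermCoord (m + 1) β, h (⨆ i, H.eig c i) * ENNReal.ofReal (H.coordWeight V a c)
        = K * ∫⁻ x, h (⨆ i, x i) * ENNReal.ofReal (eigDensity β (m + 1) V a x) := by
  have hβ : 0 < β := Nat.pos_of_ne_zero (NeZero.ne β)
  have hγ : 0 < (β : ℝ) / 2 * a * (m + 1 : ℕ) := by positivity
  obtain ⟨κ, hκ0, hκt, hκ⟩ := H.exists_lintegral_eig (n := m + 1)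
  have hV := V.continuous.measurable
  have hsup : Measurable fun x : Fin (m + 1) → ℝ => ⨆ i, x i :=
    Measurable.iSup fun i => measurable_pi_apply i
  have hsa := measurable_sphericalAverage (n := m + 1) (β := β) ((β : ℝ) / 2 * a * (m + 1 : ℕ))
  set g := gauss (Fin (m + 1) × Fin β) Set.univ with hg
  have hg0 : g ≠ 0 := gauss_univ_ne_zero
  have hgt : g ≠ ⊤ := measure_ne_top _ _
  refine ⟨g⁻¹ * κ, mul_ne_zero (ENNReal.inv_ne_zero.2 hgt) hκ0,
    ENNReal.mul_ne_top (ENNReal.inv_ne_top.2 hg0) hκt, fun h hh => ?_⟩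
  set P : (Fin (m + 1) → ℝ) → ℝ := fun x =>
    ∏ j, Real.exp (-((β : ℝ) / 2) * (m + 1 : ℕ) * V.eval (x j)) with hP
  have hP0 : ∀ x, 0 ≤ P x := fun x => Finset.prod_nonneg fun j _ => (Real.exp_pos _).le
  have hPm : Measurable P := Finset.measurable_fun_prod _ fun j _ =>
    Real.measurable_exp.comp ((hV.comp (measurable_pi_apply j)).const_mul _)
  have hΦ : Measurable fun x : Fin (m + 1) → ℝ => h (⨆ i, x i) * ENNReal.ofReal (P x) :=
    (hh.comp hsup).mul hPm.ennreal_ofReal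
  -- The source couples only to the first diagonal entry. Averaging its exponential over directions
  -- yields the spherical average, and Weyl's formula then passes to eigenvalues.
  have h1 := H.lintegral_eig_mul_diag (0 : Fin (m + 1)) hΦ
    (g := fun t => ENNReal.ofReal (Real.exp ((β : ℝ) / 2 * a * (m + 1 : ℕ) * t))) (by fun_prop)
  simp only [lintegral_exp_mul_rayleigh hγ.le] at h1
  rw [hκ (fun x => h (⨆ i, x i) * ENNReal.ofReal (P x) *
    ENNReal.ofReal (sphericalAverage (m + 1) β ((β : ℝ) / 2 * a * (m + 1 : ℕ)) x))
    (hΦ.mul hsa.ennreal_ofReal) fun x σ => ?_] at h1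
  · rw [mul_assoc, ← ENNReal.mul_left_inj hg0 hgt, mul_comm _ g, mul_comm _ g, ← mul_assoc,
      ← mul_assoc, ENNReal.mul_inv_cancel hg0 hgt, one_mul]
    convert h1 using 2
    · refine lintegral_congr fun c => ?_
      rw [mul_assoc, ← ENNReal.ofReal_mul (hP0 _), hP, coordWeight]
      simp only
      rw [Real.exp_add, Finset.mul_sum, Real.exp_sum]
    · refine lintegral_congr fun x => ?_
      rw [mul_assoc, mul_assoc, ← ENNReal.ofReal_mul (sphericalAverage_pos hγ.le _).le,
        ← ENNReal.ofReal_mul (hP0 _), eigDensity]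
      congr 2
      simp only [hP]
      ring
  · rw [sphericalAverage_comp_perm hN hγ]
    congr 2
    · exact congrArg h (σ.iSup_comp (g := x))
    · exact congrArg _ (Equiv.prod_comp σ fun j =>
        Real.exp (-((β : ℝ) / 2) * (m + 1 : ℕ) * V.eval (x j)))

end HurwitzFrame

theorem model_map {Ω ι 𝕜 : Type} [MeasurableSpace Ω] [Fintype ι] [DecidableEq ι] [RCLike 𝕜]
    [MeasurableSpace 𝕜] {Ψ : Ω → Matrix ι ι 𝕜} (hΨ : MeasurableEmbedding Ψ) (μ : Measure Ω) (n : ℕ)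
    (W : Polynomial ℝ) (A : Matrix ι ι 𝕜) :
    model (μ.map Ψ) n W A = ((∫⁻ c, ENNReal.ofReal (weight n W A (Ψ c)) ∂μ)⁻¹ •
      μ.withDensity fun c => ENNReal.ofReal (weight n W A (Ψ c))).map Ψ := by
  rw [model, hΨ.lintegral_map, Measure.map_smul]
  congr 1
  ext s hs
  rw [withDensity_apply _ hs, hΨ.restrict_map, hΨ.lintegral_map, hΨ.map_apply,
    withDensity_apply _ (hΨ.measurable hs)]

theorem isLargestEigenvaluePDF_of_map {ι 𝕜 : Type} [Fintype ι] [DecidableEq ι] [RCLike 𝕜]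
    [MeasurableSpace 𝕜] {P : Measure (Matrix ι ι 𝕜)} {f : ℝ → ℝ} (hP : IsProbabilityMeasure P)
    (hm : AEMeasurable largestEigenvalue P) (hf : Measurable f) (hf0 : ∀ u, 0 ≤ f u)
    (h : P.map largestEigenvalue = volume.withDensity fun u => ENNReal.ofReal (f u)) :
    IsLargestEigenvaluePDF P f := by
  refine ⟨hP, hasPDF_of_map_eq_withDensity hm _ hf.ennreal_ofReal.aemeasurable h, hf0, ?_⟩
  rw [pdf_def, h]
  exact Measure.rnDeriv_withDensity _ hf.ennreal_ofReal

/-- The contour formula for a matrix model whose density and largest eigenvalue are known in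
coordinates. -/
theorem HurwitzFrame.exists_pdf_model {F ι 𝕜 : Type} [NormedDivisionRing F] [NormedAlgebra ℝ F]
    [StarRing F] [StarModule ℝ F] {β m N : ℕ} [NeZero β] (H : HurwitzFrame F β) [Fintype ι]
    [DecidableEq ι] [RCLike 𝕜] [MeasurableSpace 𝕜] {V W : Polynomial ℝ} {a : ℝ}
    (hN : (m + 1) * β = 2 * (N + 1)) (ha : 0 < a)
    (hdeg : Even V.natDegree) (hpos : 0 < V.natDegree) (hlead : 0 < V.leadingCoeff)
    {A : Matrix ι ι 𝕜} {Ψ : HermCoord (m + 1) β → Matrix ι ι 𝕜} (hΨ : MeasurableEmbedding Ψ)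
    (hw : ∀ c, weight (m + 1) W A (Ψ c) = H.coordWeight V a c)
    (hmax : ∀ c, largestEigenvalue (Ψ c) = ⨆ i, H.eig c i) :
    ∃ f : ℝ → ℝ, IsLargestEigenvaluePDF (model (volume.map Ψ) (m + 1) W A) f ∧
      HasContourFormula β (m + 1) V a f := by
  have hβ : 0 < β := Nat.pos_of_ne_zero (NeZero.ne β)
  obtain ⟨f, hf, hf0, hcf, hI⟩ := exists_density_iSup hβ hN ha hdeg hpos hlead
  obtain ⟨K, hK0, hKt, hK⟩ := H.exists_lintegral_coordWeight (V := V) hN ha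
  refine ⟨f, ?_, hcf⟩
  have hcw := H.measurable_coordWeight (V := V) (a := a) (m := m)
  have hms := H.measurable_iSup_eig (m := m)
  have hT := hK (fun _ => 1) measurable_const
  simp only [one_mul] at hT
  -- The unknown constant `K` occurs in the normalization and in the integral, and cancels.
  have key : ∀ h : ℝ → ENNReal, Measurable h →
      (∫⁻ c, ENNReal.ofReal (H.coordWeight V a c))⁻¹ *
        ∫⁻ c : HermCoord (m + 1) β, h (⨆ i, H.eig c i) * ENNReal.ofReal (H.coordWeight V a c)
      = ∫⁻ u, h u * ENNReal.ofReal (f u) := fun h hh => by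
    rw [← hI h hh, hT, hK h hh, ENNReal.mul_inv (Or.inl hK0) (Or.inl hKt), mul_mul_mul_comm,
      ENNReal.inv_mul_cancel hK0 hKt, one_mul]
  rw [model_map hΨ]
  simp only [hw]
  set ν : Measure (HermCoord (m + 1) β) := (∫⁻ c, ENNReal.ofReal (H.coordWeight V a c))⁻¹ •
      volume.withDensity fun c => ENNReal.ofReal (H.coordWeight V a c) with hν
  have hl : largestEigenvalue ∘ Ψ = fun c => ⨆ i, H.eig c i := funext hmax
  have hm : AEMeasurable largestEigenvalue (ν.map Ψ) := by
    rw [hΨ.aemeasurable_map_iff, hl]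
    exact hms.aemeasurable
  have hmap : (ν.map Ψ).map largestEigenvalue
      = volume.withDensity fun u => ENNReal.ofReal (f u) := by
    rw [AEMeasurable.map_map_of_aemeasurable hm hΨ.measurable.aemeasurable, hl]
    ext s hs
    have h1 := key (s.indicator fun _ => 1) (measurable_const.indicator hs)
    have h2 : ∀ (x : ℝ) (y : ENNReal), s.indicator (fun _ => (1 : ENNReal)) x * y
        = s.indicator (fun _ => y) x := fun x y => by by_cases hx : x ∈ s <;> simp [hx]
    simp only [h2] at h1
    rw [Measure.map_apply hms hs, withDensity_apply _ hs, hν, Measure.smul_apply,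
      withDensity_apply _ (hms hs), ← lintegral_indicator hs, smul_eq_mul,
      ← lintegral_indicator (hms hs)]
    exact h1
  refine isLargestEigenvaluePDF_of_map ?_ hm hf hf0 hmap
  have h1 := key (fun _ => 1) measurable_const
  have h2 := hI (fun _ => 1) measurable_const
  simp only [one_mul] at h1 h2
  rw [ENNReal.inv_mul_cancel (lintegral_eigDensity_ne_zero hβ ha)
    (lintegral_eigDensity_ne_top hβ ha hdeg hpos hlead)] at h2
  constructor
  rw [hΨ.map_apply, Set.preimage_univ, hν, Measure.smul_apply, withDensity_apply _ .univ,
    Measure.restrict_univ, smul_eq_mul, h1, h2]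

end ExternalSource

/-! ### Spectra and traces in matrix representations. -/

namespace ExternalSource

open MeasureTheory Matrix Module Filter Topology

section Spectral

variable {ι 𝕜 : Type} [Fintype ι] [DecidableEq ι] [RCLike 𝕜]

theorem re_trace_pow_eq_sum {M : Matrix ι ι 𝕜} (hM : M.IsHermitian) (k : ℕ) :
    RCLike.re (M ^ k).trace = ∑ i, hM.eigenvalues i ^ k := by
  conv_lhs => rw [hM.spectral_theorem]
  rw [← map_pow, Unitary.conjStarAlgAut_apply, trace_mul_cycle, Unitary.coe_star_mul_self,
    one_mul, diagonal_pow, trace_diagonal, map_sum]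
  refine Finset.sum_congr rfl fun i _ => ?_
  rw [Pi.pow_apply, Function.comp_apply, ← RCLike.ofReal_pow, RCLike.ofReal_re]

/-- Proportional power sums force equal sets of values. The factor `r` accounts for eigenvalues
repeated by the representation. -/
theorem largestEigenvalue_eq_iSup {κ : Type} [Fintype κ] {M : Matrix ι ι 𝕜} (hM : M.IsHermitian)
    {x : κ → ℝ} {r : ℝ} (hr : r ≠ 0) (h : ∀ k : ℕ, RCLike.re (M ^ k).trace = r * ∑ j, x j ^ k) :
    largestEigenvalue M = ⨆ j, x j := by
  have h1 : ∀ k : ℕ, ∑ i, hM.eigenvalues i ^ k = r * ∑ j, x j ^ k := fun k => by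
    rw [← re_trace_pow_eq_sum, h]
  have h2 : ∀ k : ℕ, ∑ j, x j ^ k = r⁻¹ * ∑ i, hM.eigenvalues i ^ k := fun k => by
    rw [h1, inv_mul_cancel_left₀ hr]
  rw [largestEigenvalue, hM.spectrum_real_eq_range_eigenvalues,
    (range_subset_of_psum h1).antisymm (range_subset_of_psum h2), sSup_range]

theorem re_trace_aeval {κ : Type} [Fintype κ] {M : Matrix ι ι 𝕜} {x : κ → ℝ} {r : ℝ}
    (h : ∀ k : ℕ, RCLike.re (M ^ k).trace = r * ∑ j, x j ^ k) (p : Polynomial ℝ) :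
    RCLike.re (Polynomial.aeval M p).trace = r * ∑ j, p.eval (x j) := by
  induction p using Polynomial.induction_on' with
  | add p q hp hq =>
    simp only [map_add, trace_add, hp, hq, Polynomial.eval_add, Finset.sum_add_distrib, mul_add]
  | monomial k b =>
    simp only [Polynomial.eval_monomial, Polynomial.aeval_monomial]
    rw [← Algebra.smul_def, trace_smul, RCLike.smul_re, h, ← Finset.mul_sum]
    ring

instance [MeasurableSpace 𝕜] [BorelSpace 𝕜] : BorelSpace (Matrix ι ι 𝕜) :=
  inferInstanceAs (BorelSpace (ι → ι → 𝕜))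

end Spectral

/-- The contour formula for a matrix model which is the image, under a matrix representation, of
the Hermitian matrices over `F`. -/
theorem HurwitzFrame.exists_pdf_model_map {F ι 𝕜 : Type} [NormedDivisionRing F] [NormedAlgebra ℝ F]
    [StarRing F] [StarModule ℝ F] {β m N : ℕ} [NeZero β] (H : HurwitzFrame F β) [Fintype ι]
    [DecidableEq ι] [RCLike 𝕜] [MeasurableSpace 𝕜] [BorelSpace 𝕜] {V W : Polynomial ℝ} {a r : ℝ}
    (hN : (m + 1) * β = 2 * (N + 1)) (ha : 0 < a)
    (hdeg : Even V.natDegree) (hpos : 0 < V.natDegree) (hlead : 0 < V.leadingCoeff)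
    {A : Matrix ι ι 𝕜} (φ : Matrix (Fin (m + 1)) (Fin (m + 1)) F →ₐ[ℝ] Matrix ι ι 𝕜)
    (hφ : Function.Injective φ) (hstar : ∀ X, φ Xᴴ = (φ X)ᴴ) (hr : r ≠ 0)
    (htr : ∀ X, RCLike.re (φ X).trace = r * H.rtr X)
    (hW : ∀ x, r * W.eval x = (β : ℝ) / 2 * V.eval x)
    (hA : ∀ c : HermCoord (m + 1) β,
      RCLike.re (A * φ (H.herm c)).trace = (β : ℝ) / 2 * a * c.1 0) :
    ∃ f : ℝ → ℝ,
      IsLargestEigenvaluePDF (model (volume.map fun c => φ (H.herm c)) (m + 1) W A) f ∧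
      HasContourFormula β (m + 1) V a f := by
  have hF := H.finiteDimensional
  have hcont : Continuous fun c : HermCoord (m + 1) β => φ (H.herm c) :=
    (LinearMap.continuous_of_finiteDimensional φ.toLinearMap).comp H.continuous_herm
  -- An injective continuous map from a Polish space is a measurable embedding. Densities can
  -- therefore be computed in coordinates.
  have hemb : MeasurableEmbedding fun c : HermCoord (m + 1) β => φ (H.herm c) := by
    refine hcont.measurableEmbedding fun c d hcd => ?_
    rw [← H.coordOf_herm c, hφ hcd, H.coordOf_herm]
  have hherm : ∀ c : HermCoord (m + 1) β, (φ (H.herm c)).IsHermitian := fun c => by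
    rw [IsHermitian, ← hstar, (H.isHermitian_herm c).eq]
  have hpow : ∀ (c : HermCoord (m + 1) β) (k : ℕ),
      RCLike.re (φ (H.herm c) ^ k).trace = r * ∑ j, H.eig c j ^ k := fun c k => by
    rw [← map_pow, htr, H.rtr_herm_pow]
  refine H.exists_pdf_model hN ha hdeg hpos hlead hemb (fun c => ?_) fun c =>
    largestEigenvalue_eq_iSup (hherm c) hr (hpow c)
  rw [weight, coordWeight, trace_sub, map_sub, re_trace_aeval (hpow c), hA, Finset.mul_sum,
    Finset.sum_congr rfl fun j _ => hW (H.eig c j), ← Finset.mul_sum]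
  congr 1
  ring

end ExternalSource

namespace ExternalSource

open MeasureTheory Matrix Module Filter Topology Quaternion

/-! ### The three models -/

/-- The frame `1` of the real numbers. -/
noncomputable def realFrame : HurwitzFrame ℝ 1 where
  re := LinearMap.id
  e := fun _ => 1
  sum_re_smul q := by simp
  re_mul_star k l := by simp [Subsingleton.elim k l]
  re_mul_comm p q := mul_comm p q
  re_one := rfl
  algebraMap_re q _ := rfl
  sum_mul_mul q := by simp; ring

/-- The frame `1, i` of the complex numbers. -/
noncomputable def complexFrame : HurwitzFrame ℂ 2 where
  re := Complex.reLm
  e := ![1, Complex.I]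
  sum_re_smul q := by apply Complex.ext <;> simp [Fin.sum_univ_two]
  re_mul_star k l := by fin_cases k <;> fin_cases l <;> simp
  re_mul_comm p q := by rw [mul_comm]
  re_one := by simp
  algebraMap_re q h := Complex.conj_eq_iff_re.1 h
  sum_mul_mul q := by apply Complex.ext <;> simp [Fin.sum_univ_two]

/-- The real part of a quaternion, as a linear map. -/
noncomputable def quaternionRe : ℍ[ℝ] →ₗ[ℝ] ℝ where
  toFun q := q.re
  map_add' := Quaternion.re_add
  map_smul' r q := Quaternion.re_smul q r

theorem quaternionRe_apply (q : ℍ[ℝ]) : quaternionRe q = q.re := rfl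

/-- The quaternions `1, i, j, k`. -/
noncomputable def quaternionUnit (l : Fin 4) : ℍ[ℝ] :=
  (Quaternion.equivTuple ℝ).symm (Pi.single l 1)

theorem re_quaternionUnit (l : Fin 4) : (quaternionUnit l).re = if 0 = l then 1 else 0 :=
  Pi.single_apply l 1 0

theorem imI_quaternionUnit (l : Fin 4) : (quaternionUnit l).imI = if 1 = l then 1 else 0 :=
  Pi.single_apply l 1 1

theorem imJ_quaternionUnit (l : Fin 4) : (quaternionUnit l).imJ = if 2 = l then 1 else 0 :=
  Pi.single_apply l 1 2

theorem imK_quaternionUnit (l : Fin 4) : (quaternionUnit l).imK = if 3 = l then 1 else 0 :=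
  Pi.single_apply l 1 3

/-- The frame `1, i, j, k` of the quaternions. -/
noncomputable def quaternionFrame : HurwitzFrame ℍ[ℝ] 4 where
  re := quaternionRe
  e := quaternionUnit
  sum_re_smul q := by
    ext <;> simp [Fin.sum_univ_four, quaternionRe_apply, re_quaternionUnit, imI_quaternionUnit,
      imJ_quaternionUnit, imK_quaternionUnit]
  re_mul_star k l := by
    fin_cases k <;> fin_cases l <;> simp [quaternionRe_apply, re_quaternionUnit, imI_quaternionUnit,
      imJ_quaternionUnit, imK_quaternionUnit]
  re_mul_comm p q := by
    simp only [quaternionRe_apply, Quaternion.re_mul]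
    ring
  re_one := by simp [quaternionRe_apply]
  algebraMap_re q h := by
    rw [Quaternion.star_eq_self] at h
    exact h.symm
  sum_mul_mul q := by
    ext <;> simp [Fin.sum_univ_four, re_quaternionUnit, imI_quaternionUnit,
      imJ_quaternionUnit, imK_quaternionUnit] <;> ring

end ExternalSource

/-! ### Lebesgue measures on symmetric and Hermitian matrices in coordinates. -/

namespace ExternalSource

open MeasureTheory Matrix Module Filter Topology Quaternion

variable {n : ℕ}

theorem measurable_hermitianOf {𝕜 : Type} [RCLike 𝕜] [MeasurableSpace 𝕜] [BorelSpace 𝕜] :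
    Measurable fun c : (Fin n → ℝ) × (OffDiag n → 𝕜) => hermitianOf c.1 c.2 := by
  refine measurable_pi_iff.2 fun i => measurable_pi_iff.2 fun j => ?_
  simp only [hermitianOf, Matrix.of_apply]
  split_ifs with h h'
  · fun_prop
  · exact continuous_star.measurable.comp (by fun_prop)
  · exact (algebraMapCLM ℝ 𝕜).continuous.measurable.comp (by fun_prop)

/-- A measure preserving change of the coordinates of the entries above the diagonal. -/
theorem map_hermitianOf {𝕜 : Type} {β : ℕ} [RCLike 𝕜] [MeasureSpace 𝕜] [BorelSpace 𝕜]
    [SigmaFinite (volume : Measure 𝕜)] {T : (Fin β → ℝ) → 𝕜} (hT : MeasurePreserving T) :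
    volume.map (fun c : (Fin n → ℝ) × (OffDiag n → 𝕜) => hermitianOf c.1 c.2)
      = volume.map fun c : HermCoord n β => hermitianOf c.1 fun p => T (c.2 p) := by
  have h := (MeasurePreserving.id (volume : Measure (Fin n → ℝ))).prod
    (volume_preserving_pi fun _ : OffDiag n => hT)
  rw [Measure.volume_eq_prod, ← h.map_eq, Measure.map_map measurable_hermitianOf h.measurable]
  rfl

theorem lebesgueSymmetric_eq : lebesgueSymmetric n = volume.map realFrame.herm := by
  rw [lebesgueSymmetric, map_hermitianOf (volume_preserving_funUnique (Fin 1) ℝ)]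
  congr 1
  funext c
  rw [HurwitzFrame.herm]
  congr 1
  funext p
  rw [HurwitzFrame.coord_symm_apply]
  simp [realFrame]

theorem lebesgueHermitian_eq : lebesgueHermitian n = volume.map complexFrame.herm := by
  rw [lebesgueHermitian, map_hermitianOf Complex.volume_preserving_equiv_pi.symm]
  congr 1
  funext c
  rw [HurwitzFrame.herm]
  congr 1
  funext p
  rw [HurwitzFrame.coord_symm_apply]
  simp [complexFrame, Fin.sum_univ_two]

theorem re_trace_source_mul {𝕜 : Type} [RCLike 𝕜] (a : ℝ) (M : Matrix (Fin (n + 1)) (Fin (n + 1)) 𝕜) :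
    RCLike.re (source 𝕜 (n + 1) a * M).trace = a * RCLike.re (M 0 0) := by
  simp [source, trace, diagonal_mul]

end ExternalSource

/-! ### Quaternionic matrices as complex matrices, and the final assembly. -/

namespace ExternalSource

open MeasureTheory Matrix Module Filter Topology Quaternion

section Quaternionic

instance : StarModule ℝ ℍ[ℝ] where
  star_smul r q := by
    ext <;> simp

/-- The representation of the quaternions by complex `2 × 2` blocks. -/
noncomputable def quaternionRep : ℍ[ℝ] →ₐ[ℝ] Matrix (Fin 2) (Fin 2) ℂ where
  toFun q := quaternionBlock ![q.re, q.imI, q.imJ, q.imK]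
  map_one' := by
    ext i j
    fin_cases i <;> fin_cases j <;> simp [quaternionBlock]
  map_mul' p q := by
    ext i j
    fin_cases i <;> fin_cases j <;> simp [quaternionBlock, Matrix.mul_apply, Fin.sum_univ_two] <;>
      ring_nf <;> simp only [Complex.I_sq] <;> ring
  map_zero' := by
    ext i j
    fin_cases i <;> fin_cases j <;> simp [quaternionBlock]
  map_add' p q := by
    ext i j
    fin_cases i <;> fin_cases j <;> simp [quaternionBlock] <;> ring
  commutes' r := by
    have h : algebraMap ℝ ℍ[ℝ] r = (r : ℍ[ℝ]) := rfl
    ext i j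
    simp only [h]
    fin_cases i <;> fin_cases j <;> simp [quaternionBlock, Matrix.algebraMap_matrix_apply]

theorem quaternionRep_apply (q : ℍ[ℝ]) :
    quaternionRep q = quaternionBlock ![q.re, q.imI, q.imJ, q.imK] := rfl

theorem quaternionRep_coord_symm (c : Fin 4 → ℝ) :
    quaternionRep (quaternionFrame.coord.symm c) = quaternionBlock c := by
  rw [quaternionRep_apply, HurwitzFrame.coord_symm_apply]
  congr 1
  ext i
  fin_cases i <;> simp [quaternionFrame, Fin.sum_univ_four, re_quaternionUnit, imI_quaternionUnit,
      imJ_quaternionUnit, imK_quaternionUnit]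

theorem quaternionRep_star (q : ℍ[ℝ]) : quaternionRep (star q) = (quaternionRep q)ᴴ := by
  ext i j
  fin_cases i <;> fin_cases j <;> simp [quaternionRep_apply, quaternionBlock, conjTranspose_apply]

theorem re_trace_quaternionRep (q : ℍ[ℝ]) : (quaternionRep q).trace.re = 2 * q.re := by
  simp [quaternionRep_apply, quaternionBlock, trace, Fin.sum_univ_two]
  ring

/-- The representation of quaternionic matrices by complex matrices. -/
noncomputable def quaternionMatrixRep (n : ℕ) :
    Matrix (Fin n) (Fin n) ℍ[ℝ] →ₐ[ℝ] Matrix (Fin n × Fin 2) (Fin n × Fin 2) ℂ :=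
  (compAlgEquiv (Fin n) (Fin 2) ℂ ℝ).toAlgHom.comp quaternionRep.mapMatrix

variable {n : ℕ}

theorem quaternionMatrixRep_apply (X : Matrix (Fin n) (Fin n) ℍ[ℝ]) (p q : Fin n × Fin 2) :
    quaternionMatrixRep n X p q = quaternionRep (X p.1 q.1) p.2 q.2 := rfl

theorem quaternionMatrixRep_injective : Function.Injective (quaternionMatrixRep n) := by
  intro X Y h
  -- A ring homomorphism from a division ring to a nontrivial ring is injective.
  have hinj : Function.Injective quaternionRep := quaternionRep.toRingHom.injective
  ext1 i j
  refine hinj (Matrix.ext fun k l => ?_)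
  exact congrFun (congrFun h (i, k)) (j, l)

theorem quaternionMatrixRep_conjTranspose (X : Matrix (Fin n) (Fin n) ℍ[ℝ]) :
    quaternionMatrixRep n Xᴴ = (quaternionMatrixRep n X)ᴴ := by
  ext p q
  rw [conjTranspose_apply, quaternionMatrixRep_apply, quaternionMatrixRep_apply,
    conjTranspose_apply, quaternionRep_star, conjTranspose_apply]

theorem re_trace_quaternionMatrixRep (X : Matrix (Fin n) (Fin n) ℍ[ℝ]) :
    (quaternionMatrixRep n X).trace.re = 2 * quaternionFrame.rtr X := by
  have h : (quaternionMatrixRep n X).trace = ∑ i, (quaternionRep (X i i)).trace :=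
    Fintype.sum_prod_type _
  rw [h, Complex.re_sum, HurwitzFrame.rtr, trace, map_sum, Finset.mul_sum]
  exact Finset.sum_congr rfl fun i _ => re_trace_quaternionRep _

theorem lebesgueSelfDual_eq :
    lebesgueSelfDual n = volume.map fun c => quaternionMatrixRep n (quaternionFrame.herm c) := by
  rw [lebesgueSelfDual]
  congr 1
  funext c
  ext p q
  rw [quaternionMatrixRep_apply, comp_apply]
  rcases lt_trichotomy p.1 q.1 with h | h | h
  · rw [HurwitzFrame.herm_lt _ _ h, quaternionRep_coord_symm]
    simp [hermitianOf, h]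
  · rw [h, HurwitzFrame.herm_diag, AlgHom.commutes]
    simp [hermitianOf]
  · rw [HurwitzFrame.herm_gt _ _ h, quaternionRep_star, quaternionRep_coord_symm]
    simp [hermitianOf, h, h.not_gt, star_eq_conjTranspose]

theorem re_trace_sourceDoubled_mul (a : ℝ)
    (M : Matrix (Fin (n + 1) × Fin 2) (Fin (n + 1) × Fin 2) ℂ) :
    (sourceDoubled (n + 1) a * M).trace.re = a * ((M (0, 0) (0, 0)).re + (M (0, 1) (0, 1)).re) := by
  simp [sourceDoubled, trace, diagonal_mul, Fintype.sum_prod_type, Fin.sum_univ_succ]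
  ring

end Quaternionic

section Main

variable {V : Polynomial ℝ} {a : ℝ} {m : ℕ}

/-- For `m + 1 = 2k` the pole order `(m + 1)/2` is the integer `k = N + 1`. -/
theorem exists_pdf_model₁ (hdeg : Even V.natDegree) (hpos : 0 < V.natDegree)
    (hlead : 0 < V.leadingCoeff) (ha : 0 < a) (hm : Even (m + 1)) : ∃ f : ℝ → ℝ,
    IsLargestEigenvaluePDF (model₁ (m + 1) V a) f ∧ HasContourFormula 1 (m + 1) V a f := by
  obtain ⟨k, hk⟩ := hm
  rw [model₁, lebesgueSymmetric_eq]
  refine realFrame.exists_pdf_model_map (N := k - 1) (r := 1) (by omega) ha hdeg hpos hlead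
    (AlgHom.id ℝ _) Function.injective_id (fun X => rfl) one_ne_zero (fun X => ?_) (fun x => ?_)
    fun c => ?_
  · rw [one_mul]; rfl
  · simp
  · rw [AlgHom.id_apply, smul_mul, trace_smul, RCLike.smul_re, re_trace_source_mul,
      realFrame.herm_diag]
    simp
    ring

/-- Here the pole order is `m + 1`, an integer in every dimension. -/
theorem exists_pdf_model₂ (hdeg : Even V.natDegree) (hpos : 0 < V.natDegree)
    (hlead : 0 < V.leadingCoeff) (ha : 0 < a) : ∃ f : ℝ → ℝ,
    IsLargestEigenvaluePDF (model₂ (m + 1) V a) f ∧ HasContourFormula 2 (m + 1) V a f := by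
  rw [model₂, lebesgueHermitian_eq]
  refine complexFrame.exists_pdf_model_map (N := m) (r := 1) (by omega) ha hdeg hpos hlead
    (AlgHom.id ℝ _) Function.injective_id (fun X => rfl) one_ne_zero (fun X => ?_) (fun x => ?_)
    fun c => ?_
  · rw [one_mul]; rfl
  · simp
  · rw [AlgHom.id_apply, re_trace_source_mul, complexFrame.herm_diag]
    simp

/-- The pole order is `2(m + 1)`. The factor `r = 2` is the trace of a block relative to the real
part of its quaternion; it turns the potential `V` into `(β/2) V` and the doubled source into `(β/2)
a`. -/
theorem exists_pdf_model₄ (hdeg : Even V.natDegree) (hpos : 0 < V.natDegree)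
    (hlead : 0 < V.leadingCoeff) (ha : 0 < a) : ∃ f : ℝ → ℝ,
    IsLargestEigenvaluePDF (model₄ (m + 1) V a) f ∧ HasContourFormula 4 (m + 1) V a f := by
  rw [model₄, lebesgueSelfDual_eq]
  refine quaternionFrame.exists_pdf_model_map (N := 2 * m + 1) (r := 2) (by omega) ha hdeg hpos
    hlead (quaternionMatrixRep _) quaternionMatrixRep_injective quaternionMatrixRep_conjTranspose
    two_ne_zero re_trace_quaternionMatrixRep (fun x => ?_) fun c => ?_
  · norm_num
  · rw [RCLike.re_eq_complex_re, re_trace_sourceDoubled_mul, quaternionMatrixRep_apply,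
      quaternionMatrixRep_apply, quaternionFrame.herm_diag, AlgHom.commutes]
    simp [Matrix.algebraMap_matrix_apply]
    ring

end Main

end ExternalSource

theorem mainTheorem5 (V : Polynomial ℝ) (hdeg : Even V.natDegree) (hpos : 0 < V.natDegree)
    (hlead : 0 < V.leadingCoeff) (a : ℝ) (ha : 0 < a) (n : ℕ) (hn : 1 ≤ n) :
    (Even n → ∃ f : ℝ → ℝ,
      ExternalSource.IsLargestEigenvaluePDF (ExternalSource.model₁ n V a) f ∧
      ExternalSource.HasContourFormula 1 n V a f) ∧
    (∃ f : ℝ → ℝ,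
      ExternalSource.IsLargestEigenvaluePDF (ExternalSource.model₂ n V a) f ∧
      ExternalSource.HasContourFormula 2 n V a f) ∧
    (∃ f : ℝ → ℝ,
      ExternalSource.IsLargestEigenvaluePDF (ExternalSource.model₄ n V a) f ∧
      ExternalSource.HasContourFormula 4 n V a f) := by
  obtain ⟨m, rfl⟩ := Nat.exists_eq_add_of_le' hn
  exact ⟨ExternalSource.exists_pdf_model₁ hdeg hpos hlead ha,
    ExternalSource.exists_pdf_model₂ hdeg hpos hlead ha,
    ExternalSource.exists_pdf_model₄ hdeg hpos hlead ha⟩
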